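/- **Setting.** Let $H$ be a separable complex Hilbert space (with inner product linear in the first argument), $(f\otimes g)v=\langle v,g\rangle f$, and let $\|\cdot\|_2$ be the Hilbert–Schmidt norm on operators. Let $(\epsilon_t)_{t\in\mathbb Z}$ be i.i.d. random elements of a measurable space $S$, let $(\epsilon'_t)_{t\in\mathbb Z}$ be an independent copy of this sequence on the same probability space, let $g:S^{\mathbb N}\to H$ be (strongly) measurable, and let $X_t=g(\epsilon_t,\epsilon_{t-1},\dots)$. Let $\mathcal G_{t,\{0\}}=\sigma(\epsilon_{s,\{0\}}: s\le t)$, where $\epsilon_{0,\{0\}}=\epsilon'_0$ and $\epsilon_{s,\{0\}}=\epsilon_s$ for $s\neq0$. *Dependence condition with $p=4$:* $E X_t=0$, $E\|X_t\|^4<\infty$ and $\sum_{j=0}^\infty \big(E\|X_j-E[X_j\mid\mathcal G_{j,\{0\}}]\|^4\big)^{1/4}<\infty$. *Window assumptions:* $w:\mathbb R\to\mathbb R$ is even and bounded, $\lim_{x\to0}w(x)=1=w(0)$, $w$ is continuous except at finitely many points, $\kappa=\int_{\mathbb R} w^2(x)\,dx<\infty$, $\lim_{b\downarrow0} b\sum_{h\in\mathbb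 Z}w^2(bh)=\kappa$, and $\sup_{0<b\le1} b\sum_{|h|\ge M/b}w^2(bh)\to0$ as $M\to\infty$. With $C_h=E(X_h\otimes X_0)$ put $$F^\lambda=\frac1{2\pi}\sum_{h\in\mathbb Z}C_he^{-i\lambda h},\qquad \hat F_T^\lambda=\frac1{2\pi T}\sum_{s,t=1}^T w(b_T(t-s))\,e^{i\lambda(t-s)}\,X_s\otimes X_t .$$ An *eigensystem* of an operator $A$ on $H$ consists of real numbers $\beta_j$ and orthonormal vectors $\phi_j$, $1\le j\le\dim H$ ($j\ge1$ if $\dim H=\infty$), with $A=\sum_j\beta_j\,\phi_j\otimes\phi_j$ in operator norm and $|\beta_1|\ge|\beta_2|\ge\cdots$; $\Pi_j=\phi_j\otimes\phi_j$ is the $j$-th eigenprojector. (For non-negative definite $A$, all $\beta_j$ are non-negative and this is the usual non-increasing enumeration.) **Proposition 4.2.** Assume the dependence condition with $p=4$ and the window assumptions, and let $b_T\to0$ and $b_TT\to\infty$ as $T\to\infty$. Let $\lambda\in[0,\pi]$. Then $\sum_{h\in\mathbb Z}\|C_h\|<\infty$ in operator norm, and $F^\lambda$ and every realization of $\hat F^\lambda_T$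 have eigensystems. Let $(\beta_j^\lambda,\phi_j^\lambda)_j$ be any eigensystem of $F^\lambda$, with eigenprojectors $\Pi_j^\lambda$, and let $(\hat\beta_j^\lambda,\hat\phi_j^\lambda)_j$ be, for each $T$ and each outcome, any eigensystem of $\hat F_T^\lambda$, with eigenprojectors $\hat\Pi_j^\lambda$. Then for each $j$ with $1\le j\le\dim H$: (i) $|\hat\beta_j^\lambda-\beta_j^\lambda|\to0$ in probability as $T\to\infty$; (ii) if in addition $\inf_{l\ne j}|\beta_j^\lambda-\beta_l^\lambda|>0$, then $\|\hat\Pi_j^\lambda-\Pi_j^\lambda\|_2\to0$ in probability as $T\to\infty$. (Convergence in probability is understood in outer probability if the chosen eigenelements are not measurable.) -/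

import Mathlib

open MeasureTheory ProbabilityTheory Filter Topology
open scoped ENNReal

noncomputable section

namespace FTS

/-! ### Causal Bernoulli shifts and the physical dependence coefficients -/

section Shift

variable {Ω S H : Type*} [MeasurableSpace Ω] [MeasurableSpace S]
  [NormedAddCommGroup H] [InnerProductSpace ℂ H]

/-- The process `X_t = g(ε_t, ε_{t-1}, …)`, `t ∈ ℤ`. -/
def shiftProcess (g : (ℕ → S) → H) (ε : ℤ → Ω → S) (t : ℤ) (ω : Ω) : H :=
  g fun k => ε (t - k) ω

open Classical in
/-- The coupled innovations `ε_{t,I}`: equal to `ε'_t` if `t ∈ I` and to `ε_t` if `t ∉ I`. -/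
def coupled (ε ε' : ℤ → Ω → S) (I : Set ℤ) (t : ℤ) : Ω → S :=
  if t ∈ I then ε' t else ε t

/-- The σ-algebra `𝒢_{t,I} = σ(ε_{t,I}, ε_{t-1,I}, …)`. -/
@[reducible] def coupledPast (ε ε' : ℤ → Ω → S) (I : Set ℤ) (t : ℤ) : MeasurableSpace Ω :=
  ⨆ k : ℕ, MeasurableSpace.comap (coupled ε ε' I (t - k)) inferInstance

/-- The dependence coefficient `ν_{H,p}(X_t) = ‖X_t - E[X_t | 𝒢_{t,{0}}]‖_{H,p}`, where
`‖Y‖_{H,p} = (E ‖Y‖^p)^{1/p}`. -/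
def dependenceCoeff [CompleteSpace H] (P : Measure Ω) (p : ℝ≥0∞) (g : (ℕ → S) → H)
    (ε ε' : ℤ → Ω → S) (t : ℤ) : ℝ≥0∞ :=
  eLpNorm (shiftProcess g ε t - P[shiftProcess g ε t | coupledPast ε ε' {0} t]) p P

/-- The innovations `ε` are i.i.d. and `ε'` is an independent copy of the whole sequence `ε`. -/
structure IsInnovationPair (P : Measure Ω) (ε ε' : ℤ → Ω → S) : Prop where
  measurable : ∀ t, Measurable (ε t)
  measurable' : ∀ t, Measurable (ε' t)
  iIndep : iIndepFun ε P
  identDistrib : ∀ t, IdentDistrib (ε t) (ε 0) P P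
  copy : IdentDistrib (fun ω t => ε' t ω) (fun ω t => ε t ω) P P
  indep_copy : IndepFun (fun ω t => ε t ω) (fun ω t => ε' t ω) P

/-- The dependence condition of order `p`: `X_t = g(ε_t, ε_{t-1}, …)` is centred, lies in
`L^p_H`, and `∑_{j ≥ 0} ν_{H,p}(X_j) < ∞`. -/
structure DependenceCondition [CompleteSpace H] (P : Measure Ω) (p : ℝ≥0∞)
    (g : (ℕ → S) → H) (ε ε' : ℤ → Ω → S) : Prop where
  innovations : IsInnovationPair P ε ε'
  measurable_g : StronglyMeasurable g
  memLp : ∀ t, MemLp (shiftProcess g ε t) p P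
  centred : ∀ t, ∫ ω, shiftProcess g ε t ω ∂P = 0
  summable_coeff : ∑' j : ℕ, dependenceCoeff P p g ε ε' j < ∞

end Shift

/-! ### Windows -/

/-- The window assumptions. The series, the integral and the supremum are taken in `[0, ∞]`. -/
structure IsWindow (w : ℝ → ℝ) : Prop where
  even : ∀ x, w (-x) = w x
  bounded : ∃ M : ℝ, ∀ x, |w x| ≤ M
  /-- `w(x) → 1` as `x → 0`, and `w(0) = 1`. -/
  tendsto_zero : Tendsto w (𝓝 0) (𝓝 1)
  finite_discontinuities : {x | ¬ ContinuousAt w x}.Finite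
  sq_integrable : ∫⁻ x, ENNReal.ofReal (w x ^ 2) < ∞
  tendsto_riemann :
    Tendsto (fun b : ℝ => ENNReal.ofReal b * ∑' h : ℤ, ENNReal.ofReal (w (b * h) ^ 2))
      (𝓝[>] 0) (𝓝 (∫⁻ x, ENNReal.ofReal (w x ^ 2)))
  tendsto_tail :
    Tendsto (fun M : ℝ => ⨆ b ∈ Set.Ioc (0 : ℝ) 1,
        ENNReal.ofReal b * ∑' h : {h : ℤ // M / b ≤ |(h : ℝ)|},
          ENNReal.ofReal (w (b * (h : ℤ)) ^ 2))
      atTop (𝓝 0)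

/-! ### The spectral density operator and its lag window estimator

`InnerProductSpace.rankOne ℂ f g` is the operator `f ⊗ g : v ↦ ⟨v, g⟩ f`
(Mathlib writes this inner product, linear in `v`, as `inner ℂ g v`). -/

section Operators

variable {Ω H : Type*} [MeasurableSpace Ω] [NormedAddCommGroup H] [InnerProductSpace ℂ H]

/-- The lag-`h` covariance operator `C_h = E(X_h ⊗ X_0)` of a centred process. -/
def covOp (P : Measure Ω) (X : ℤ → Ω → H) (h : ℤ) : H →L[ℂ] H :=
  ∫ ω, InnerProductSpace.rankOne ℂ (X h ω) (X 0 ω) ∂P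

/-- The spectral density operator `F^θ = (2π)⁻¹ ∑_{h ∈ ℤ} e^{-iθh} C_h`. -/
def spectralDensityOp (P : Measure Ω) (X : ℤ → Ω → H) (θ : ℝ) : H →L[ℂ] H :=
  (1 / (2 * Real.pi) : ℂ) • ∑' h : ℤ, Complex.exp (-(Complex.I * θ * h)) • covOp P X h

/-- The lag window estimator
`F̂_T^θ = (2πT)⁻¹ ∑_{s,t=1}^T w(b(t-s)) e^{iθ(t-s)} X_s ⊗ X_t` with bandwidth `b`. -/
def spectralEstimator (w : ℝ → ℝ) (b : ℝ) (X : ℤ → Ω → H) (T : ℕ) (θ : ℝ) (ω : Ω) :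
    H →L[ℂ] H :=
  (1 / (2 * Real.pi * T) : ℂ) • ∑ s ∈ Finset.Icc (1 : ℤ) T, ∑ t ∈ Finset.Icc (1 : ℤ) T,
    ((w (b * ((t : ℝ) - s)) : ℂ) * Complex.exp (Complex.I * θ * ((t : ℂ) - s))) •
      InnerProductSpace.rankOne ℂ (X s ω) (X t ω)

end Operators

/-! ### Eigenvalues and eigenprojectors -/

section Eigen

variable {H : Type*} [NormedAddCommGroup H] [InnerProductSpace ℂ H]

/-- The indices of an eigenvalue sequence (starting at `0`): all of `ℕ` if `H` is
infinite-dimensional, and `{0, …, dim H - 1}` otherwise. -/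
def eigenIndex (H : Type*) [NormedAddCommGroup H] [InnerProductSpace ℂ H] : Set ℕ :=
  {j | FiniteDimensional ℂ H → j < Module.finrank ℂ H}

/-- `(β_j)` are the eigenvalues, repeated according to multiplicity, and `(φ_j)` orthonormal
eigenvectors in a spectral representation `A = ∑_j β_j φ_j ⊗ φ_j` (in operator norm). The order
is non-increasing in `|β_j|`; for a non-negative definite `A` all `β_j` are non-negative, and this
is the non-increasing order. In finite dimension both sequences are continued by `0` from the index
`dim H` on. -/
structure IsEigensystem (A : H →L[ℂ] H) (β : ℕ → ℝ) (φ : ℕ → H) : Prop where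
  antitone_abs : Antitone fun j => |β j|
  orthonormal : Orthonormal ℂ fun j : eigenIndex H => φ j
  padding : ∀ j ∉ eigenIndex H, β j = 0 ∧ φ j = 0
  hasSum : HasSum (fun j => (β j : ℂ) • InnerProductSpace.rankOne ℂ (φ j) (φ j)) A

/-- The eigenvalue with index `j` is isolated: `inf_{l ≠ j} |β_j - β_l| > 0`. -/
def IsIsolatedEigenvalue (H : Type*) [NormedAddCommGroup H] [InnerProductSpace ℂ H]
    (β : ℕ → ℝ) (j : ℕ) : Prop :=
  ∃ δ > 0, ∀ l ∈ eigenIndex H, l ≠ j → δ ≤ |β j - β l|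

/-- The Hilbert–Schmidt norm `(∑_i ‖A χ_i‖²)^{1/2} ∈ [0, ∞]`, computed in the orthonormal
basis `χ`. -/
def hsNorm {ι : Type*} (χ : HilbertBasis ι ℂ H) (A : H →L[ℂ] H) : ℝ≥0∞ :=
  (∑' i, ‖A (χ i)‖ₑ ^ 2) ^ (1 / 2 : ℝ)

end Eigen

end FTS

end

/-! Write `D_{k,t}` (`shiftDiff`) for the part of `X_t` contributed by `ε_{t-k}`: the difference of
the conditional expectations of `X_t` given `ε_t, …, ε_{t-k}` and given `ε_t, …, ε_{t-k+1}`. Then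
`X_t = ∑_k D_{k,t}` almost surely, and the `L⁴` norm of `D_{k,t}` is at most the dependence
coefficient `ν_k` of `X_k`, because `D_{k,k}` is a conditional expectation of `X_k - E[X_k |
𝒢_{k,{0}}]` (`ae_hasSum_shiftDiff`, `eLpNorm_shiftDiff_le`). For fixed `k` the variables `D_{k,u+k}`
are martingale differences for the decreasing σ-algebras `σ(ε_v : v ≥ u)`.

Expanding both factors turns the estimator into a sum over pairs `(k, l)` of quadratic forms in
`D_{k,u+k}` and `D_{l,v+l}`. Off the diagonal `u = v`, orthogonality in Hilbert–Schmidt norm and a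
fourth moment inequality bound the form divided by `T` in `L¹` by `4 ν_k ν_l √(κ/(bT))`, where `κ`
bounds `b ∑_h w(bh)²` (`integral_norm_offDiag_le`). On the diagonal the window factor is the
constant `w(b(l-k)) → 1`, and the summands are stationary and finitely dependent, so a law of large
numbers gives the limit `e^{iθ(l-k)} E(D_{k,k} ⊗ D_{l,l})` (`tendsto_integral_norm_diag_sub`). These
limits add up to `2π F^θ` (`hasSum_crossMoment`), and dominated convergence over `(k, l)`, with a
multiple of `ν_k ν_l` as majorant, shows that `F̂` converges to `F` in mean in operator norm
(`tendsto_tsum_integral_norm_lagDev`).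

The rest is deterministic. `2π F^θ` is the mean of `x ⊗ x` with `x = ∑_k e^{-iθk} D_{k,k}`, hence
compact, self-adjoint and non-negative (`spectralDensityOp_properties`). Weyl's dimension count and
non-negativity control the eigenvalues (`IsEigensystem.abs_sub_le`). A gap `δ` bounds `A - β_j`
below on the complement of `φ_j`, which makes the eigenprojectors differ by at most a multiple of
`‖B - A‖ / δ` (`IsEigensystem.hsNorm_sub_le`). -/

namespace FTS

/-! ### Orthonormal families with zero padding -/

section EigenLemmas

open InnerProductSpace

variable {H : Type*} [NormedAddCommGroup H] [InnerProductSpace ℂ H]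

/-- A sequence of pairwise orthogonal vectors, each of norm `1` or zero. -/
structure IsPartialOrthonormal (φ : ℕ → H) : Prop where
  orth : ∀ i j, i ≠ j → inner ℂ (φ i) (φ j) = 0
  unit : ∀ i, φ i = 0 ∨ ‖φ i‖ = 1

lemma IsPartialOrthonormal.norm_le {φ : ℕ → H} (h : IsPartialOrthonormal φ) (i : ℕ) :
    ‖φ i‖ ≤ 1 := by
  rcases h.unit i with h | h <;> simp [h]

lemma IsPartialOrthonormal.norm_sum_sq {φ : ℕ → H} (h : IsPartialOrthonormal φ)
    (s : Finset ℕ) (c : ℕ → ℂ) :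
    ‖∑ i ∈ s, c i • φ i‖ ^ 2 = ∑ i ∈ s, ‖c i‖ ^ 2 * ‖φ i‖ ^ 2 := by
  classical
  induction s using Finset.induction_on with
  | empty => simp
  | insert a s ha ih =>
    have h0 : inner ℂ (c a • φ a) (∑ i ∈ s, c i • φ i) = 0 := by
      rw [inner_sum]
      refine Finset.sum_eq_zero fun i hi => ?_
      rw [inner_smul_left, inner_smul_right, h.orth a i (by rintro rfl; exact ha hi)]
      simp
    rw [Finset.sum_insert ha, Finset.sum_insert ha, ← ih]
    have := norm_add_sq_eq_norm_sq_add_norm_sq_of_inner_eq_zero _ _ h0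
    rw [sq, this, norm_smul]; ring

/-- The partial projection of `v` has squared norm `B` and inner product `B` with `v`, so
Cauchy–Schwarz gives `B² ≤ B ‖v‖²`. -/
lemma IsPartialOrthonormal.bessel {φ : ℕ → H} (h : IsPartialOrthonormal φ)
    (s : Finset ℕ) (v : H) :
    ∑ i ∈ s, ‖inner ℂ (φ i) v‖ ^ 2 ≤ ‖v‖ ^ 2 := by
  set B := ∑ i ∈ s, ‖inner ℂ (φ i) v‖ ^ 2 with hB
  have hB0 : 0 ≤ B := Finset.sum_nonneg fun _ _ => sq_nonneg _
  have h1 : ‖∑ i ∈ s, (inner ℂ (φ i) v) • φ i‖ ^ 2 = B := by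
    rw [h.norm_sum_sq]
    refine Finset.sum_congr rfl fun i _ => ?_
    rcases h.unit i with hi | hi <;> simp [hi]
  have h2 : inner ℂ (∑ i ∈ s, (inner ℂ (φ i) v) • φ i) v = (B : ℂ) := by
    rw [sum_inner, hB]
    push_cast
    refine Finset.sum_congr rfl fun i _ => ?_
    rw [inner_smul_left, ← Complex.normSq_eq_conj_mul_self, Complex.normSq_eq_norm_sq]
    push_cast; rfl
  have h3 := norm_inner_le_norm (𝕜 := ℂ) (∑ i ∈ s, (inner ℂ (φ i) v) • φ i) v
  rw [h2, Complex.norm_real, Real.norm_of_nonneg hB0] at h3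
  have h4 : B ^ 2 ≤ B * ‖v‖ ^ 2 := by
    calc B ^ 2 ≤ (‖∑ i ∈ s, (inner ℂ (φ i) v) • φ i‖ * ‖v‖) ^ 2 := by gcongr
      _ = _ := by rw [mul_pow, h1]
  rcases hB0.eq_or_lt with h5 | h5
  · rw [← h5]; positivity
  · exact le_of_mul_le_mul_left (by rw [← sq]; exact h4) h5

/-- The second alternative in `ha` lets `IsEigensystem.norm_apply_le` ignore the leading eigenvalues
when `v` is orthogonal to their eigenvectors. -/
lemma IsPartialOrthonormal.norm_sum_smul_inner_le {φ : ℕ → H} (h : IsPartialOrthonormal φ)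
    (s : Finset ℕ) (a : ℕ → ℂ) {c : ℝ} (hc : 0 ≤ c) (v : H)
    (ha : ∀ i ∈ s, ‖a i‖ ≤ c ∨ inner ℂ (φ i) v = 0) :
    ‖∑ i ∈ s, a i • (inner ℂ (φ i) v) • φ i‖ ≤ c * ‖v‖ := by
  refine le_of_sq_le_sq ?_ (by positivity)
  simp_rw [smul_smul]
  rw [h.norm_sum_sq, mul_pow]
  refine le_trans ?_ (mul_le_mul_of_nonneg_left (h.bessel s v) (sq_nonneg c))
  rw [Finset.mul_sum]
  refine Finset.sum_le_sum fun i hi => ?_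
  rcases ha i hi with h1 | h1
  · rw [norm_mul, mul_pow]
    have h2 := h.norm_le i
    calc ‖a i‖ ^ 2 * ‖inner ℂ (φ i) v‖ ^ 2 * ‖φ i‖ ^ 2
        ≤ c ^ 2 * ‖inner ℂ (φ i) v‖ ^ 2 * 1 ^ 2 := by gcongr
      _ = _ := by ring
  · simp [h1]

lemma IsPartialOrthonormal.norm_sum_rankOne_le {φ : ℕ → H} (h : IsPartialOrthonormal φ)
    (s : Finset ℕ) (β : ℕ → ℝ) {c : ℝ} (hc : 0 ≤ c) (hβ : ∀ i ∈ s, |β i| ≤ c) :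
    ‖∑ i ∈ s, (β i : ℂ) • rankOne ℂ (φ i) (φ i)‖ ≤ c := by
  refine ContinuousLinearMap.opNorm_le_bound _ hc fun v => ?_
  have := h.norm_sum_smul_inner_le s (fun i => (β i : ℂ)) hc v
    fun i hi => Or.inl (by simpa using hβ i hi)
  simpa [_root_.sum_apply] using this

lemma mem_eigenIndex_of_le {i j : ℕ} (hij : i ≤ j) (hj : j ∈ eigenIndex H) :
    i ∈ eigenIndex H := fun hfd => hij.trans_lt (hj hfd)

lemma IsPartialOrthonormal.orthonormal {φ : ℕ → H} (h : IsPartialOrthonormal φ) {s : Set ℕ}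
    (hs : ∀ i ∈ s, φ i ≠ 0) : Orthonormal ℂ fun j : s => φ j :=
  ⟨fun i => (h.unit i).resolve_left (hs i i.2), fun i j hij =>
    h.orth i j fun h => hij (Subtype.ext h)⟩

lemma IsPartialOrthonormal.card_le {φ : ℕ → H} (h : IsPartialOrthonormal φ)
    [FiniteDimensional ℂ H] (s : Finset ℕ) (hs : ∀ i ∈ s, φ i ≠ 0) :
    s.card ≤ Module.finrank ℂ H := by
  have := (h.orthonormal (s := (s : Set ℕ)) (by simpa using hs)).linearIndependent
  have h2 := LinearIndependent.fintype_card_le_finrank this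
  simpa using h2

/-! ### Perturbation of eigenvalues and eigenprojectors -/

section Eigensystem

variable {A B : H →L[ℂ] H} {β β' : ℕ → ℝ} {φ φ' : ℕ → H}

lemma IsEigensystem.partialOrthonormal (h : IsEigensystem A β φ) : IsPartialOrthonormal φ := by
  refine ⟨fun i j hij => ?_, fun i => ?_⟩
  · by_cases hi : i ∈ eigenIndex H
    · by_cases hj : j ∈ eigenIndex H
      · exact h.orthonormal.2 (i := ⟨i, hi⟩) (j := ⟨j, hj⟩) (by simpa using hij)
      · simp [(h.padding j hj).2]
    · simp [(h.padding i hi).2]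
  · by_cases hi : i ∈ eigenIndex H
    · exact Or.inr (h.orthonormal.1 ⟨i, hi⟩)
    · exact Or.inl (h.padding i hi).2

lemma IsEigensystem.norm_eq_one (h : IsEigensystem A β φ) {j : ℕ} (hj : j ∈ eigenIndex H) :
    ‖φ j‖ = 1 := h.orthonormal.1 ⟨j, hj⟩

lemma IsEigensystem.hasSum_apply (h : IsEigensystem A β φ) (v : H) :
    HasSum (fun j => (β j : ℂ) • inner ℂ (φ j) v • φ j) (A v) := by
  simpa using (ContinuousLinearMap.apply ℂ H v).hasSum h.hasSum

lemma IsEigensystem.apply_eigenvector (h : IsEigensystem A β φ) (j : ℕ) :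
    A (φ j) = (β j : ℂ) • φ j := by
  have h1 := h.hasSum_apply (φ j)
  have h2 : HasSum (fun i => (β i : ℂ) • inner ℂ (φ i) (φ j) • φ i) ((β j : ℂ) • φ j) := by
    have : (β j : ℂ) • φ j = (β j : ℂ) • inner ℂ (φ j) (φ j) • φ j := by
      rcases h.partialOrthonormal.unit j with hj | hj
      · simp [hj]
      · rw [inner_self_eq_norm_sq_to_K, hj]; simp
    rw [this]
    refine hasSum_single j fun i hi => ?_
    simp [h.partialOrthonormal.orth i j hi]
  exact h1.unique h2

lemma IsEigensystem.norm_apply_le (h : IsEigensystem A β φ) (n : ℕ) (v : H)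
    (hv : ∀ i < n, inner ℂ (φ i) v = 0) : ‖A v‖ ≤ |β n| * ‖v‖ := by
  refine le_of_tendsto (h.hasSum_apply v).norm (Eventually.of_forall fun s => ?_)
  refine h.partialOrthonormal.norm_sum_smul_inner_le s _ (abs_nonneg _) v fun i _ => ?_
  rcases lt_or_ge i n with hi | hi
  · exact Or.inr (hv i hi)
  · left; simpa using h.antitone_abs hi

/-- One half of Weyl's perturbation inequality for the moduli of the eigenvalues. -/
lemma IsEigensystem.abs_le_abs_add (h : IsEigensystem A β φ) (h' : IsEigensystem B β' φ')
    {j : ℕ} (hj : j ∈ eigenIndex H) : |β' j| ≤ |β j| + ‖B - A‖ := by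
  -- Dimension count: `j + 1` unknowns against `j` equations give a nonzero `v` in the span of `φ'
  -- 0, …, φ' j` orthogonal to `φ 0, …, φ (j - 1)`. On it `B` stretches by at least `|β' j|` and `A`
  -- by at most `|β j|`.
  let L : (Fin (j + 1) → ℂ) →ₗ[ℂ] (Fin j → ℂ) :=
    LinearMap.pi fun i => ∑ l : Fin (j + 1), inner ℂ (φ i) (φ' l) • LinearMap.proj l
  obtain ⟨c, hcL, hc0⟩ := (Submodule.ne_bot_iff _).1
    (LinearMap.ker_ne_bot_of_finrank_lt (f := L) (by simp))
  let c' : ℕ → ℂ := fun l => if hl : l < j + 1 then c ⟨l, hl⟩ else 0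
  have hc' : ∀ l : Fin (j + 1), c' l = c l := fun l => by simp only [c', dif_pos l.2]
  set v := ∑ l ∈ Finset.range (j + 1), c' l • φ' l with hv
  have hone : ∀ l ∈ Finset.range (j + 1), ‖φ' l‖ = 1 := fun l hl =>
    h'.norm_eq_one (mem_eigenIndex_of_le (Nat.lt_succ_iff.1 (Finset.mem_range.1 hl)) hj)
  have hvn : ‖v‖ ^ 2 = ∑ l ∈ Finset.range (j + 1), ‖c' l‖ ^ 2 := by
    rw [hv, h'.partialOrthonormal.norm_sum_sq]
    exact Finset.sum_congr rfl fun l hl => by rw [hone l hl]; ring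
  have hv0 : 0 < ‖v‖ := by
    obtain ⟨l, hl⟩ := Function.ne_iff.1 hc0
    have : 0 < ‖v‖ ^ 2 := by
      rw [hvn]
      refine Finset.sum_pos' (fun _ _ => sq_nonneg _) ⟨l, Finset.mem_range.2 l.2, ?_⟩
      rw [hc' l]
      have : 0 < ‖c l‖ := norm_pos_iff.2 hl
      positivity
    exact (norm_nonneg _).lt_of_ne' (by rintro h0; simp [h0] at this)
  have hvo : ∀ i < j, inner ℂ (φ i) v = 0 := fun i hi => by
    have := congrFun (LinearMap.mem_ker.1 hcL) ⟨i, hi⟩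
    simp only [L, LinearMap.pi_apply, LinearMap.sum_apply, LinearMap.smul_apply,
      LinearMap.proj_apply, smul_eq_mul, Pi.zero_apply] at this
    rw [hv, inner_sum, ← this, Finset.sum_range]
    refine Finset.sum_congr rfl fun l _ => ?_
    rw [inner_smul_right, hc', mul_comm]
  have hB : |β' j| * ‖v‖ ≤ ‖B v‖ := by
    refine le_of_sq_le_sq ?_ (norm_nonneg _)
    have : B v = ∑ l ∈ Finset.range (j + 1), ((β' l : ℂ) * c' l) • φ' l := by
      rw [hv, map_sum]
      refine Finset.sum_congr rfl fun l _ => ?_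
      rw [map_smul, h'.apply_eigenvector, smul_smul, mul_comm]
    rw [this, h'.partialOrthonormal.norm_sum_sq, mul_pow, hvn, Finset.mul_sum]
    refine Finset.sum_le_sum fun l hl => ?_
    rw [hone l hl, norm_mul, mul_pow, one_pow, mul_one, Complex.norm_real, Real.norm_eq_abs]
    have := h'.antitone_abs (Nat.lt_succ_iff.1 (Finset.mem_range.1 hl))
    simp only at this
    gcongr
  have hA := h.norm_apply_le j v hvo
  have hd : ‖B v‖ ≤ ‖A v‖ + ‖B - A‖ * ‖v‖ := by
    have h1 : B v = A v + (B - A) v := by simp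
    rw [h1]
    exact (norm_add_le _ _).trans (by gcongr; exact (B - A).le_opNorm v)
  exact le_of_mul_le_mul_right (by nlinarith) hv0

lemma IsEigensystem.re_inner_apply (h : IsEigensystem A β φ) {j : ℕ} (hj : j ∈ eigenIndex H) :
    (inner ℂ (φ j) (A (φ j))).re = β j := by
  rw [h.apply_eigenvector, inner_smul_right, inner_self_eq_norm_sq_to_K, h.norm_eq_one hj]
  simp

lemma IsEigensystem.nonneg (h : IsEigensystem A β φ)
    (hA : ∀ v, 0 ≤ (inner ℂ v (A v)).re) (j : ℕ) : 0 ≤ β j := by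
  by_cases hj : j ∈ eigenIndex H
  · rw [← h.re_inner_apply hj]; exact hA _
  · rw [(h.padding j hj).1]

/-- If `A` is non-negative definite, the eigenvalues of `B` (in order of decreasing modulus) are
close to those of `A`. -/
lemma IsEigensystem.abs_sub_le (h : IsEigensystem A β φ) (h' : IsEigensystem B β' φ')
    (hA : ∀ v, 0 ≤ (inner ℂ v (A v)).re) {j : ℕ} (hj : j ∈ eigenIndex H) :
    |β' j - β j| ≤ 3 * ‖B - A‖ := by
  have h1 := h.abs_le_abs_add h' hj
  have h2 := h'.abs_le_abs_add h hj
  rw [norm_sub_rev] at h2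
  have h3 := h.nonneg hA j
  -- Weyl's inequality controls only moduli; testing `A ≥ 0` on `φ' j` excludes a large negative `β'
  -- j`. The constant 3 comes from the case `β' j < 0`, where `β j ≤ |β' j| + ‖B - A‖ ≤ 2 ‖B - A‖`.
  have h4 : -‖B - A‖ ≤ β' j := by
    have e : (inner ℂ (φ' j) (B (φ' j))).re =
        (inner ℂ (φ' j) (A (φ' j))).re + (inner ℂ (φ' j) ((B - A) (φ' j))).re := by
      rw [← Complex.add_re, ← inner_add_right]; simp
    rw [h'.re_inner_apply hj] at e
    have h5 := Complex.abs_re_le_norm (inner ℂ (φ' j) ((B - A) (φ' j)))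
    have h6 : ‖inner ℂ (φ' j) ((B - A) (φ' j))‖ ≤ ‖B - A‖ := by
      refine (norm_inner_le_norm _ _).trans ?_
      have := (B - A).le_opNorm (φ' j)
      rw [h'.norm_eq_one hj] at this ⊢
      linarith
    have := hA (φ' j)
    have := neg_abs_le (inner ℂ (φ' j) ((B - A) (φ' j))).re
    linarith
  rw [abs_of_nonneg h3] at h1 h2
  have hn := norm_nonneg (B - A)
  rcases abs_cases (β' j) with ⟨e, _⟩ | ⟨e, _⟩ <;> rw [e] at h1 h2 <;> rw [abs_le] <;>
    constructor <;> linarith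

lemma IsEigensystem.inner_apply (h : IsEigensystem A β φ) (i : ℕ) (v : H) :
    inner ℂ (φ i) (A v) = (β i : ℂ) * inner ℂ (φ i) v := by
  have h1 := (innerSL ℂ (φ i)).hasSum (h.hasSum_apply v)
  refine h1.unique ?_
  have h2 : (β i : ℂ) * inner ℂ (φ i) v =
      innerSL ℂ (φ i) ((β i : ℂ) • inner ℂ (φ i) v • φ i) := by
    rcases h.partialOrthonormal.unit i with hi | hi
    · simp [hi]
    · simp [inner_self_eq_norm_sq_to_K, hi]
  rw [h2]
  refine hasSum_single i fun k hk => ?_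
  simp [h.partialOrthonormal.orth i k hk.symm]

lemma IsPartialOrthonormal.pythagoras {φ : ℕ → H} (h : IsPartialOrthonormal φ)
    (s : Finset ℕ) (v : H) :
    ‖v‖ ^ 2 = ∑ i ∈ s, ‖inner ℂ (φ i) v‖ ^ 2 + ‖v - ∑ i ∈ s, inner ℂ (φ i) v • φ i‖ ^ 2 := by
  have h1 : ‖∑ i ∈ s, (inner ℂ (φ i) v) • φ i‖ ^ 2 = ∑ i ∈ s, ‖inner ℂ (φ i) v‖ ^ 2 := by
    rw [h.norm_sum_sq]
    refine Finset.sum_congr rfl fun i _ => ?_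
    rcases h.unit i with hi | hi <;> simp [hi]
  have h2 : inner ℂ (∑ i ∈ s, inner ℂ (φ i) v • φ i)
      (v - ∑ i ∈ s, inner ℂ (φ i) v • φ i) = 0 := by
    rw [sum_inner]
    refine Finset.sum_eq_zero fun i hi => ?_
    rw [inner_smul_left, inner_sub_right, inner_sum, Finset.sum_eq_single i]
    · rcases h.unit i with hi | hi
      · simp [hi]
      · simp [inner_smul_right, inner_self_eq_norm_sq_to_K, hi]
    · intro k _ hk
      simp [inner_smul_right, h.orth i k hk.symm]
    · exact fun h => absurd hi h
  have h3 := norm_add_sq_eq_norm_sq_add_norm_sq_of_inner_eq_zero _ _ h2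
  rw [add_sub_cancel, ← sq, ← sq, ← sq] at h3
  rw [h3, h1]

lemma IsPartialOrthonormal.eq_zero_of_orth {φ : ℕ → H} (h : IsPartialOrthonormal φ)
    [FiniteDimensional ℂ H] (s : Finset ℕ) (hs : ∀ i ∈ s, φ i ≠ 0)
    (hc : s.card = Module.finrank ℂ H) {v : H} (hv : ∀ i ∈ s, inner ℂ (φ i) v = 0) : v = 0 := by
  have hl := (h.orthonormal (s := (s : Set ℕ)) (by simpa using hs)).linearIndependent
  have ht := hl.span_eq_top_of_card_eq_finrank' (by simpa using hc)
  have : ∀ x ∈ Submodule.span ℂ (Set.range fun j : (s : Set ℕ) => φ j), inner ℂ x v = 0 := by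
    intro x hx
    induction hx using Submodule.span_induction with
    | mem x hx => obtain ⟨i, rfl⟩ := hx; exact hv i i.2
    | zero => simp
    | add x y _ _ hx hy => rw [inner_add_left, hx, hy, add_zero]
    | smul a x _ hx => rw [inner_smul_left, hx, mul_zero]
  exact inner_self_eq_zero.1 (this v (ht ▸ Submodule.mem_top))

lemma IsEigensystem.tendsto_zero (h : IsEigensystem A β φ) :
    Tendsto (fun n => |β n|) atTop (𝓝 0) := by
  have h1 := h.hasSum.summable.tendsto_atTop_zero.norm
  rw [norm_zero] at h1
  refine h1.congr fun n => ?_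
  by_cases hn : n ∈ eigenIndex H
  · simp [norm_smul, h.norm_eq_one hn]
  · simp [(h.padding n hn).1]

/-- If the eigenvalue `β j` is separated from the others by `δ`, then `A - β j` is bounded below by
`δ` on the orthogonal complement of `φ j`. -/
lemma IsEigensystem.gap_le (h : IsEigensystem A β φ) {j : ℕ}
    {δ : ℝ} (hδ : 0 < δ) (hgap : ∀ l ∈ eigenIndex H, l ≠ j → δ ≤ |β j - β l|) {v : H}
    (hv : inner ℂ (φ j) v = 0) : δ * ‖v‖ ≤ ‖A v - (β j : ℂ) • v‖ := by
  have hφ := h.partialOrthonormal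
  set y := A v - (β j : ℂ) • v with hy
  -- The part of `v` beyond the first `n` eigenvectors needs `β j` separated from zero. In infinite
  -- dimension this follows from the gap, since the eigenvalues tend to zero; in finite dimension
  -- that part eventually vanishes.
  have key : ∀ᶠ n in atTop, |β n| < δ ∧ ((δ ≤ |β j|) ∨
      v - ∑ i ∈ Finset.range n, inner ℂ (φ i) v • φ i = 0) := by
    refine (h.tendsto_zero.eventually_lt_const hδ).and ?_
    by_cases hfd : FiniteDimensional ℂ H
    · filter_upwards [eventually_ge_atTop (Module.finrank ℂ H)] with n hn
      right
      refine hφ.eq_zero_of_orth (Finset.range (Module.finrank ℂ H)) (fun i hi => ?_) (by simp)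
        fun i hi => ?_
      · have := h.norm_eq_one (j := i) (fun _ => Finset.mem_range.1 hi)
        exact norm_ne_zero_iff.1 (by rw [this]; exact one_ne_zero)
      · have hi' : i ∈ Finset.range n := Finset.mem_range.2 ((Finset.mem_range.1 hi).trans_le hn)
        have h1 := h.norm_eq_one (j := i) (fun _ => Finset.mem_range.1 hi)
        rw [inner_sub_right, inner_sum, Finset.sum_eq_single i, inner_smul_right,
          inner_self_eq_norm_sq_to_K, h1]
        · simp
        · intro k _ hk
          simp [inner_smul_right, hφ.orth i k hk.symm]
        · exact fun h => absurd hi' h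
    · refine Eventually.of_forall fun n => Or.inl ?_
      have h1 : Tendsto (fun l => |β j - β l|) atTop (𝓝 |β j - 0|) :=
        (tendsto_const_nhds.sub ((tendsto_zero_iff_abs_tendsto_zero _).2 h.tendsto_zero)).abs
      rw [sub_zero] at h1
      refine ge_of_tendsto h1 ?_
      filter_upwards [eventually_gt_atTop j] with l hl
      exact hgap l (fun h => absurd h hfd) hl.ne'
  -- Pythagoras splits `v` and `y` along the first `n` eigenvectors. On the remainder `r` one only
  -- has `‖A r‖ ≤ |β n| ‖r‖`, which costs `|β n|`; this disappears as `n → ∞`.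
  have key2 : ∀ᶠ n in atTop, (δ - |β n|) * ‖v‖ ≤ ‖y‖ := by
    filter_upwards [key] with n ⟨hn1, hn2⟩
    refine le_of_sq_le_sq ?_ (norm_nonneg _)
    set r := v - ∑ i ∈ Finset.range n, inner ℂ (φ i) v • φ i with hr
    have hyr : y - ∑ i ∈ Finset.range n, inner ℂ (φ i) y • φ i = A r - (β j : ℂ) • r := by
      have : ∀ i, inner ℂ (φ i) y = ((β i : ℂ) - β j) * inner ℂ (φ i) v := fun i => by
        rw [hy, inner_sub_right, h.inner_apply, inner_smul_right]; ring
      simp_rw [this, hr, map_sub, map_sum, map_smul, h.apply_eigenvector, smul_sub,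
        Finset.smul_sum, hy, sub_mul, sub_smul, Finset.sum_sub_distrib, smul_smul]
      simp_rw [mul_comm (inner ℂ (φ _) v)]
      abel
    have hrr : (δ - |β n|) * ‖r‖ ≤ ‖A r - (β j : ℂ) • r‖ := by
      rcases hn2 with hn2 | hn2
      · have h1 : ‖A r‖ ≤ |β n| * ‖r‖ := by
          refine h.norm_apply_le n r fun i hi => ?_
          have hi' := Finset.mem_range.2 hi
          rw [hr, inner_sub_right, inner_sum, Finset.sum_eq_single i]
          · rcases hφ.unit i with h0 | h0
            · simp [h0]
            · simp [inner_smul_right, inner_self_eq_norm_sq_to_K, h0]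
          · intro k _ hk
            simp [inner_smul_right, hφ.orth i k hk.symm]
          · exact fun h => absurd hi' h
        have h2 := norm_sub_norm_le ((β j : ℂ) • r) (A r)
        rw [norm_smul, Complex.norm_real, Real.norm_eq_abs, norm_sub_rev _ (A r)] at h2
        nlinarith [norm_nonneg r]
      · rw [hn2]; simp
    rw [mul_pow, hφ.pythagoras (Finset.range n) v, hφ.pythagoras (Finset.range n) y, hyr, ← hr,
      mul_add, ← mul_pow _ ‖r‖]
    have hc0 : 0 ≤ δ - |β n| := by linarith
    refine add_le_add ?_ (pow_le_pow_left₀ (by positivity) hrr 2)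
    rw [Finset.mul_sum]
    refine Finset.sum_le_sum fun i _ => ?_
    rw [hy, inner_sub_right, h.inner_apply, inner_smul_right, ← sub_mul, norm_mul, mul_pow]
    by_cases hij : i = j
    · rw [hij, hv]; simp
    by_cases hi : i ∈ eigenIndex H
    · have h1 : δ - |β n| ≤ ‖(β i : ℂ) - β j‖ := by
        rw [← Complex.ofReal_sub, Complex.norm_real, Real.norm_eq_abs, abs_sub_comm]
        linarith [hgap i hi hij, abs_nonneg (β n)]
      gcongr
    · simp [(h.padding i hi).2]
  have h3 : Tendsto (fun n => (δ - |β n|) * ‖v‖) atTop (𝓝 ((δ - 0) * ‖v‖)) :=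
    (tendsto_const_nhds.sub h.tendsto_zero).mul_const _
  rw [sub_zero] at h3
  exact le_of_tendsto h3 key2

/-- Parseval gives `2 - 2|⟨x, y⟩|²` for the squared norm, and `1 - |⟨x, y⟩|²` is the squared length
of the component of `x` orthogonal to `y`. The phases of `x` and `y` play no role, so eigenvectors
need not be aligned. -/
lemma hsNorm_rankOne_sub {ι : Type*} (χ : HilbertBasis ι ℂ H) {x y : H} (hx : ‖x‖ = 1)
    (hy : ‖y‖ = 1) :
    hsNorm χ (rankOne ℂ x x - rankOne ℂ y y) =
      ENNReal.ofReal (2 * ‖x - inner ℂ y x • y‖ ^ 2) ^ (1 / 2 : ℝ) := by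
  have hsum : HasSum (fun i => ‖(rankOne ℂ x x - rankOne ℂ y y) (χ i)‖ ^ 2)
      (2 * ‖x - inner ℂ y x • y‖ ^ 2) := by
    have hx' : inner ℂ x x = (1 : ℂ) := by simp [inner_self_eq_norm_sq_to_K, hx]
    have hy' : inner ℂ y y = (1 : ℂ) := by simp [inner_self_eq_norm_sq_to_K, hy]
    have e : ∀ i, ((‖(rankOne ℂ x x - rankOne ℂ y y) (χ i)‖ ^ 2 : ℝ) : ℂ) =
        inner ℂ x (χ i) * inner ℂ (χ i) x + inner ℂ y (χ i) * inner ℂ (χ i) y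
        - inner ℂ x y * (inner ℂ y (χ i) * inner ℂ (χ i) x)
        - inner ℂ y x * (inner ℂ x (χ i) * inner ℂ (χ i) y) := fun i => by
      have := inner_self_eq_norm_sq_to_K (𝕜 := ℂ) ((rankOne ℂ x x - rankOne ℂ y y) (χ i))
      push_cast
      refine Eq.trans this.symm ?_
      simp only [_root_.sub_apply, rankOne_apply, inner_sub_left, inner_sub_right,
        inner_smul_left, inner_smul_right, inner_conj_symm, hx', hy']
      ring
    have h2 : ((2 * ‖x - inner ℂ y x • y‖ ^ 2 : ℝ) : ℂ) =
        inner ℂ x x + inner ℂ y y - inner ℂ x y * inner ℂ y x - inner ℂ y x * inner ℂ x y := by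
      have := inner_self_eq_norm_sq_to_K (𝕜 := ℂ) (x - inner ℂ y x • y)
      push_cast
      refine Eq.trans (congrArg (fun z => 2 * z) this.symm) ?_
      simp only [inner_sub_left, inner_sub_right,
        inner_smul_left, inner_smul_right, inner_conj_symm, hx', hy']
      ring
    rw [← Complex.hasSum_ofReal, h2]
    simp_rw [e]
    exact (((χ.hasSum_inner_mul_inner x x).add (χ.hasSum_inner_mul_inner y y)).sub
      ((χ.hasSum_inner_mul_inner y x).mul_left _)).sub ((χ.hasSum_inner_mul_inner x y).mul_left _)
  unfold hsNorm
  congr 1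
  rw [← hsum.tsum_eq, ENNReal.ofReal_tsum_of_nonneg (fun _ => sq_nonneg _) hsum.summable]
  refine tsum_congr fun i => ?_
  rw [ENNReal.ofReal_pow (norm_nonneg _), ofReal_norm]

/-- Perturbation bound for an isolated eigenprojector. -/
lemma IsEigensystem.hsNorm_sub_le (h : IsEigensystem A β φ) (h' : IsEigensystem B β' φ')
    (hA : ∀ v, 0 ≤ (inner ℂ v (A v)).re) {j : ℕ} (hj : j ∈ eigenIndex H)
    {δ : ℝ} (hδ : 0 < δ) (hgap : ∀ l ∈ eigenIndex H, l ≠ j → δ ≤ |β j - β l|)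
    {ι : Type*} (χ : HilbertBasis ι ℂ H) :
    hsNorm χ (rankOne ℂ (φ' j) (φ' j) - rankOne ℂ (φ j) (φ j)) ≤
      ENNReal.ofReal (2 * (4 * ‖B - A‖ / δ) ^ 2) ^ (1 / 2 : ℝ) := by
  have h1 := h.norm_eq_one hj
  have h1' := h'.norm_eq_one hj
  rw [hsNorm_rankOne_sub χ h1' h1]
  set v := φ' j - inner ℂ (φ j) (φ' j) • φ j with hv
  have hv0 : inner ℂ (φ j) v = 0 := by
    simp [hv, inner_self_eq_norm_sq_to_K, h1]
  have h2 := h.gap_le hδ hgap hv0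
  -- `v` and `φ' j` differ by a multiple of `φ j`, which `A - β j` annihilates. The constant 4 below
  -- is 3 from the eigenvalue bound plus 1 from `(B - A) (φ' j)`.
  have h3 : A v - (β j : ℂ) • v = ((β' j - β j : ℝ) : ℂ) • φ' j - (B - A) (φ' j) := by
    rw [hv, map_sub, map_smul, h.apply_eigenvector, smul_sub, _root_.sub_apply,
      h'.apply_eigenvector, smul_comm]
    push_cast
    rw [sub_smul]
    abel
  have h4 : ‖A v - (β j : ℂ) • v‖ ≤ 4 * ‖B - A‖ := by
    rw [h3]
    refine (norm_sub_le _ _).trans ?_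
    have h5 := h.abs_sub_le h' hA hj
    have h6 := (B - A).le_opNorm (φ' j)
    rw [norm_smul, Complex.norm_real, Real.norm_eq_abs, h1']
    rw [h1'] at h6
    linarith
  have h5 : ‖v‖ ≤ 4 * ‖B - A‖ / δ := by
    rw [le_div_iff₀ hδ]; linarith
  gcongr

end Eigensystem

lemma isCompactOperator_rankOne (x y : H) : IsCompactOperator (rankOne ℂ x y) := by
  rw [rankOne_def']
  exact (isCompactOperator_of_locallyCompactSpace_dom (innerSL ℂ y)).clm_comp
    (ContinuousLinearMap.toSpanSingleton ℂ x)

/-! ### Spectral theorem for compact self-adjoint operators, by deflation -/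

section Existence

variable [CompleteSpace H]

/-- The spectral radius of a self-adjoint operator equals `‖B‖` and is attained in the spectrum; by
compactness that point, if nonzero, is an eigenvalue, and its eigenvectors are orthogonal to `V ⊆
ker B`. If `B = 0`, any unit vector of `Vᗮ` serves, so that the orthonormal family can be continued
through the kernel. -/
lemma exists_unit_eigenvector {B : H →L[ℂ] H} (hc : IsCompactOperator B) (hs : IsSelfAdjoint B)
    (V : Submodule ℂ H) [FiniteDimensional ℂ V] (hV : V ≠ ⊤) (hBV : ∀ v ∈ V, B v = 0) :
    ∃ p : ℝ × H, ‖p.2‖ = 1 ∧ p.2 ∈ Vᗮ ∧ B p.2 = (p.1 : ℂ) • p.2 ∧ |p.1| = ‖B‖ := by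
  by_cases hB : B = 0
  · have h1 : Vᗮ ≠ ⊥ := fun h => hV ((Submodule.orthogonal_eq_bot_iff).1 h)
    obtain ⟨v, hv, hv0⟩ := (Submodule.ne_bot_iff _).1 h1
    refine ⟨(0, ((‖v‖⁻¹ : ℝ) : ℂ) • v), ?_, Submodule.smul_mem _ _ hv, by simp [hB], by simp [hB]⟩
    simp [norm_smul, hv0]
  · have : Nontrivial (H →L[ℂ] H) := ⟨B, 0, hB⟩
    obtain ⟨z, hz, hzB⟩ := spectrum.exists_nnnorm_eq_spectralRadius B
    rw [B.spectralRadius_eq_nnnorm hs] at hzB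
    have hzn : ‖z‖ = ‖B‖ := congrArg NNReal.toReal (ENNReal.coe_injective hzB)
    have hz0 : z ≠ 0 := by
      rw [← norm_ne_zero_iff, hzn]; exact norm_ne_zero_iff.2 hB
    have hev := (hc.hasEigenvalue_iff_mem_spectrum hz0).2 hz
    have hsym := ContinuousLinearMap.isSelfAdjoint_iff_isSymmetric.1 hs
    have hreal := hsym.conj_eigenvalue_eq_self hev
    obtain ⟨v, hv⟩ := hev.exists_hasEigenvector
    have hv1 : B v = z • v := hv.apply_eq_smul
    have hzr : ((z.re : ℝ) : ℂ) = z := Complex.conj_eq_iff_re.1 hreal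
    refine ⟨(z.re, ((‖v‖⁻¹ : ℝ) : ℂ) • v), ?_, Submodule.smul_mem _ _ ?_, ?_, ?_⟩
    · simp [norm_smul, hv.2]
    · rw [Submodule.mem_orthogonal]
      intro u hu
      have h1 : inner ℂ (B u) v = inner ℂ u (B v) := hsym u v
      rw [hBV u hu, inner_zero_left, hv1, inner_smul_right] at h1
      exact (mul_eq_zero.1 h1.symm).resolve_left hz0
    · simp only [hzr]
      rw [map_smul, hv1, smul_comm]
    · rw [← hzn, ← Real.norm_eq_abs, ← Complex.norm_real, hzr]

open Classical in
/-- A unit vector in `Vᗮ` that is an eigenvector of `B` for an eigenvalue of maximal modulus, with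
this eigenvalue; `(0, 0)` if there is none. -/
noncomputable def eigenPick (B : H →L[ℂ] H) (V : Submodule ℂ H) : ℝ × H :=
  if h : ∃ p : ℝ × H, ‖p.2‖ = 1 ∧ p.2 ∈ Vᗮ ∧ B p.2 = (p.1 : ℂ) • p.2 ∧ |p.1| = ‖B‖ then h.choose
  else 0

lemma eigenPick_spec (B : H →L[ℂ] H) (V : Submodule ℂ H) :
    (‖(eigenPick B V).2‖ = 1 ∧ (eigenPick B V).2 ∈ Vᗮ ∧
      B (eigenPick B V).2 = ((eigenPick B V).1 : ℂ) • (eigenPick B V).2 ∧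
      |(eigenPick B V).1| = ‖B‖) ∨ (eigenPick B V = 0 ∧
      ¬ ∃ p : ℝ × H, ‖p.2‖ = 1 ∧ p.2 ∈ Vᗮ ∧ B p.2 = (p.1 : ℂ) • p.2 ∧ |p.1| = ‖B‖) := by
  unfold eigenPick
  split_ifs with h
  · exact Or.inl h.choose_spec
  · exact Or.inr ⟨rfl, h⟩

/-- Successive removal of eigenvectors: the remaining operator and the span of the eigenvectors
removed so far. -/
noncomputable def deflation (A : H →L[ℂ] H) : ℕ → (H →L[ℂ] H) × Submodule ℂ H
  | 0 => (A, ⊥)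
  | n + 1 =>
    ((deflation A n).1 - ((eigenPick (deflation A n).1 (deflation A n).2).1 : ℂ) •
        rankOne ℂ (eigenPick (deflation A n).1 (deflation A n).2).2
          (eigenPick (deflation A n).1 (deflation A n).2).2,
      (deflation A n).2 ⊔ Submodule.span ℂ {(eigenPick (deflation A n).1 (deflation A n).2).2})

/-- Every compact self-adjoint operator has an eigensystem. -/
lemma exists_isEigensystem {A : H →L[ℂ] H} (hc : IsCompactOperator A) (hs : IsSelfAdjoint A) :
    ∃ (β : ℕ → ℝ) (φ : ℕ → H), IsEigensystem A β φ := by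
  set B : ℕ → H →L[ℂ] H := fun n => (deflation A n).1 with hB
  set V : ℕ → Submodule ℂ H := fun n => (deflation A n).2 with hV
  set β : ℕ → ℝ := fun n => (eigenPick (B n) (V n)).1 with hβ
  set φ : ℕ → H := fun n => (eigenPick (B n) (V n)).2 with hφ
  have hB1 : ∀ n, B (n + 1) = B n - (β n : ℂ) • rankOne ℂ (φ n) (φ n) := fun n => rfl
  have hV1 : ∀ n, V (n + 1) = V n ⊔ Submodule.span ℂ {φ n} := fun n => rfl
  have spec : ∀ n, (‖φ n‖ = 1 ∧ φ n ∈ (V n)ᗮ ∧ B n (φ n) = (β n : ℂ) • φ n ∧ |β n| = ‖B n‖) ∨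
      ((β n = 0 ∧ φ n = 0) ∧
        ¬ ∃ p : ℝ × H, ‖p.2‖ = 1 ∧ p.2 ∈ (V n)ᗮ ∧ B n p.2 = (p.1 : ℂ) • p.2 ∧ |p.1| = ‖B n‖) :=
    fun n => (eigenPick_spec (B n) (V n)).imp_right fun h =>
      ⟨⟨congrArg Prod.fst h.1, congrArg Prod.snd h.1⟩, h.2⟩
  have hVmono : Monotone V := monotone_nat_of_le_succ fun n => by rw [hV1]; exact le_sup_left
  have hφV : ∀ n, φ n ∈ V (n + 1) := fun n => by
    rw [hV1]; exact Submodule.mem_sup_right (Submodule.mem_span_singleton_self _)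
  have hφo : ∀ n, φ n ∈ (V n)ᗮ := fun n => by
    rcases spec n with h | h
    · exact h.2.1
    · rw [h.1.2]; exact zero_mem _
  have hpo : IsPartialOrthonormal φ := by
    have h1 : ∀ i j, i < j → inner ℂ (φ i) (φ j) = 0 := fun i j hij =>
      (Submodule.mem_orthogonal _ _).1 (hφo j) _ (hVmono hij (hφV i))
    refine ⟨fun i j hij => ?_, fun i => (spec i).symm.imp (fun h => h.1.2) (fun h => h.1)⟩
    rcases lt_or_gt_of_ne hij with h | h
    · exact h1 i j h
    · exact inner_eq_zero_symm.1 (h1 j i h)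
  have hBφ : ∀ n, B n (φ n) = (β n : ℂ) • φ n := fun n => by
    rcases spec n with h | h
    · exact h.2.2.1
    · simp [h.1.2]
  have hβB : ∀ n, |β n| ≤ ‖B n‖ := fun n => by
    rcases spec n with h | h
    · exact h.2.2.2.le
    · simp [h.1.1]
  -- These are the conditions for picking the next eigenvector: `B n` vanishes on the span already
  -- removed, and the bound on the dimension keeps `V n` proper for every index below `dim H`.
  have inv : ∀ n, IsCompactOperator (B n) ∧ IsSelfAdjoint (B n) ∧ FiniteDimensional ℂ (V n) ∧
      Module.finrank ℂ (V n) ≤ n ∧ ∀ v ∈ V n, B n v = 0 := by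
    intro n
    induction n with
    | zero =>
      refine ⟨hc, hs, inferInstanceAs (FiniteDimensional ℂ (⊥ : Submodule ℂ H)), ?_, ?_⟩
      · exact (finrank_bot ℂ H).le
      · intro v hv
        rw [(Submodule.mem_bot ℂ).1 hv, map_zero]
    | succ n ih =>
      obtain ⟨h1, h2, h3, h4, h5⟩ := ih
      have hr : IsCompactOperator (rankOne ℂ (φ n) (φ n)) :=
        isCompactOperator_rankOne _ _
      refine ⟨?_, ?_, ?_, ?_, ?_⟩
      · rw [hB1]; exact h1.sub (hr.smul _)
      · rw [hB1]
        refine h2.sub (IsSelfAdjoint.smul (by simp [IsSelfAdjoint]) ?_)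
        exact ContinuousLinearMap.isSelfAdjoint_iff_isSymmetric.2 (isSymmetric_rankOne_self _)
      · rw [hV1]; infer_instance
      · rw [hV1]
        refine (Submodule.finrank_add_le_finrank_add_finrank _ _).trans ?_
        have := finrank_span_le_card (R := ℂ) ({φ n} : Set H)
        simp only [Set.toFinset_singleton, Finset.card_singleton] at this
        omega
      · intro v hv
        rw [hV1] at hv
        obtain ⟨a, ha, c, hc, rfl⟩ := Submodule.mem_sup.1 hv
        obtain ⟨t, rfl⟩ := Submodule.mem_span_singleton.1 hc
        have e1 : inner ℂ (φ n) a = 0 :=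
          inner_eq_zero_symm.1 ((Submodule.mem_orthogonal _ _).1 (hφo n) a ha)
        rw [hB1]
        simp only [_root_.sub_apply, map_add, h5 a ha, map_smul, hBφ,
          _root_.smul_apply, rankOne_apply, e1]
        rcases hpo.unit n with h0 | h0
        · simp [h0]
        · simp [inner_self_eq_norm_sq_to_K, h0]
  have hunit : ∀ n, V n ≠ ⊤ → ‖φ n‖ = 1 ∧ |β n| = ‖B n‖ := fun n hn => by
    obtain ⟨h1, h2, h3, h4, h5⟩ := inv n
    rcases spec n with h | h
    · exact ⟨h.1, h.2.2.2⟩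
    · exact absurd (exists_unit_eigenvector h1 h2 (V n) hn h5) h.2
  have htop : ∀ n ∈ eigenIndex H, V n ≠ ⊤ := fun n hn ht => by
    obtain ⟨h1, h2, h3, h4, h5⟩ := inv n
    rw [ht] at h3 h4
    have : FiniteDimensional ℂ H := Submodule.topEquiv.finiteDimensional
    rw [finrank_top] at h4
    exact absurd (hn this) (not_lt.2 h4)
  have hout : ∀ n ∉ eigenIndex H, V n = ⊤ := fun n hn => by
    by_contra ht
    simp only [eigenIndex, Set.mem_ofPred_eq, not_forall, not_lt] at hn
    obtain ⟨hfd, hn⟩ := hn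
    have := hpo.card_le (insert n (Finset.range (Module.finrank ℂ H))) fun i hi => by
      refine norm_ne_zero_iff.1 (ne_of_eq_of_ne ?_ one_ne_zero)
      rcases Finset.mem_insert.1 hi with rfl | hi
      · exact (hunit _ ht).1
      · exact (hunit _ (htop i fun _ => Finset.mem_range.1 hi)).1
    rw [Finset.card_insert_of_notMem (by simpa using hn)] at this
    simp at this
  have hpad : ∀ n ∉ eigenIndex H, B n = 0 ∧ β n = 0 ∧ φ n = 0 := fun n hn => by
    have ht := hout n hn
    have hB0 : B n = 0 := by
      ext v
      exact (inv n).2.2.2.2 v (ht ▸ Submodule.mem_top)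
    refine ⟨hB0, ?_, ?_⟩
    · have := hβB n
      rw [hB0, norm_zero] at this
      exact abs_eq_zero.1 (le_antisymm this (abs_nonneg _))
    · have := hφo n
      rw [ht, Submodule.top_orthogonal_eq_bot] at this
      exact (Submodule.mem_bot ℂ).1 this
  have hBanti : Antitone fun n => ‖B n‖ := antitone_nat_of_succ_le fun n => by
    rcases hpo.unit n with h0 | h0
    · rw [hB1, h0]; simp
    · have e : B (n + 1) = B n * (1 - rankOne ℂ (φ n) (φ n)) := by
        rw [hB1, mul_sub, mul_one]
        congr 1
        ext v
        simp only [_root_.smul_apply, rankOne_apply, mul_apply_eq_comp,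
          map_smul, hBφ]
        rw [smul_comm]
      rw [e]
      have h1 := (isStarProjection_rankOne_self (𝕜 := ℂ) h0).one_sub.norm_le
      exact (norm_mul_le _ _).trans (mul_le_of_le_one_right (norm_nonneg _) h1)
  have hβanti : Antitone fun n => |β n| := antitone_nat_of_succ_le fun n => by
    by_cases hn : n ∈ eigenIndex H
    · rw [(hunit n (htop n hn)).2]
      exact (hβB _).trans (hBanti n.le_succ)
    · have : n + 1 ∉ eigenIndex H := fun h => hn (mem_eigenIndex_of_le n.le_succ h)
      rw [(hpad _ this).2.1, (hpad _ hn).2.1]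
  have hBA : ∀ n, B n = A - ∑ i ∈ Finset.range n, (β i : ℂ) • rankOne ℂ (φ i) (φ i) := fun n => by
    induction n with
    | zero => simp [hB, deflation]
    | succ n ih => rw [hB1, ih, Finset.sum_range_succ]; abel
  have hAφ : ∀ n, A (φ n) = (β n : ℂ) • φ n := fun n => by
    have := hBφ n
    rw [hBA, _root_.sub_apply, _root_.sum_apply, Finset.sum_eq_zero, sub_zero] at this
    · exact this
    · intro i hi
      simp [hpo.orth i n (Finset.mem_range.1 hi).ne]
  -- Were `‖B n‖` to stay above `c > 0`, the orthogonal vectors `A (φ n) = β n φ n` would all have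
  -- norm at least `c`, so no subsequence could be Cauchy, against compactness of `A`.
  have hlim : Tendsto (fun n => ‖B n‖) atTop (𝓝 0) := by
    by_contra hcon
    have hpos : ∃ c > 0, ∀ n, c ≤ ‖B n‖ := by
      by_contra! hcon2
      refine hcon (tendsto_order.2 ⟨fun a ha => Eventually.of_forall fun n =>
        ha.trans_le (norm_nonneg _), fun a ha => ?_⟩)
      obtain ⟨n, hn⟩ := hcon2 a ha
      filter_upwards [eventually_ge_atTop n] with m hm
      exact (hBanti hm).trans_lt hn
    obtain ⟨c, hc0, hcB⟩ := hpos
    have hall : ∀ n, ‖φ n‖ = 1 ∧ c ≤ |β n| := fun n => by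
      have hn : n ∈ eigenIndex H := by
        by_contra hn
        have := hcB n
        rw [(hpad n hn).1, norm_zero] at this
        linarith
      have := hunit n (htop n hn)
      exact ⟨this.1, this.2 ▸ hcB n⟩
    have hK := hc.isCompact_closure_image_closedBall (f := (A : H →ₗ[ℂ] H)) 1
    have hmem : ∀ n, A (φ n) ∈ closure ((A : H →ₗ[ℂ] H) '' Metric.closedBall 0 1) := fun n =>
      subset_closure ⟨φ n, by simp [(hall n).1], rfl⟩
    obtain ⟨x, -, ψ, hψ, hx⟩ := hK.tendsto_subseq hmem
    have hcau := hx.cauchySeq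
    obtain ⟨N, hN⟩ := Metric.cauchySeq_iff.1 hcau c hc0
    have h1 := hN N le_rfl (N + 1) N.le_succ
    have hne : ψ N ≠ ψ (N + 1) := (hψ N.lt_succ_self).ne
    simp only [Function.comp_apply, dist_eq_norm, hAφ] at h1
    have h2 : inner ℂ ((β (ψ N) : ℂ) • φ (ψ N)) (-((β (ψ (N + 1)) : ℂ) • φ (ψ (N + 1)))) = 0 := by
      rw [inner_neg_right, inner_smul_left, inner_smul_right, hpo.orth _ _ hne]; simp
    have h3 := norm_add_sq_eq_norm_sq_add_norm_sq_of_inner_eq_zero _ _ h2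
    rw [← sub_eq_add_neg, norm_neg, norm_smul, norm_smul, (hall _).1, (hall _).1] at h3
    have h4 := (hall (ψ N)).2
    rw [← Real.norm_eq_abs, ← Complex.norm_real] at h4
    nlinarith [norm_nonneg ((β (ψ (N + 1)) : ℂ)),
      norm_nonneg ((β (ψ N) : ℂ) • φ (ψ N) - (β (ψ (N + 1)) : ℂ) • φ (ψ (N + 1)))]
  refine ⟨β, φ, hβanti, hpo.orthonormal fun i hi => ?_, fun j hj => (hpad j hj).2, ?_⟩
  · refine norm_ne_zero_iff.1 (ne_of_eq_of_ne (hunit i (htop i hi)).1 one_ne_zero)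
  · rw [HasSum, SummationFilter.unconditional_filter, Metric.tendsto_atTop]
    intro e he
    -- The remainder `B n` and any finite sum of terms of index at least `n` both have norm at most
    -- `‖B n‖`; this gives the `e / 2` and unconditional convergence.
    obtain ⟨n, hn⟩ := ((tendsto_order.1 hlim).2 (e / 2) (by positivity)).exists
    refine ⟨Finset.range n, fun s hs => ?_⟩
    have hs' : Finset.range n ⊆ s := hs.le
    rw [dist_eq_norm, ← Finset.sum_sdiff hs']
    have e1 : ∑ i ∈ s \ Finset.range n, (β i : ℂ) • rankOne ℂ (φ i) (φ i) +
        ∑ i ∈ Finset.range n, (β i : ℂ) • rankOne ℂ (φ i) (φ i) - A =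
        ∑ i ∈ s \ Finset.range n, (β i : ℂ) • rankOne ℂ (φ i) (φ i) - B n := by
      rw [hBA]; abel
    rw [e1]
    refine (norm_sub_le _ _).trans_lt ?_
    have := hpo.norm_sum_rankOne_le (s \ Finset.range n) β (norm_nonneg (B n)) fun i hi => by
      have hin : n ≤ i := by simpa using (Finset.mem_sdiff.1 hi).2
      exact (hβB i).trans (hBanti hin)
    linarith

end Existence

end EigenLemmas


/-! ### Conditional expectations given independent innovations -/

section CondExp

variable {Ω E : Type*} {m₀ : MeasurableSpace Ω} {P : Measure Ω} [IsProbabilityMeasure P]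
  [NormedAddCommGroup E] [NormedSpace ℝ E] [CompleteSpace E]

lemma setIntegral_of_indep {m₁ m₂ : MeasurableSpace Ω} (h₁ : m₁ ≤ m₀) (h₂ : m₂ ≤ m₀)
    (hind : Indep m₁ m₂ P) {Y : Ω → E} (hY : StronglyMeasurable[m₁] Y) (hYi : Integrable Y P)
    {B : Set Ω} (hB : MeasurableSet[m₂] B) :
    ∫ ω in B, Y ω ∂P = P.real B • ∫ ω, Y ω ∂P := by
  rw [← setIntegral_condExp h₂ hYi hB,
    setIntegral_congr_ae (g := fun _ => ∫ ω, Y ω ∂P) (h₂ _ hB), setIntegral_const]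
  filter_upwards [condExp_indep_eq h₁ h₂ hY hind] with ω hω _ using hω

/-- Conditioning on additional information that is independent of everything else has no effect. -/
lemma condExp_sup_of_indep {m₁ m₂ m₃ : MeasurableSpace Ω} (h₁₂ : m₁ ≤ m₂) (h₂ : m₂ ≤ m₀)
    (h₃ : m₃ ≤ m₀) (hind : Indep m₂ m₃ P) {Y : Ω → E} (hY : StronglyMeasurable[m₂] Y)
    (hYi : Integrable Y P) : P[Y | m₁ ⊔ m₃] =ᵐ[P] P[Y | m₁] := by
  have h₁ := h₁₂.trans h₂
  have hZm : StronglyMeasurable[m₁] (P[Y | m₁]) := stronglyMeasurable_condExp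
  have hZi : Integrable (P[Y | m₁]) P := integrable_condExp
  have hle : m₁ ⊔ m₃ ≤ m₀ := sup_le h₁ h₃
  refine (ae_eq_condExp_of_forall_setIntegral_eq hle hYi (fun _ _ _ => hZi.integrableOn)
    (fun s hs _ => ?_) (hZm.mono le_sup_left).aestronglyMeasurable).symm
  -- The intersections `a ∩ b` form a π-system generating `m₁ ⊔ m₃`. On them independence pulls out
  -- the factor `P b` on both sides and leaves the defining identity of `P[Y | m₁]` on `a`.
  let C : Set (Set Ω) := Set.image2 (· ∩ ·) {s | MeasurableSet[m₁] s} {s | MeasurableSet[m₃] s}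
  have hgen : m₁ ⊔ m₃ = MeasurableSpace.generateFrom C := by
    refine le_antisymm (sup_le (fun s hs => ?_) fun s hs => ?_)
      (MeasurableSpace.generateFrom_le ?_)
    · exact MeasurableSpace.measurableSet_generateFrom
        ⟨s, hs, Set.univ, MeasurableSet.univ, Set.inter_univ s⟩
    · exact MeasurableSpace.measurableSet_generateFrom
        ⟨Set.univ, MeasurableSet.univ, s, hs, Set.univ_inter s⟩
    · rintro _ ⟨a, ha, b, hb, rfl⟩
      exact MeasurableSet.inter ((le_sup_left : m₁ ≤ m₁ ⊔ m₃) a ha)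
        ((le_sup_right : m₃ ≤ m₁ ⊔ m₃) b hb)
  have hpi : IsPiSystem C := by
    rintro _ ⟨a, ha, b, hb, rfl⟩ _ ⟨a', ha', b', hb', rfl⟩ _
    exact ⟨a ∩ a', MeasurableSet.inter ha ha', b ∩ b', MeasurableSet.inter hb hb',
      Set.inter_inter_inter_comm _ _ _ _⟩
  induction s, hs using MeasurableSpace.induction_on_inter hgen hpi with
  | empty => simp
  | basic t ht =>
    obtain ⟨a, ha, b, hb, rfl⟩ := ht
    have ha₀ := h₁ a ha
    have hb₀ := h₃ b hb
    have key : ∀ {W : Ω → E}, StronglyMeasurable[m₂] W → Integrable W P →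
        ∫ ω in a ∩ b, W ω ∂P = P.real b • ∫ ω in a, W ω ∂P := fun {W} hW hWi => by
      rw [Set.inter_comm, ← setIntegral_indicator ha₀,
        setIntegral_of_indep h₂ h₃ hind (hW.indicator (h₁₂ a ha)) (hWi.indicator ha₀) hb,
        integral_indicator ha₀]
    simp only
    rw [key (hZm.mono h₁₂) hZi, key hY hYi, setIntegral_condExp h₁ hYi ha]
  | compl t ht ih =>
    rw [setIntegral_compl (hle _ ht) hZi, setIntegral_compl (hle _ ht) hYi,
      ih (measure_lt_top _ _), integral_condExp h₁]
  | iUnion f hd hf ih =>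
    rw [integral_iUnion (fun i => hle _ (hf i)) hd hZi.integrableOn,
      integral_iUnion (fun i => hle _ (hf i)) hd hYi.integrableOn]
    exact tsum_congr fun i => ih i (measure_lt_top _ _)

/-- The σ-algebra generated by the random elements `ε i`, `i ∈ I`. -/
@[reducible] def innovSigma {κ S : Type*} [MeasurableSpace S] (ε : κ → Ω → S) (I : Set κ) :
    MeasurableSpace Ω :=
  ⨆ i ∈ I, MeasurableSpace.comap (ε i) inferInstance

section Innov

variable {κ S : Type*} [MeasurableSpace S] {ε : κ → Ω → S}

lemma innovSigma_mono {I J : Set κ} (h : I ⊆ J) : innovSigma ε I ≤ innovSigma ε J :=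
  biSup_mono h

lemma innovSigma_le (hε : ∀ i, Measurable (ε i)) (I : Set κ) : innovSigma ε I ≤ m₀ :=
  iSup₂_le fun i _ => (hε i).comap_le

lemma innovSigma_indep (hε : ∀ i, Measurable (ε i)) (hind : iIndepFun ε P) {I J : Set κ}
    (h : Disjoint I J) : Indep (innovSigma ε I) (innovSigma ε J) P :=
  indep_iSup_of_disjoint (fun i => (hε i).comap_le) hind h

/-- The innovations in `J \ I` are independent of all those in `I`, hence jointly of `Y` and of the
conditioning by `I ∩ J`, and carry no information about `Y`. -/
lemma condExp_innovSigma_of_stronglyMeasurable (hε : ∀ i, Measurable (ε i)) (hind : iIndepFun ε P)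
    {I J : Set κ} {Y : Ω → E} (hY : StronglyMeasurable[innovSigma ε I] Y) (hYi : Integrable Y P) :
    P[Y | innovSigma ε J] =ᵐ[P] P[Y | innovSigma ε (I ∩ J)] := by
  have e : innovSigma ε J = innovSigma ε (I ∩ J) ⊔ innovSigma ε (J \ I) := by
    rw [innovSigma, innovSigma, innovSigma, ← iSup_union]
    congr 1
    rw [Set.inter_comm, Set.inter_union_sdiff]
  rw [e]
  exact condExp_sup_of_indep (innovSigma_mono Set.inter_subset_left) (innovSigma_le hε I)
    (innovSigma_le hε _) (innovSigma_indep hε hind disjoint_sdiff_self_right) hY hYi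

/-- For independent innovations, the conditional expectations commute. -/
lemma condExp_condExp_innovSigma (hε : ∀ i, Measurable (ε i)) (hind : iIndepFun ε P)
    (I J : Set κ) (Y : Ω → E) :
    P[P[Y | innovSigma ε I] | innovSigma ε J] =ᵐ[P] P[Y | innovSigma ε (I ∩ J)] :=
  (condExp_innovSigma_of_stronglyMeasurable hε hind stronglyMeasurable_condExp
    integrable_condExp).trans
    (condExp_condExp_of_le (innovSigma_mono Set.inter_subset_left) (innovSigma_le hε I))

end Innov

/-- Lets one version of a conditional expectation on sequence space serve all times `t`, so that the
decomposition of `X_t` is stationary by construction. -/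
lemma condExp_comp_measurePreserving {Ω' : Type*} {m m' : MeasurableSpace Ω'} {Q : Measure Ω'}
    [IsProbabilityMeasure Q] {φ : Ω → Ω'} (hφ : MeasurePreserving φ P Q)
    (hm : m ≤ m') {f : Ω' → E} (hf : Integrable f Q) :
    P[f ∘ φ | m.comap φ] =ᵐ[P] Q[f | m] ∘ φ := by
  have hle : m.comap φ ≤ m₀ := (MeasurableSpace.comap_mono hm).trans hφ.measurable.comap_le
  have hfi : Integrable (f ∘ φ) P := hφ.integrable_comp_of_integrable hf
  have hci : Integrable (Q[f | m] ∘ φ) P := hφ.integrable_comp_of_integrable integrable_condExp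
  refine (ae_eq_condExp_of_forall_setIntegral_eq hle hfi (fun _ _ _ => hci.integrableOn)
    (fun s hs _ => ?_) ?_).symm
  · obtain ⟨t, ht, rfl⟩ := hs
    have key : ∀ {h : Ω' → E}, Integrable h Q →
        ∫ ω in φ ⁻¹' t, (h ∘ φ) ω ∂P = ∫ x in t, h x ∂Q := fun {h} hh => by
      rw [← hφ.map_eq] at hh ⊢
      exact (setIntegral_map (hm t ht) hh.aestronglyMeasurable hφ.measurable.aemeasurable).symm
    rw [key integrable_condExp, key hf, setIntegral_condExp hm hf ht]
  · exact (stronglyMeasurable_condExp.comp_measurable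
      (comap_measurable φ)).aestronglyMeasurable

/-- Orthogonality of a conditionally centred variable and a conditionally known one. -/
lemma integral_bilin_eq_zero {F G : Type*} [NormedAddCommGroup F] [NormedSpace ℝ F]
    [NormedAddCommGroup G] [NormedSpace ℝ G] [CompleteSpace G] (B : E →L[ℝ] F →L[ℝ] G)
    {m : MeasurableSpace Ω} (hm : m ≤ m₀) {ξ : Ω → E} {Y : Ω → F} (hξ : Integrable ξ P)
    (h0 : P[ξ | m] =ᵐ[P] 0) (hY : StronglyMeasurable[m] Y)
    (hi : Integrable (fun ω => B (ξ ω) (Y ω)) P) : ∫ ω, B (ξ ω) (Y ω) ∂P = 0 := by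
  rw [← integral_condExp hm]
  refine integral_eq_zero_of_ae ?_
  filter_upwards [condExp_bilin_of_stronglyMeasurable_right B hY hi hξ, h0] with ω h1 h2
  rw [h1, h2]; simp

end CondExp


/-! ### The law of the past -/

section Past

variable {Ω S : Type*} [MeasurableSpace Ω] [MeasurableSpace S]

/-- The sequence `(ε_t, ε_{t-1}, …)`. -/
def pastMap (ε : ℤ → Ω → S) (t : ℤ) (ω : Ω) : ℕ → S := fun k => ε (t - k) ω

/-- The law of `(ε_0, ε_{-1}, …)`. -/
noncomputable def pastLaw (P : Measure Ω) (ε : ℤ → Ω → S) : Measure (ℕ → S) :=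
  P.map (pastMap ε 0)

/-- The σ-algebra on sequences generated by the first `n` coordinates. -/
@[reducible] def headSigma (S : Type*) [MeasurableSpace S] (n : ℕ) : MeasurableSpace (ℕ → S) :=
  innovSigma (fun k (x : ℕ → S) => x k) (Set.Iio n)

lemma headSigma_le (n : ℕ) : headSigma S n ≤ MeasurableSpace.pi :=
  innovSigma_le (fun k => measurable_pi_apply k) _

lemma headSigma_mono : Monotone (headSigma S) := fun _ _ h =>
  innovSigma_mono (Set.Iio_subset_Iio h)

lemma headSigma_zero : headSigma S 0 = ⊥ := by simp [headSigma, innovSigma]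

lemma iSup_headSigma : ⨆ n, headSigma S n = MeasurableSpace.pi := by
  refine le_antisymm (iSup_le headSigma_le) (iSup_le fun k => ?_)
  exact le_trans (le_iSup₂_of_le (f := fun i (_ : i ∈ Set.Iio (k + 1)) =>
    MeasurableSpace.comap (fun x : ℕ → S => x i) inferInstance) k (Nat.lt_succ_self k) le_rfl)
    (le_iSup (headSigma S) (k + 1))

variable {ε : ℤ → Ω → S} {P : Measure Ω} [IsProbabilityMeasure P]

/-- The first `n` entries at time `t` are `ε_t, …, ε_{t-n+1}`, hence the half-open interval. -/
lemma comap_headSigma (ε : ℤ → Ω → S) (t : ℤ) (n : ℕ) :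
    (headSigma S n).comap (pastMap ε t) = innovSigma ε (Set.Ioc (t - n) t) := by
  simp only [headSigma, innovSigma, MeasurableSpace.comap_iSup, MeasurableSpace.comap_comp]
  refine le_antisymm (iSup₂_le fun k hk => ?_) (iSup₂_le fun i hi => ?_)
  · refine le_iSup₂_of_le (f := fun i (_ : i ∈ Set.Ioc (t - n) t) =>
      MeasurableSpace.comap (ε i) inferInstance) (t - k) ?_ le_rfl
    simp only [Set.mem_Iio, Set.mem_Ioc] at hk ⊢
    omega
  · obtain ⟨h1, h2⟩ := hi
    refine le_iSup₂_of_le (f := fun k (_ : k ∈ Set.Iio n) =>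
      MeasurableSpace.comap ((fun x : ℕ → S => x k) ∘ pastMap ε t) inferInstance)
      (t - i).toNat ?_ ?_
    · simp only [Set.mem_Iio]; omega
    · have : (fun x : ℕ → S => x (t - i).toNat) ∘ pastMap ε t = ε i := by
        funext ω
        simp only [Function.comp_apply, pastMap]
        congr 1
        omega
      rw [this]

variable {ε' : ℤ → Ω → S}

lemma IsInnovationPair.measurable_pastMap (h : IsInnovationPair P ε ε') (t : ℤ) :
    Measurable (pastMap ε t) := measurable_pi_iff.2 fun _ => h.measurable _

/-- Stationarity: for every `t` the sequence has the product law with factor the law of `ε_0`. -/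
lemma IsInnovationPair.measurePreserving_pastMap (h : IsInnovationPair P ε ε') (t : ℤ) :
    MeasurePreserving (pastMap ε t) P (pastLaw P ε) := by
  refine ⟨h.measurable_pastMap t, ?_⟩
  have key : ∀ s : ℤ, P.map (pastMap ε s) = Measure.infinitePi fun _ : ℕ => P.map (ε 0) := by
    intro s
    have hind : iIndepFun (fun (k : ℕ) => ε (s - k)) P :=
      h.iIndep.precomp (g := fun k : ℕ => s - (k : ℤ)) fun a b hab => by simpa using hab
    have := hind.map_fun_eq_infinitePi_map fun k => h.measurable _
    simp_rw [fun k : ℕ => (h.identDistrib (s - k)).map_eq] at this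
    exact this
  rw [pastLaw, key, key]

lemma IsInnovationPair.isProbabilityMeasure_pastLaw (h : IsInnovationPair P ε ε') :
    IsProbabilityMeasure (pastLaw P ε) :=
  Measure.isProbabilityMeasure_map (h.measurable_pastMap 0).aemeasurable

/-! ### Decomposition of `X_t` into contributions of single innovations -/

section Decomposition

variable {H : Type*} [NormedAddCommGroup H] [InnerProductSpace ℂ H] [CompleteSpace H]
  {g : (ℕ → S) → H}

/-- The contribution of the `k`-th coordinate to `g`, given the preceding coordinates. -/
noncomputable def coordDiff (P : Measure Ω) (ε : ℤ → Ω → S) (g : (ℕ → S) → H) (k : ℕ) :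
    (ℕ → S) → H :=
  (pastLaw P ε)[g | headSigma S (k + 1)] - (pastLaw P ε)[g | headSigma S k]

/-- The contribution of `ε_{t-k}` to `X_t`, given `ε_t, …, ε_{t-k+1}`. -/
noncomputable def shiftDiff (P : Measure Ω) (ε : ℤ → Ω → S) (g : (ℕ → S) → H) (k : ℕ) (t : ℤ) :
    Ω → H := coordDiff P ε g k ∘ pastMap ε t

lemma stronglyMeasurable_coordDiff (k : ℕ) :
    StronglyMeasurable[headSigma S (k + 1)] (coordDiff P ε g k) :=
  stronglyMeasurable_condExp.sub (stronglyMeasurable_condExp.mono (headSigma_mono k.le_succ))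

lemma stronglyMeasurable_shiftDiff (k : ℕ) (t : ℤ) :
    StronglyMeasurable[innovSigma ε (Set.Icc (t - k) t)] (shiftDiff P ε g k t) := by
  have h := (stronglyMeasurable_coordDiff (P := P) (ε := ε) (g := g) k).comp_measurable
    (comap_measurable (pastMap ε t))
  rw [comap_headSigma] at h
  refine h.mono (innovSigma_mono fun i hi => ?_)
  simp only [Set.mem_Ioc, Set.mem_Icc] at hi ⊢
  push_cast at hi
  omega

namespace DependenceCondition

variable (hX : DependenceCondition P 4 g ε ε')

include hX

lemma memLp_g : MemLp g 4 (pastLaw P ε) :=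
  (memLp_map_measure_iff hX.measurable_g.aestronglyMeasurable
    (hX.innovations.measurable_pastMap 0).aemeasurable).2 (hX.memLp 0)

lemma integrable_g : Integrable g (pastLaw P ε) :=
  have := hX.innovations.isProbabilityMeasure_pastLaw
  hX.memLp_g.integrable (by norm_num)

lemma integrable_shiftProcess (t : ℤ) : Integrable (shiftProcess g ε t) P :=
  (hX.memLp t).integrable (by norm_num)

lemma condExp_head (t : ℤ) (n : ℕ) :
    (pastLaw P ε)[g | headSigma S n] ∘ pastMap ε t =ᵐ[P]
      P[shiftProcess g ε t | innovSigma ε (Set.Ioc (t - n) t)] := by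
  have := hX.innovations.isProbabilityMeasure_pastLaw
  have h := condExp_comp_measurePreserving (hX.innovations.measurePreserving_pastMap t)
    (headSigma_le n) hX.integrable_g
  rw [comap_headSigma] at h
  exact h.symm

lemma shiftDiff_ae_eq (k : ℕ) (t : ℤ) : shiftDiff P ε g k t =ᵐ[P]
    P[shiftProcess g ε t | innovSigma ε (Set.Icc (t - k) t)] -
      P[shiftProcess g ε t | innovSigma ε (Set.Ioc (t - k) t)] := by
  have e : Set.Ioc (t - ((k + 1 : ℕ) : ℤ)) t = Set.Icc (t - k) t := by
    ext i; simp only [Set.mem_Ioc, Set.mem_Icc]; push_cast; omega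
  have h1 := hX.condExp_head t (k + 1)
  rw [e] at h1
  filter_upwards [h1, hX.condExp_head t k] with ω h1 h2
  simp only [shiftDiff, coordDiff, Function.comp_apply, Pi.sub_apply] at h1 h2 ⊢
  rw [h1, h2]

lemma integrable_shiftDiff (k : ℕ) (t : ℤ) : Integrable (shiftDiff P ε g k t) P :=
  (integrable_condExp.sub integrable_condExp).congr (hX.shiftDiff_ae_eq k t).symm

/-- For fixed `k`, the variables `shiftDiff k t` are martingale differences in reversed time. -/
lemma condExp_shiftDiff (k : ℕ) (t : ℤ) :
    P[shiftDiff P ε g k t | innovSigma ε (Set.Ici (t - k + 1))] =ᵐ[P] 0 := by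
  have hm := hX.innovations.measurable
  have hi := hX.innovations.iIndep
  -- Conditioning on the innovations after `t - k` reduces both windows in the difference to the
  -- same one, so the two terms cancel.
  have e1 : Set.Icc (t - k) t ∩ Set.Ici (t - k + 1) = Set.Ioc (t - k) t := by
    ext i; simp only [Set.mem_inter_iff, Set.mem_Icc, Set.mem_Ici, Set.mem_Ioc]; omega
  have e2 : Set.Ioc (t - k) t ∩ Set.Ici (t - k + 1) = Set.Ioc (t - k) t := by
    ext i; simp only [Set.mem_inter_iff, Set.mem_Ici, Set.mem_Ioc]; omega
  have h1 := condExp_condExp_innovSigma hm hi (Set.Icc (t - k) t) (Set.Ici (t - k + 1))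
    (shiftProcess g ε t)
  have h2 := condExp_condExp_innovSigma hm hi (Set.Ioc (t - k) t) (Set.Ici (t - k + 1))
    (shiftProcess g ε t)
  rw [e1] at h1
  rw [e2] at h2
  refine (condExp_congr_ae (hX.shiftDiff_ae_eq k t)).trans ?_
  refine (condExp_sub integrable_condExp integrable_condExp _).trans ?_
  filter_upwards [h1, h2] with ω h1 h2
  rw [Pi.sub_apply, h1, h2, sub_self, Pi.zero_apply]

lemma eLpNorm_coordDiff (k : ℕ) (t : ℤ) (p : ℝ≥0∞) :
    eLpNorm (shiftDiff P ε g k t) p P = eLpNorm (coordDiff P ε g k) p (pastLaw P ε) :=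
  eLpNorm_comp_measurePreserving
    ((stronglyMeasurable_coordDiff k).mono (headSigma_le _)).aestronglyMeasurable
    (hX.innovations.measurePreserving_pastMap t)

/-- The substitute `ε'_0` is independent of the whole sequence `ε`, which determines `X_k`, and can
be dropped from the conditioning; the past with `ε_0` deleted remains. -/
lemma condExp_coupledPast (k : ℕ) :
    P[shiftProcess g ε k | coupledPast ε ε' {0} k] =ᵐ[P]
      P[shiftProcess g ε k | innovSigma ε (Set.Iic (k : ℤ) \ {0})] := by
  have hm := hX.innovations.measurable
  have hm' := hX.innovations.measurable'
  have hG : coupledPast ε ε' {0} k = innovSigma ε (Set.Iic (k : ℤ) \ {0}) ⊔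
      MeasurableSpace.comap (ε' 0) inferInstance := by
    refine le_antisymm (iSup_le fun n => ?_) (sup_le (iSup₂_le fun i hi => ?_) ?_)
    · by_cases h : (k : ℤ) - n = 0
      · have : coupled ε ε' {0} ((k : ℤ) - n) = ε' 0 := by simp [coupled, h]
        rw [this]; exact le_sup_right
      · have : coupled ε ε' {0} ((k : ℤ) - n) = ε (k - n) := by simp [coupled, h]
        rw [this]
        refine le_sup_of_le_left ?_
        exact le_iSup₂_of_le (f := fun i (_ : i ∈ Set.Iic (k : ℤ) \ {0}) =>
          MeasurableSpace.comap (ε i) inferInstance) ((k : ℤ) - n) ⟨by simp, by simpa using h⟩ le_rfl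
    · have hi1 : i ≤ k := hi.1
      have hi2 : i ≠ 0 := hi.2
      refine le_iSup_of_le ((k : ℤ) - i).toNat ?_
      have e : (k : ℤ) - ((k : ℤ) - i).toNat = i := by omega
      have : coupled ε ε' {0} i = ε i := by simp [coupled, hi2]
      rw [e, this]
    · refine le_iSup_of_le k ?_
      have : coupled ε ε' {0} ((k : ℤ) - k) = ε' 0 := by simp [coupled]
      rw [this]
  have hXm : StronglyMeasurable[innovSigma ε Set.univ] (shiftProcess g ε k) := by
    refine hX.measurable_g.comp_measurable (f := g) (g := pastMap ε k) ?_
    refine (@measurable_pi_iff Ω ℕ (fun _ => S) (innovSigma ε Set.univ) _ _).2 fun n => ?_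
    exact measurable_iff_comap_le.2 (le_iSup₂_of_le (f := fun i (_ : i ∈ Set.univ) =>
      MeasurableSpace.comap (ε i) inferInstance) ((k : ℤ) - n) (Set.mem_univ _) le_rfl)
  have hind : Indep (innovSigma ε Set.univ) (MeasurableSpace.comap (ε' 0) inferInstance) P := by
    have h := (IndepFun_iff_Indep _ _ _).1 hX.innovations.indep_copy
    refine indep_of_indep_of_le_left (indep_of_indep_of_le_right h ?_) (iSup₂_le fun i _ => ?_)
    · exact measurable_iff_comap_le.1 ((measurable_pi_apply (0 : ℤ)).comp
        (comap_measurable fun ω t => ε' t ω))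
    · exact measurable_iff_comap_le.1 ((measurable_pi_apply i).comp
        (comap_measurable fun ω t => ε t ω))
  rw [hG]
  exact condExp_sup_of_indep (innovSigma_mono (Set.subset_univ _)) (innovSigma_le hm _)
    (hm' 0).comap_le hind hXm (hX.integrable_shiftProcess k)

/-- By stationarity one may take `t = k`. Projecting `X_k - E[X_k | 𝒢_{k,{0}}]` onto `σ(ε_0, …,
ε_k)` gives exactly `D_{k,k}`, and conditional expectation contracts `L⁴`. The dependence condition
thus makes the `L⁴` norms of the `D_{k,t}` summable in `k`. -/
lemma eLpNorm_shiftDiff_le (k : ℕ) (t : ℤ) :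
    eLpNorm (shiftDiff P ε g k t) 4 P ≤ dependenceCoeff P 4 g ε ε' k := by
  have hm := hX.innovations.measurable
  have hi := hX.innovations.iIndep
  rw [hX.eLpNorm_coordDiff k t, ← hX.eLpNorm_coordDiff k k]
  have h1 := hX.shiftDiff_ae_eq k k
  rw [sub_self] at h1
  have e : (Set.Iic (k : ℤ) \ {0}) ∩ Set.Icc 0 (k : ℤ) = Set.Ioc 0 (k : ℤ) := by
    ext i
    simp only [Set.mem_inter_iff, Set.mem_Icc, Set.mem_Ioc, Set.mem_sdiff, Set.mem_Iic,
      Set.mem_singleton_iff]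
    omega
  have h2 : P[P[shiftProcess g ε k | coupledPast ε ε' {0} k] | innovSigma ε (Set.Icc 0 (k : ℤ))]
      =ᵐ[P] P[shiftProcess g ε k | innovSigma ε (Set.Ioc 0 (k : ℤ))] := by
    refine (condExp_congr_ae (hX.condExp_coupledPast k)).trans ?_
    have := condExp_condExp_innovSigma hm hi (Set.Iic (k : ℤ) \ {0}) (Set.Icc 0 (k : ℤ))
      (shiftProcess g ε k)
    rwa [e] at this
  have h3 : shiftDiff P ε g k k =ᵐ[P]
      P[shiftProcess g ε k - P[shiftProcess g ε k | coupledPast ε ε' {0} k] |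
        innovSigma ε (Set.Icc 0 (k : ℤ))] := by
    filter_upwards [h1, h2, condExp_sub (hX.integrable_shiftProcess k)
      (integrable_condExp (f := shiftProcess g ε k) (m := coupledPast ε ε' {0} k) (μ := P))
      (innovSigma ε (Set.Icc 0 (k : ℤ)))] with ω h1 h2 h3
    rw [h1, h3, Pi.sub_apply, Pi.sub_apply, h2]
  rw [eLpNorm_congr_ae h3]
  exact eLpNorm_condExp_le_eLpNorm _ (by norm_num)

lemma ae_summable_norm_shiftDiff (t : ℤ) :
    ∀ᵐ ω ∂P, Summable fun k => ‖shiftDiff P ε g k t ω‖ := by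
  have hm : ∀ k, AEStronglyMeasurable (shiftDiff P ε g k t) P := fun k =>
    (hX.integrable_shiftDiff k t).aestronglyMeasurable
  have h1 : ∫⁻ ω, ∑' k, ‖shiftDiff P ε g k t ω‖ₑ ∂P < ∞ := by
    rw [lintegral_tsum fun k => (hm k).enorm]
    refine lt_of_le_of_lt (ENNReal.tsum_le_tsum fun k => ?_) hX.summable_coeff
    rw [← eLpNorm_one_eq_lintegral_enorm]
    exact (eLpNorm_le_eLpNorm_of_exponent_le (by norm_num) (hm k)).trans
      (hX.eLpNorm_shiftDiff_le k t)
  filter_upwards [ae_lt_top' (AEMeasurable.tsum fun k => (hm k).enorm) h1.ne] with ω hω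
  have := NNReal.summable_coe.2 (ENNReal.tsum_coe_ne_top_iff_summable.1 hω.ne)
  simpa using this

/-- The partial sums telescope to conditional expectations given the first `n` coordinates, starting
from `E g = 0`. Norm convergence is already known; the limit is identified by Lévy's upward theorem
for the scalar functionals `Re ⟨v, ·⟩`, with `v` in a countable dense set. -/
lemma ae_hasSum_shiftDiff [TopologicalSpace.SeparableSpace H] (t : ℤ) :
    ∀ᵐ ω ∂P, HasSum (fun k => shiftDiff P ε g k t ω) (shiftProcess g ε t ω) := by
  have hQ := hX.innovations.isProbabilityMeasure_pastLaw
  have hmp := hX.innovations.measurePreserving_pastMap t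
  let f : H → H →L[ℝ] ℝ := fun v => Complex.reCLM ∘L (innerSL ℂ v).restrictScalars ℝ
  let ℱ : Filtration ℕ (MeasurableSpace.pi : MeasurableSpace (ℕ → S)) :=
    ⟨headSigma S, headSigma_mono, headSigma_le⟩
  have hlevy : ∀ v : H, ∀ᵐ x ∂(pastLaw P ε),
      Tendsto (fun n => f v ((pastLaw P ε)[g | headSigma S n] x)) atTop (𝓝 (f v (g x))) := by
    intro v
    have h1 : StronglyMeasurable[⨆ n, ℱ n] (f v ∘ g) := by
      have : ⨆ n, ℱ n = MeasurableSpace.pi := iSup_headSigma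
      rw [this]
      exact (f v).continuous.comp_stronglyMeasurable hX.measurable_g
    have h2 := ((f v).integrable_comp hX.integrable_g).tendsto_ae_condExp h1
    have h3 : ∀ᵐ x ∂(pastLaw P ε), ∀ n, f v ((pastLaw P ε)[g | headSigma S n] x) =
        (pastLaw P ε)[f v ∘ g | headSigma S n] x :=
      ae_all_iff.2 fun n => (f v).comp_condExp_comm hX.integrable_g
    filter_upwards [h2, h3] with x h2 h3
    simp_rw [h3]
    exact h2
  have h0 : (pastLaw P ε)[g | headSigma S 0] = 0 := by
    rw [headSigma_zero, condExp_bot]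
    funext x
    have := hX.centred 0
    rw [Pi.zero_apply, ← this]
    rw [pastLaw, integral_map (hX.innovations.measurable_pastMap 0).aemeasurable]
    · rfl
    · exact hX.measurable_g.aestronglyMeasurable
  have hall := hmp.quasiMeasurePreserving.ae
    (ae_all_iff.2 fun n => hlevy (TopologicalSpace.denseSeq H n))
  filter_upwards [hall, hX.ae_summable_norm_shiftDiff t] with ω h1 h2
  have hs := h2.of_norm.hasSum
  have hpart : ∀ n, ∑ k ∈ Finset.range n, shiftDiff P ε g k t ω =
      (pastLaw P ε)[g | headSigma S n] (pastMap ε t ω) := fun n => by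
    have := Finset.sum_range_sub
      (fun k => (pastLaw P ε)[g | headSigma S k] (pastMap ε t ω)) n
    simp only [h0, Pi.zero_apply, sub_zero] at this
    rw [← this]; rfl
  have hlim := hs.tendsto_sum_nat
  simp_rw [hpart] at hlim
  have heq : ∀ n, f (TopologicalSpace.denseSeq H n) (∑' k, shiftDiff P ε g k t ω) =
      f (TopologicalSpace.denseSeq H n) (shiftProcess g ε t ω) := fun n =>
    tendsto_nhds_unique (((f _).continuous.tendsto _).comp hlim) (h1 n)
  have hall2 : ∀ v, (inner ℂ v (∑' k, shiftDiff P ε g k t ω)).re =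
      (inner ℂ v (shiftProcess g ε t ω)).re := by
    have hc1 : ∀ y : H, Continuous fun v : H => (inner ℂ v y).re := fun y =>
      Complex.continuous_re.comp (continuous_id.inner continuous_const)
    exact congrFun ((TopologicalSpace.denseRange_denseSeq H).equalizer (hc1 _) (hc1 _)
      (funext heq))
  have hfin : ∑' k, shiftDiff P ε g k t ω = shiftProcess g ε t ω := by
    rw [← sub_eq_zero, ← inner_self_eq_zero (𝕜 := ℂ)]
    set y := ∑' k, shiftDiff P ε g k t ω - shiftProcess g ε t ω with hy
    have h3 : (inner ℂ y y).re = 0 := by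
      nth_rw 2 [hy]
      rw [inner_sub_right, Complex.sub_re, hall2, sub_self]
    have h4 := inner_self_eq_norm_sq_to_K (𝕜 := ℂ) y
    rw [h4] at h3 ⊢
    have h5 : ‖y‖ ^ 2 = 0 := by exact_mod_cast h3
    change ((‖y‖ : ℂ)) ^ 2 = 0
    exact_mod_cast h5
  rw [← hfin]
  exact hs

end DependenceCondition

end Decomposition

end Past


/-! ### Fourth moments and Hilbert–Schmidt bounds -/

section Quadratic

open InnerProductSpace

variable {Ω H : Type*} {m m₀ : MeasurableSpace Ω} {P : Measure Ω}
  [NormedAddCommGroup H] [InnerProductSpace ℂ H]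

lemma integral_mul_le_of_sq_le {f g : Ω → ℝ} (hf0 : ∀ ω, 0 ≤ f ω) (hg0 : ∀ ω, 0 ≤ g ω)
    (hf : AEStronglyMeasurable f P) (hg : AEStronglyMeasurable g P)
    (hfi : Integrable (fun ω => f ω ^ 2) P) (hgi : Integrable (fun ω => g ω ^ 2) P) {A B : ℝ}
    (hA0 : 0 ≤ A) (hB0 : 0 ≤ B) (hA : ∫ ω, f ω ^ 2 ∂P ≤ A ^ 2) (hB : ∫ ω, g ω ^ 2 ∂P ≤ B ^ 2) :
    ∫ ω, f ω * g ω ∂P ≤ A * B := by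
  have h2 : ENNReal.ofReal 2 = 2 := by simp
  have h := integral_mul_le_Lp_mul_Lq_of_nonneg Real.HolderConjugate.two_two
    (Eventually.of_forall hf0) (Eventually.of_forall hg0)
    (by rw [h2]; exact (memLp_two_iff_integrable_sq hf).2 hfi)
    (by rw [h2]; exact (memLp_two_iff_integrable_sq hg).2 hgi)
  simp only [Real.rpow_two] at h
  refine h.trans ?_
  rw [← Real.sqrt_eq_rpow, ← Real.sqrt_eq_rpow]
  exact mul_le_mul (Real.sqrt_le_iff.2 ⟨hA0, hA⟩) (Real.sqrt_le_iff.2 ⟨hB0, hB⟩)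
    (Real.sqrt_nonneg _) hA0

lemma integrable_norm_pow_four {f : Ω → H} (hf : MemLp f 4 P) :
    Integrable (fun ω => ‖f ω‖ ^ 4) P := by
  simpa using hf.integrable_norm_pow (p := 4) (by norm_num)

lemma integrable_of_norm_le_pow_four {E : Type*} [NormedAddCommGroup E] {F : Ω → E}
    (hF : AEStronglyMeasurable F P) {f₁ f₂ f₃ f₄ : Ω → H} (h₁ : MemLp f₁ 4 P)
    (h₂ : MemLp f₂ 4 P) (h₃ : MemLp f₃ 4 P) (h₄ : MemLp f₄ 4 P)
    (h : ∀ ω, ‖F ω‖ ≤ ‖f₁ ω‖ * ‖f₂ ω‖ * ‖f₃ ω‖ * ‖f₄ ω‖) : Integrable F P := by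
  refine ((((integrable_norm_pow_four h₁).add (integrable_norm_pow_four h₂)).add
    (integrable_norm_pow_four h₃)).add (integrable_norm_pow_four h₄)).mono' hF
    (Eventually.of_forall fun ω => (h ω).trans ?_)
  simp only [Pi.add_apply]
  set a := ‖f₁ ω‖
  set b := ‖f₂ ω‖
  set c := ‖f₃ ω‖
  set d := ‖f₄ ω‖
  nlinarith [sq_nonneg (a * b - c * d), sq_nonneg (a ^ 2 - b ^ 2), sq_nonneg (c ^ 2 - d ^ 2),
    sq_nonneg (a * b), sq_nonneg (c * d), pow_nonneg (sq_nonneg a) 2, pow_nonneg (sq_nonneg b) 2,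
    pow_nonneg (sq_nonneg c) 2, pow_nonneg (sq_nonneg d) 2]

section Centred

variable [CompleteSpace H] [IsProbabilityMeasure P]

lemma integral_inner_eq_zero (hm : m ≤ m₀) {ξ Y : Ω → H}
    (hξ : Integrable ξ P) (h0 : P[ξ | m] =ᵐ[P] 0) (hY : StronglyMeasurable[m] Y)
    (hi : Integrable (fun ω => inner ℂ (ξ ω) (Y ω)) P) : ∫ ω, inner ℂ (ξ ω) (Y ω) ∂P = 0 :=
  integral_bilin_eq_zero (isBoundedBilinearMap_inner (𝕜 := ℂ) (E := H)).toContinuousLinearMap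
    hm hξ h0 hY hi

lemma isBoundedBilinearMap_rankOne :
    IsBoundedBilinearMap ℝ fun p : H × H => rankOne ℂ p.1 p.2 where
  add_left x y z := by simp
  smul_left c x y := by
    simp only [← Complex.coe_smul, map_smul, _root_.smul_apply]
  add_right x y z := by simp
  smul_right c x y := by
    simp only [← Complex.coe_smul, map_smulₛₗ, Complex.conj_ofReal]
  bound := ⟨1, one_pos, fun x y => by simp⟩

lemma continuous_rankOne : Continuous fun p : H × H => rankOne ℂ p.1 p.2 :=
  (isBoundedBilinearMap_rankOne (H := H)).continuous

/-- Two-smoothness of `L⁴_H`, for a conditionally centred increment. -/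
lemma integral_norm_add_pow_four_le (hm : m ≤ m₀) {T D : Ω → H}
    (hT : StronglyMeasurable[m] T) (hT4 : MemLp T 4 P) (hD4 : MemLp D 4 P)
    (h0 : P[D | m] =ᵐ[P] 0) {A B : ℝ} (hA0 : 0 ≤ A) (hB0 : 0 ≤ B)
    (hA : ∫ ω, ‖T ω‖ ^ 4 ∂P ≤ A ^ 2) (hB : ∫ ω, ‖D ω‖ ^ 4 ∂P ≤ B ^ 2) :
    ∫ ω, ‖T ω + D ω‖ ^ 4 ∂P ≤ (A + 4 * B) ^ 2 := by
  have hTi := integrable_norm_pow_four hT4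
  have hDi := integrable_norm_pow_four hD4
  have hTm := hT4.aestronglyMeasurable
  have hDm := hD4.aestronglyMeasurable
  let Y : Ω → H := fun ω => ((‖T ω‖ ^ 2 : ℝ) : ℂ) • T ω
  have hYm : StronglyMeasurable[m] Y :=
    (Complex.continuous_ofReal.comp_stronglyMeasurable (hT.norm.pow 2)).smul hT
  have hin : Integrable (fun ω => inner ℂ (D ω) (Y ω)) P := by
    refine integrable_of_norm_le_pow_four (hDm.inner (hYm.mono hm).aestronglyMeasurable)
      hD4 hT4 hT4 hT4 fun ω => (norm_inner_le_norm _ _).trans (le_of_eq ?_)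
    simp only [Y, norm_smul, Complex.norm_real, norm_pow, norm_norm]
    ring
  have hz := integral_inner_eq_zero hm (hD4.integrable (by norm_num)) h0 hYm hin
  have hzr : ∫ ω, (inner ℂ (D ω) (Y ω)).re ∂P = 0 := by
    have := integral_re hin
    simp only [RCLike.re_eq_complex_re] at this
    rw [this, hz, Complex.zero_re]
  have hprod : Integrable (fun ω => ‖T ω‖ ^ 2 * ‖D ω‖ ^ 2) P := by
    refine integrable_of_norm_le_pow_four ((hTm.norm.pow 2).mul (hDm.norm.pow 2))
      hT4 hT4 hD4 hD4 fun ω => le_of_eq ?_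
    rw [Real.norm_of_nonneg (by positivity)]; ring
  have hcs : ∫ ω, ‖T ω‖ ^ 2 * ‖D ω‖ ^ 2 ∂P ≤ A * B :=
    integral_mul_le_of_sq_le (fun _ => sq_nonneg _) (fun _ => sq_nonneg _) (hTm.norm.pow 2)
      (hDm.norm.pow 2) (by simpa only [← pow_mul] using hTi) (by simpa only [← pow_mul] using hDi)
      hA0 hB0 (by simpa only [← pow_mul] using hA) (by simpa only [← pow_mul] using hB)
  -- With `r = Re ⟨T, D⟩`, the expansion contains `4r² + 2‖T‖²‖D‖² ≤ 6‖T‖²‖D‖²` and `4r‖D‖² ≤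
  -- 2‖T‖²‖D‖² + 2‖D‖⁴`, whence 8 and 3. Then `A² + 8AB + 3B² ≤ (A + 4B)²`.
  have hpt : ∀ ω, ‖T ω + D ω‖ ^ 4 ≤ ‖T ω‖ ^ 4 + 4 * (inner ℂ (D ω) (Y ω)).re +
      8 * (‖T ω‖ ^ 2 * ‖D ω‖ ^ 2) + 3 * ‖D ω‖ ^ 4 := fun ω => by
    have h1 : (inner ℂ (D ω) (Y ω)).re = ‖T ω‖ ^ 2 * (inner ℂ (T ω) (D ω)).re := by
      simp only [Y, inner_smul_right, Complex.re_ofReal_mul]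
      rw [← inner_conj_symm, Complex.conj_re]
    have h2 : ‖T ω + D ω‖ ^ 2 = ‖T ω‖ ^ 2 + 2 * (inner ℂ (T ω) (D ω)).re + ‖D ω‖ ^ 2 :=
      norm_add_sq (𝕜 := ℂ) (T ω) (D ω)
    have h3 : |(inner ℂ (T ω) (D ω)).re| ≤ ‖T ω‖ * ‖D ω‖ :=
      (Complex.abs_re_le_norm _).trans (norm_inner_le_norm _ _)
    have h4 : ‖T ω + D ω‖ ^ 4 = (‖T ω + D ω‖ ^ 2) ^ 2 := by ring
    rw [h4, h2, h1]
    set s := ‖T ω‖ with hs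
    set d := ‖D ω‖ with hd
    set r := (inner ℂ (T ω) (D ω)).re
    have hs0 : 0 ≤ s := norm_nonneg _
    have hd0 : 0 ≤ d := norm_nonneg _
    have h5 : r ^ 2 ≤ s ^ 2 * d ^ 2 := by
      rw [← mul_pow]; exact sq_le_sq' (by linarith [neg_abs_le r]) ((le_abs_self r).trans h3)
    have h6 : r * d ^ 2 ≤ s * d * d ^ 2 :=
      mul_le_mul_of_nonneg_right ((le_abs_self r).trans h3) (sq_nonneg d)
    have h7 : 2 * (s * d * d ^ 2) ≤ s ^ 2 * d ^ 2 + d ^ 4 := by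
      nlinarith [sq_nonneg (s * d - d ^ 2)]
    nlinarith
  have hI1 : Integrable (fun ω => 4 * (inner ℂ (D ω) (Y ω)).re) P := hin.re.const_mul 4
  calc ∫ ω, ‖T ω + D ω‖ ^ 4 ∂P
      ≤ ∫ ω, (‖T ω‖ ^ 4 + 4 * (inner ℂ (D ω) (Y ω)).re +
      8 * (‖T ω‖ ^ 2 * ‖D ω‖ ^ 2) + 3 * ‖D ω‖ ^ 4) ∂P :=
        integral_mono (integrable_norm_pow_four (hT4.add hD4))
          (((hTi.add hI1).add (hprod.const_mul 8)).add (hDi.const_mul 3)) hpt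
    _ = ∫ ω, ‖T ω‖ ^ 4 ∂P + 8 * ∫ ω, ‖T ω‖ ^ 2 * ‖D ω‖ ^ 2 ∂P + 3 * ∫ ω, ‖D ω‖ ^ 4 ∂P := by
        have e1 := integral_add ((hTi.add hI1).add (hprod.const_mul 8)) (hDi.const_mul 3)
        have e2 := integral_add (hTi.add hI1) (hprod.const_mul 8)
        have e3 := integral_add hTi hI1
        simp only [Pi.add_apply] at e1 e2 e3
        rw [e1, e2, e3, integral_const_mul, integral_const_mul, integral_const_mul, hzr]
        ring
    _ ≤ (A + 4 * B) ^ 2 := by nlinarith [mul_nonneg hA0 hB0, sq_nonneg B]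

/-- Martingale differences in reversed time with fourth moments at most `K ^ 4`. -/
structure IsReverseDiff (P : Measure Ω) (𝓕 : ℤ → MeasurableSpace Ω) (ξ : ℤ → Ω → H) (K : ℝ) :
    Prop where
  nonneg : 0 ≤ K
  meas : ∀ u, StronglyMeasurable[𝓕 u] (ξ u)
  memLp : ∀ u, MemLp (ξ u) 4 P
  centred : ∀ u, P[ξ u | 𝓕 (u + 1)] =ᵐ[P] 0
  moment : ∀ u, ∫ ω, ‖ξ u ω‖ ^ 4 ∂P ≤ K ^ 4

variable {𝓕 : ℤ → MeasurableSpace Ω} {ξ η : ℤ → Ω → H} {K L : ℝ}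

lemma stronglyMeasurable_sum_smul (hanti : Antitone 𝓕) (hη : IsReverseDiff P 𝓕 η L)
    (V : Finset ℤ) (c : ℤ → ℂ) {u : ℤ} (hV : ∀ v ∈ V, u ≤ v) :
    StronglyMeasurable[𝓕 u] fun ω => ∑ v ∈ V, c v • η v ω :=
  Finset.stronglyMeasurable_fun_sum V fun v hv => ((hη.meas v).mono (hanti (hV v hv))).const_smul _

lemma memLp_sum_smul (hη : IsReverseDiff P 𝓕 η L) (V : Finset ℤ) (c : ℤ → ℂ) :
    MemLp (fun ω => ∑ v ∈ V, c v • η v ω) 4 P :=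
  memLp_finsetSum V fun v _ => (hη.memLp v).const_smul (c v)

/-- Burkholder type inequality for fourth moments. -/
lemma integral_norm_sum_pow_four_le (hm : ∀ u, 𝓕 u ≤ m₀) (hanti : Antitone 𝓕)
    (hη : IsReverseDiff P 𝓕 η L) (V : Finset ℤ) (c : ℤ → ℂ) :
    ∫ ω, ‖∑ v ∈ V, c v • η v ω‖ ^ 4 ∂P ≤ (4 * L ^ 2 * ∑ v ∈ V, ‖c v‖ ^ 2) ^ 2 := by
  -- Time runs backwards: the new index `a` lies below all others, so the old sum is `𝓕 (a +
  -- 1)`-measurable and the new term is centred given it.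
  induction V using Finset.induction_on_min with
  | empty => simp
  | insert a s ha ih =>
    have has : a ∉ s := fun h => lt_irrefl _ (ha a h)
    simp_rw [Finset.sum_insert has, add_comm (c a • η a _)]
    have h0 : P[fun ω => c a • η a ω | 𝓕 (a + 1)] =ᵐ[P] 0 := by
      refine (condExp_smul (c a) (η a) (𝓕 (a + 1))).trans ?_
      filter_upwards [hη.centred a] with ω hω
      simp [hω]
    have hB : ∫ ω, ‖c a • η a ω‖ ^ 4 ∂P ≤ (L ^ 2 * ‖c a‖ ^ 2) ^ 2 := by
      simp_rw [norm_smul, mul_pow]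
      rw [integral_const_mul]
      calc ‖c a‖ ^ 4 * ∫ ω, ‖η a ω‖ ^ 4 ∂P ≤ ‖c a‖ ^ 4 * L ^ 4 := by
            gcongr; exact hη.moment a
        _ = _ := by ring
    refine (integral_norm_add_pow_four_le (hm (a + 1))
      (stronglyMeasurable_sum_smul hanti hη s c fun v hv => ha v hv)
      (memLp_sum_smul hη s c) ((hη.memLp a).const_smul (c a)) h0
      (A := 4 * L ^ 2 * ∑ v ∈ s, ‖c v‖ ^ 2) (by positivity) (by positivity) ih hB).trans
      (le_of_eq ?_)
    ring

end Centred

/-- The operator norm of a sum of rank one operators is at most its Hilbert–Schmidt norm. -/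
lemma norm_sum_rankOne_sq_le [CompleteSpace H] {κ : Type*} (U : Finset κ) (x z : κ → H) :
    ‖∑ u ∈ U, rankOne ℂ (x u) (z u)‖ ^ 2 ≤
      (∑ u ∈ U, ∑ u' ∈ U, inner ℂ (x u) (x u') * inner ℂ (z u') (z u)).re := by
  obtain ⟨w, χ, -⟩ := exists_hilbertBasis ℂ H
  set A := ∑ u ∈ U, rankOne ℂ (x u) (z u) with hA
  have hsum : HasSum (fun i => ‖A (χ i)‖ ^ 2)
      (∑ u ∈ U, ∑ u' ∈ U, inner ℂ (x u) (x u') * inner ℂ (z u') (z u)).re := by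
    have h1 : ∀ i, ((‖A (χ i)‖ ^ 2 : ℝ) : ℂ) = ∑ u ∈ U, ∑ u' ∈ U,
        inner ℂ (x u) (x u') * (inner ℂ (z u') (χ i) * inner ℂ (χ i) (z u)) := fun i => by
      have := inner_self_eq_norm_sq_to_K (𝕜 := ℂ) (A (χ i))
      push_cast
      refine Eq.trans this.symm ?_
      simp only [hA, _root_.sum_apply, rankOne_apply, sum_inner, inner_sum]
      rw [Finset.sum_comm]
      refine Finset.sum_congr rfl fun u _ => Finset.sum_congr rfl fun u' _ => ?_
      rw [inner_smul_left, inner_smul_right, inner_conj_symm]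
      ring
    have h2 : HasSum (fun i => ((‖A (χ i)‖ ^ 2 : ℝ) : ℂ))
        (∑ u ∈ U, ∑ u' ∈ U, inner ℂ (x u) (x u') * inner ℂ (z u') (z u)) := by
      simp_rw [h1]
      exact hasSum_sum fun u _ => hasSum_sum fun u' _ =>
        (χ.hasSum_inner_mul_inner (z u') (z u)).mul_left _
    have h3 := Complex.hasSum_re h2
    simp only [Complex.ofReal_re] at h3
    exact h3
  set G := (∑ u ∈ U, ∑ u' ∈ U, inner ℂ (x u) (x u') * inner ℂ (z u') (z u)).re with hG
  have hG0 : 0 ≤ G := hsum.nonneg fun _ => sq_nonneg _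
  have h3 : ‖A‖ ≤ √G := by
    -- The adjoint is easier to bound: the coordinates of `A† v` in the basis are `⟨A χ_i, v⟩` up to
    -- conjugation, hence at most `‖A χ_i‖ ‖v‖`.
    rw [← ContinuousLinearMap.adjoint.norm_map A]
    refine ContinuousLinearMap.opNorm_le_bound _ (Real.sqrt_nonneg _) fun v => ?_
    refine le_of_sq_le_sq ?_ (by positivity)
    rw [mul_pow, Real.sq_sqrt hG0]
    have h4 : HasSum (fun i => ‖inner ℂ (χ i) (ContinuousLinearMap.adjoint A v)‖ ^ 2)
        (‖ContinuousLinearMap.adjoint A v‖ ^ 2) := by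
      rw [← Complex.hasSum_ofReal]
      have h5 := χ.hasSum_inner_mul_inner (ContinuousLinearMap.adjoint A v)
        (ContinuousLinearMap.adjoint A v)
      rw [inner_self_eq_norm_sq_to_K] at h5
      push_cast
      refine h5.congr_fun fun i => ?_
      rw [← inner_conj_symm (ContinuousLinearMap.adjoint A v) (χ i),
        ← Complex.normSq_eq_conj_mul_self, Complex.normSq_eq_norm_sq]
      push_cast; rfl
    refine hasSum_le (fun i => ?_) h4 (hsum.mul_right (‖v‖ ^ 2))
    rw [ContinuousLinearMap.adjoint_inner_right, ← mul_pow]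
    gcongr
    exact norm_inner_le_norm _ _
  calc ‖A‖ ^ 2 ≤ √G ^ 2 := by gcongr
    _ = G := Real.sq_sqrt hG0

end Quadratic


/-! ### Off-diagonal quadratic forms in reversed martingale differences -/

section OffDiagonal

open InnerProductSpace

variable {Ω H : Type*} {m₀ : MeasurableSpace Ω} {P : Measure Ω} [IsProbabilityMeasure P]
  [NormedAddCommGroup H] [InnerProductSpace ℂ H] [CompleteSpace H]
  {𝓕 : ℤ → MeasurableSpace Ω} {ξ η ζ : ℤ → Ω → H} {K L B : ℝ}

lemma aestronglyMeasurable_rankOne {f g : Ω → H} (hf : AEStronglyMeasurable f P)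
    (hg : AEStronglyMeasurable g P) :
    AEStronglyMeasurable (fun ω => rankOne ℂ (f ω) (g ω)) P := by
  have := (continuous_rankOne (H := H)).comp_aestronglyMeasurable (hf.prodMk hg)
  exact this

lemma stronglyMeasurable_rankOne {m : MeasurableSpace Ω} {f g : Ω → H}
    (hf : StronglyMeasurable[m] f) (hg : StronglyMeasurable[m] g) :
    StronglyMeasurable[m] fun ω => rankOne ℂ (f ω) (g ω) := by
  have := (continuous_rankOne (H := H)).comp_stronglyMeasurable (hf.prodMk hg)
  exact this

lemma integrable_rankOne {f g : Ω → H} (hf : MemLp f 4 P) (hg : MemLp g 4 P) :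
    Integrable (fun ω => rankOne ℂ (f ω) (g ω)) P := by
  have h1 : MemLp (fun _ : Ω => (1 : ℝ)) 4 P := memLp_const 1
  have h2 : ∀ {f : Ω → H}, MemLp f 4 P → Integrable (fun ω => ‖f ω‖ ^ 2) P := fun {f} hf =>
    (memLp_two_iff_integrable_sq_norm hf.aestronglyMeasurable).1
      (hf.mono_exponent (by norm_num))
  refine ((h2 hf).add (h2 hg)).mono' (aestronglyMeasurable_rankOne hf.aestronglyMeasurable
    hg.aestronglyMeasurable) (Eventually.of_forall fun ω => ?_)
  simp only [norm_rankOne, Pi.add_apply]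
  nlinarith [sq_nonneg (‖f ω‖ - ‖g ω‖), sq_nonneg ‖f ω‖, sq_nonneg ‖g ω‖]

/-- Since `ζ u` only looks at indices beyond `u`, for `u < u'` the factor `ξ u` is centred given
everything else in the cross term of the squared Hilbert–Schmidt norm. Only the diagonal survives,
and Cauchy–Schwarz bounds each of its terms by `K² B`. -/
lemma integral_norm_sum_rankOne_sq_le (hm : ∀ u, 𝓕 u ≤ m₀) (hanti : Antitone 𝓕)
    (hξ : IsReverseDiff P 𝓕 ξ K) (U : Finset ℤ)
    (hζ : ∀ u, StronglyMeasurable[𝓕 (u + 1)] (ζ u)) (hζ4 : ∀ u, MemLp (ζ u) 4 P) (hB0 : 0 ≤ B)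
    (hB : ∀ u, ∫ ω, ‖ζ u ω‖ ^ 4 ∂P ≤ B ^ 2) :
    Integrable (fun ω => ‖∑ u ∈ U, rankOne ℂ (ξ u ω) (ζ u ω)‖ ^ 2) P ∧
    ∫ ω, ‖∑ u ∈ U, rankOne ℂ (ξ u ω) (ζ u ω)‖ ^ 2 ∂P ≤ U.card * (K ^ 2 * B) := by
  have hξm := fun u => (hξ.memLp u).aestronglyMeasurable
  have hζm := fun u => (hζ4 u).aestronglyMeasurable
  let F : ℤ → ℤ → Ω → ℂ := fun u u' ω =>
    inner ℂ (ξ u ω) (ξ u' ω) * inner ℂ (ζ u' ω) (ζ u ω)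
  have hF : ∀ u u', Integrable (F u u') P := fun u u' => by
    refine integrable_of_norm_le_pow_four (((hξm u).inner (hξm u')).mul ((hζm u').inner (hζm u)))
      (hξ.memLp u) (hξ.memLp u') (hζ4 u') (hζ4 u) fun ω => ?_
    rw [norm_mul, mul_assoc]
    exact mul_le_mul (norm_inner_le_norm _ _) (norm_inner_le_norm _ _) (norm_nonneg _)
      (by positivity)
  have hcross : ∀ u u', u < u' → ∫ ω, F u u' ω ∂P = 0 := fun u u' huu' => by
    have e : F u u' = fun ω => inner ℂ (ξ u ω) (inner ℂ (ζ u' ω) (ζ u ω) • ξ u' ω) := by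
      funext ω
      simp only [F, inner_smul_right]
      ring
    have hi := hF u u'
    rw [e] at hi ⊢
    refine integral_inner_eq_zero (hm (u + 1)) ((hξ.memLp u).integrable (by norm_num))
      (hξ.centred u) ?_ hi
    exact (((hζ u').mono (hanti (by omega))).inner (hζ u)).smul
      ((hξ.meas u').mono (hanti (by omega)))
  have hcross' : ∀ u u', u ≠ u' → ∫ ω, F u u' ω ∂P = 0 := fun u u' huu' => by
    rcases lt_or_gt_of_ne huu' with h | h
    · exact hcross u u' h
    · have e : F u u' = fun ω => (starRingEnd ℂ) (F u' u ω) := by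
        funext ω
        simp only [F, map_mul, inner_conj_symm]
      rw [e, integral_conj, hcross u' u h, map_zero]
  have hdiag : ∀ u, (∫ ω, F u u ω ∂P).re ≤ K ^ 2 * B := fun u => by
    have e : ∀ ω, (F u u ω).re = ‖ξ u ω‖ ^ 2 * ‖ζ u ω‖ ^ 2 := fun ω => by
      simp only [F]
      have h1 := inner_self_eq_norm_sq_to_K (𝕜 := ℂ) (ξ u ω)
      have h2 := inner_self_eq_norm_sq_to_K (𝕜 := ℂ) (ζ u ω)
      rw [h1, h2]
      norm_cast
    have h := integral_re (hF u u)
    simp only [RCLike.re_eq_complex_re] at h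
    rw [← h]
    simp_rw [e]
    refine integral_mul_le_of_sq_le (fun _ => sq_nonneg _) (fun _ => sq_nonneg _)
      ((hξm u).norm.pow 2) ((hζm u).norm.pow 2)
      (by simpa only [← pow_mul] using integrable_norm_pow_four (hξ.memLp u))
      (by simpa only [← pow_mul] using integrable_norm_pow_four (hζ4 u))
      (sq_nonneg K) hB0 (by simpa only [← pow_mul] using hξ.moment u)
      (by simpa only [← pow_mul] using hB u)
  have hsum : Integrable (fun ω => ∑ u ∈ U, ∑ u' ∈ U, F u u' ω) P :=
    integrable_finsetSum _ fun u _ => integrable_finsetSum _ fun u' _ => hF u u'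
  have hint : Integrable (fun ω => ‖∑ u ∈ U, rankOne ℂ (ξ u ω) (ζ u ω)‖ ^ 2) P := by
    refine hsum.re.mono' ?_ (Eventually.of_forall fun ω => ?_)
    · exact (Finset.aestronglyMeasurable_fun_sum U fun u _ =>
        aestronglyMeasurable_rankOne (hξm u) (hζm u)).norm.pow 2
    · rw [Real.norm_of_nonneg (sq_nonneg _)]
      exact norm_sum_rankOne_sq_le U (fun u => ξ u ω) (fun u => ζ u ω)
  refine ⟨hint, ?_⟩
  calc ∫ ω, ‖∑ u ∈ U, rankOne ℂ (ξ u ω) (ζ u ω)‖ ^ 2 ∂P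
      ≤ ∫ ω, (∑ u ∈ U, ∑ u' ∈ U, F u u' ω).re ∂P :=
        integral_mono hint hsum.re fun ω =>
          norm_sum_rankOne_sq_le U (fun u => ξ u ω) (fun u => ζ u ω)
    _ = (∑ u ∈ U, ∑ u' ∈ U, ∫ ω, F u u' ω ∂P).re := by
        have h := integral_re hsum
        simp only [RCLike.re_eq_complex_re] at h
        rw [h, integral_finsetSum _ fun u _ => integrable_finsetSum _ fun u' _ => hF u u']
        simp_rw [fun u => integral_finsetSum U fun u' _ => hF u u']
    _ = ∑ u ∈ U, (∫ ω, F u u ω ∂P).re := by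
        rw [Complex.re_sum]
        refine Finset.sum_congr rfl fun u hu => ?_
        rw [Finset.sum_eq_single u (fun u' _ h => hcross' u u' h.symm) (fun h => absurd hu h)]
    _ ≤ ∑ u ∈ U, K ^ 2 * B := Finset.sum_le_sum fun u _ => hdiag u
    _ = _ := by rw [Finset.sum_const, nsmul_eq_mul]

lemma integral_norm_le_of_sq {E : Type*} [NormedAddCommGroup E] {f : Ω → E}
    (hf : AEStronglyMeasurable f P) (hi : Integrable (fun ω => ‖f ω‖ ^ 2) P) {a : ℝ} (ha : 0 ≤ a)
    (h : ∫ ω, ‖f ω‖ ^ 2 ∂P ≤ a ^ 2) : ∫ ω, ‖f ω‖ ∂P ≤ a := by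
  have := integral_mul_le_of_sq_le (P := P) (f := fun ω => ‖f ω‖) (g := fun _ => 1)
    (fun _ => norm_nonneg _) (fun _ => zero_le_one) hf.norm aestronglyMeasurable_const hi
    (by simp) ha zero_le_one h (by simp)
  simpa using this

/-- For fixed `u` the sum over `v > u` collapses to one vector `ζ u`, with coefficients conjugated
because `x ⊗ y` is conjugate-linear in `y`. Its fourth moment is at most `(4 L² C)²`, which gives
the factor `2 L √C` after a square root. -/
lemma integral_norm_upper_le (hm : ∀ u, 𝓕 u ≤ m₀) (hanti : Antitone 𝓕)
    (hξ : IsReverseDiff P 𝓕 ξ K) (hη : IsReverseDiff P 𝓕 η L) (U V : Finset ℤ)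
    (c : ℤ → ℤ → ℂ) {C : ℝ} (hC0 : 0 ≤ C) (hC : ∀ u, ∑ v ∈ V, ‖c u v‖ ^ 2 ≤ C) :
    ∫ ω, ‖∑ u ∈ U, ∑ v ∈ V with u < v, c u v • rankOne ℂ (ξ u ω) (η v ω)‖ ∂P ≤
      2 * K * L * √(U.card * C) := by
  let ζ : ℤ → Ω → H := fun u ω => ∑ v ∈ V with u < v, (starRingEnd ℂ) (c u v) • η v ω
  have e : ∀ ω, ∑ u ∈ U, ∑ v ∈ V with u < v, c u v • rankOne ℂ (ξ u ω) (η v ω) =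
      ∑ u ∈ U, rankOne ℂ (ξ u ω) (ζ u ω) := fun ω => by
    simp only [ζ, map_sum, map_smulₛₗ, RingHomCompTriple.comp_apply, RingHom.id_apply]
  simp_rw [e]
  have hζ4 : ∀ u, MemLp (ζ u) 4 P := fun u => memLp_sum_smul hη _ _
  have hmain := integral_norm_sum_rankOne_sq_le hm hanti hξ U (ζ := ζ) (B := 4 * L ^ 2 * C)
    (fun u => stronglyMeasurable_sum_smul hanti hη _ _ fun v hv =>
      Int.add_one_le_iff.2 (Finset.mem_filter.1 hv).2)
    hζ4 (by positivity) fun u => by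
      refine (integral_norm_sum_pow_four_le hm hanti hη _ _).trans ?_
      have h1 : ∑ v ∈ V with u < v, ‖(starRingEnd ℂ) (c u v)‖ ^ 2 ≤ C := by
        refine le_trans ?_ (hC u)
        simp_rw [RCLike.norm_conj]
        exact Finset.sum_le_sum_of_subset_of_nonneg (Finset.filter_subset _ _)
          fun _ _ _ => sq_nonneg _
      have h2 : 0 ≤ ∑ v ∈ V with u < v, ‖(starRingEnd ℂ) (c u v)‖ ^ 2 :=
        Finset.sum_nonneg fun _ _ => sq_nonneg _
      gcongr
  have hK := hξ.nonneg
  have hL := hη.nonneg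
  refine integral_norm_le_of_sq (Finset.aestronglyMeasurable_fun_sum U fun u _ =>
    aestronglyMeasurable_rankOne (hξ.memLp u).aestronglyMeasurable
      (hζ4 u).aestronglyMeasurable) hmain.1 (by positivity) (hmain.2.trans (le_of_eq ?_))
  rw [mul_pow, Real.sq_sqrt (by positivity)]
  ring

/-- Taking adjoints exchanges the two factors and reduces to the upper triangle. -/
lemma integral_norm_lower_le (hm : ∀ u, 𝓕 u ≤ m₀) (hanti : Antitone 𝓕)
    (hξ : IsReverseDiff P 𝓕 ξ K) (hη : IsReverseDiff P 𝓕 η L) (U V : Finset ℤ)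
    (c : ℤ → ℤ → ℂ) {C : ℝ} (hC0 : 0 ≤ C) (hC : ∀ v, ∑ u ∈ U, ‖c u v‖ ^ 2 ≤ C) :
    ∫ ω, ‖∑ u ∈ U, ∑ v ∈ V with v < u, c u v • rankOne ℂ (ξ u ω) (η v ω)‖ ∂P ≤
      2 * K * L * √(V.card * C) := by
  have h := integral_norm_upper_le hm hanti hη hξ V U (fun v u => (starRingEnd ℂ) (c u v)) hC0
    (fun v => by simpa using hC v)
  have e : ∀ ω, ‖∑ u ∈ U, ∑ v ∈ V with v < u, c u v • rankOne ℂ (ξ u ω) (η v ω)‖ =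
      ‖∑ v ∈ V, ∑ u ∈ U with v < u, (starRingEnd ℂ) (c u v) • rankOne ℂ (η v ω) (ξ u ω)‖ :=
    fun ω => by
    rw [← ContinuousLinearMap.adjoint.norm_map]
    simp only [map_sum, Finset.sum_filter]
    rw [Finset.sum_comm]
    congr 1
    refine Finset.sum_congr rfl fun v _ => Finset.sum_congr rfl fun u _ => ?_
    split_ifs
    · rw [map_smulₛₗ, adjoint_rankOne]
    · exact map_zero _
  simp_rw [e]
  rw [show 2 * K * L = 2 * L * K by ring]
  exact h

lemma integrable_smul_rankOne (hξ : IsReverseDiff P 𝓕 ξ K) (hη : IsReverseDiff P 𝓕 η L)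
    (a : ℂ) (u v : ℤ) : Integrable (fun ω => a • rankOne ℂ (ξ u ω) (η v ω)) P :=
  (integrable_rankOne (hξ.memLp u) (hη.memLp v)).smul a

/-- The off-diagonal part of a quadratic form in reversed martingale differences. -/
lemma integral_norm_offDiag_le (hm : ∀ u, 𝓕 u ≤ m₀) (hanti : Antitone 𝓕)
    (hξ : IsReverseDiff P 𝓕 ξ K) (hη : IsReverseDiff P 𝓕 η L) (U V : Finset ℤ)
    (c : ℤ → ℤ → ℂ) {C : ℝ} (hC0 : 0 ≤ C) (hC : ∀ u, ∑ v ∈ V, ‖c u v‖ ^ 2 ≤ C)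
    (hC' : ∀ v, ∑ u ∈ U, ‖c u v‖ ^ 2 ≤ C) :
    ∫ ω, ‖∑ u ∈ U, ∑ v ∈ V, c u v • rankOne ℂ (ξ u ω) (η v ω) -
        ∑ u ∈ U ∩ V, c u u • rankOne ℂ (ξ u ω) (η u ω)‖ ∂P ≤
      2 * K * L * √(U.card * C) + 2 * K * L * √(V.card * C) := by
  have e : ∀ ω, ∑ u ∈ U, ∑ v ∈ V, c u v • rankOne ℂ (ξ u ω) (η v ω) -
        ∑ u ∈ U ∩ V, c u u • rankOne ℂ (ξ u ω) (η u ω) =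
      ∑ u ∈ U, ∑ v ∈ V with u < v, c u v • rankOne ℂ (ξ u ω) (η v ω) +
      ∑ u ∈ U, ∑ v ∈ V with v < u, c u v • rankOne ℂ (ξ u ω) (η v ω) := fun ω => by
    rw [sub_eq_iff_eq_add, ← Finset.filter_mem_eq_inter, Finset.sum_filter,
      ← Finset.sum_add_distrib, ← Finset.sum_add_distrib]
    refine Finset.sum_congr rfl fun u _ => ?_
    have h1 : (if u ∈ V then c u u • rankOne ℂ (ξ u ω) (η u ω) else 0) =
        ∑ v ∈ V, if v = u then c u v • rankOne ℂ (ξ u ω) (η v ω) else 0 := by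
      rw [Finset.sum_ite_eq' V u]
    rw [h1, Finset.sum_filter, Finset.sum_filter, ← Finset.sum_add_distrib,
      ← Finset.sum_add_distrib]
    refine Finset.sum_congr rfl fun v _ => ?_
    rcases lt_trichotomy u v with h | h | h
    · simp [h, h.not_gt, h.ne']
    · simp [h]
    · simp [h, h.not_gt, h.ne]
  simp_rw [e]
  have hi1 : ∀ p : ℤ → ℤ → Prop, ∀ [∀ u, DecidablePred (p u)], Integrable
      (fun ω => ∑ u ∈ U, ∑ v ∈ V with p u v, c u v • rankOne ℂ (ξ u ω) (η v ω)) P := by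
    intro p _
    exact integrable_finsetSum _ fun u _ => integrable_finsetSum _ fun v _ =>
      integrable_smul_rankOne hξ hη _ u v
  have hlt := hi1 (fun u v => u < v)
  have hgt := hi1 (fun u v => v < u)
  refine (integral_mono (hlt.add hgt).norm (hlt.norm.add hgt.norm) fun ω => norm_add_le _ _).trans
    ?_
  refine (integral_add hlt.norm hgt.norm).le.trans ?_
  exact add_le_add (integral_norm_upper_le hm hanti hξ hη U V c hC0 hC)
    (integral_norm_lower_le hm hanti hξ hη U V c hC0 hC')

end OffDiagonal


/-! ### A law of large numbers under finite-range dependence -/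

section LawOfLargeNumbers

variable {Ω E : Type*} {m₀ : MeasurableSpace Ω} {P : Measure Ω} [IsProbabilityMeasure P]
  [NormedAddCommGroup E] [NormedSpace ℝ E] [CompleteSpace E] [MeasurableSpace E] [BorelSpace E]

lemma sum_range_mul_eq {M : Type*} [AddCommMonoid M] (f : ℕ → M) (q n : ℕ) :
    ∑ i ∈ Finset.range (q * n), f i =
      ∑ r ∈ Finset.range q, ∑ j ∈ Finset.range n, f (r + q * j) := by
  induction n with
  | zero => simp
  | succ n ih =>
    rw [mul_add, mul_one, Finset.sum_range_add, ih]
    simp_rw [Finset.sum_range_succ]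
    rw [Finset.sum_add_distrib]
    congr 1
    exact Finset.sum_congr rfl fun r _ => by rw [add_comm]

/-- The weak law of large numbers in `L¹` for identically distributed variables that are pairwise
independent along arithmetic progressions with difference `q`. -/
lemma tendsto_eLpNorm_average {Z : ℕ → Ω → E} {q : ℕ} (hq : 0 < q)
    (hint : ∀ i, Integrable (Z i) P)
    (hident : ∀ i j, IdentDistrib (Z i) (Z j) P P)
    (hindep : ∀ r i j, i ≠ j → IndepFun (Z (r + q * i)) (Z (r + q * j)) P) :
    Tendsto (fun n : ℕ => eLpNorm
      (fun ω => (n : ℝ)⁻¹ • ∑ i ∈ Finset.range n, Z i ω - ∫ ω, Z 0 ω ∂P) 1 P) atTop (𝓝 0) := by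
  set M := ∫ ω, Z 0 ω ∂P with hM
  set e : ℕ → ℕ → ℝ≥0∞ := fun r n => eLpNorm
    (fun ω => (n : ℝ)⁻¹ • ∑ j ∈ Finset.range n, Z (r + q * j) ω - M) 1 P with he
  have hlaw : ∀ r, Tendsto (e r) atTop (𝓝 0) := fun r => by
    have h := strong_law_Lp (μ := P) (p := 1) le_rfl ENNReal.one_ne_top
      (fun j => Z (r + q * j)) (memLp_one_iff_integrable.2 (hint _))
      (fun i j hij => hindep r i j hij) (fun j => hident _ _)
    have h2 : ∫ ω, Z (r + q * 0) ω ∂P = M := (hident _ _).integral_eq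
    simp only [h2] at h
    exact h
  set W : ℕ → Ω → E := fun i ω => Z i ω - M with hW
  have hWi : ∀ i, Integrable (W i) P := fun i => (hint i).sub (integrable_const M)
  set K := eLpNorm (W 0) 1 P with hK
  have hKtop : K ≠ ∞ := (memLp_one_iff_integrable.2 (hWi 0)).eLpNorm_ne_top
  have hWK : ∀ i, eLpNorm (W i) 1 P = K := fun i =>
    ((hident i 0).comp (u := fun x => x - M) (measurable_id.sub_const M)).eLpNorm_eq 1
  -- The indices below `n` split into `q` residue classes of `n / q` terms, to each of which the
  -- independent law applies, and fewer than `q` leftover terms, each of norm `K`.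
  have hbound : ∀ n : ℕ, 0 < n → eLpNorm
      (fun ω => (n : ℝ)⁻¹ • ∑ i ∈ Finset.range n, Z i ω - M) 1 P ≤
      ∑ r ∈ Finset.range q, e r (n / q) + (q * K) / n := by
    intro n hn
    have hn0 : (n : ℝ) ≠ 0 := by positivity
    have h1 : (fun ω => (n : ℝ)⁻¹ • ∑ i ∈ Finset.range n, Z i ω - M) =
        (n : ℝ)⁻¹ • ((∑ r ∈ Finset.range q, ∑ j ∈ Finset.range (n / q), W (r + q * j)) +
          ∑ i ∈ Finset.range (n % q), W (q * (n / q) + i)) := by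
      rw [← sum_range_mul_eq W, ← Finset.sum_range_add, Nat.div_add_mod]
      funext ω
      simp only [Pi.smul_apply, Finset.sum_apply, hW, Finset.sum_sub_distrib, Finset.sum_const,
        Finset.card_range, smul_sub, ← Nat.cast_smul_eq_nsmul ℝ, smul_smul]
      rw [inv_mul_cancel₀ hn0, one_smul]
    have h2 : ∀ r, eLpNorm (∑ j ∈ Finset.range (n / q), W (r + q * j)) 1 P =
        (n / q : ℕ) * e r (n / q) := by
      intro r
      rcases Nat.eq_zero_or_pos (n / q) with h0 | h0
      · simp [h0]
      · have h3 : (∑ j ∈ Finset.range (n / q), W (r + q * j)) =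
            ((n / q : ℕ) : ℝ) • fun ω =>
              (((n / q : ℕ) : ℝ)⁻¹ • ∑ j ∈ Finset.range (n / q), Z (r + q * j) ω - M) := by
          funext ω
          have h0' : ((n / q : ℕ) : ℝ) ≠ 0 := by positivity
          simp only [Pi.smul_apply, Finset.sum_apply, hW, Finset.sum_sub_distrib,
            Finset.sum_const, Finset.card_range, smul_sub, ← Nat.cast_smul_eq_nsmul ℝ, smul_smul]
          rw [mul_inv_cancel₀ h0', one_smul]
        rw [h3, eLpNorm_const_smul, he]
        congr 1
        simp
    have hsm : ∀ i, AEStronglyMeasurable (W i) P := fun i => (hWi i).aestronglyMeasurable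
    rw [h1, eLpNorm_const_smul]
    have h4 : ‖(n : ℝ)⁻¹‖ₑ = (n : ℝ≥0∞)⁻¹ := by
      rw [enorm_inv hn0]; simp
    have hnE : (n : ℝ≥0∞) ≠ 0 := by exact_mod_cast hn.ne'
    calc ‖(n : ℝ)⁻¹‖ₑ * eLpNorm ((∑ r ∈ Finset.range q, ∑ j ∈ Finset.range (n / q),
            W (r + q * j)) + ∑ i ∈ Finset.range (n % q), W (q * (n / q) + i)) 1 P
        ≤ (n : ℝ≥0∞)⁻¹ * (∑ r ∈ Finset.range q, (n : ℝ≥0∞) * e r (n / q) + q * K) := by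
          rw [h4]
          gcongr
          refine (eLpNorm_add_le (Finset.aestronglyMeasurable_sum _ fun r _ =>
            Finset.aestronglyMeasurable_sum _ fun j _ => hsm _)
            (Finset.aestronglyMeasurable_sum _ fun j _ => hsm _) le_rfl).trans (add_le_add ?_ ?_)
          · refine (eLpNorm_sum_le (fun r _ => Finset.aestronglyMeasurable_sum _
              fun j _ => hsm _) le_rfl).trans (Finset.sum_le_sum fun r _ => ?_)
            rw [h2 r]
            gcongr
            exact Nat.div_le_self n q
          · refine (eLpNorm_sum_le (fun r _ => hsm _) le_rfl).trans ?_
            simp_rw [hWK]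
            rw [Finset.sum_const, Finset.card_range, nsmul_eq_mul]
            gcongr
            exact (Nat.mod_lt n hq).le
      _ = _ := by
          rw [mul_add, ← Finset.mul_sum, ← mul_assoc, ENNReal.inv_mul_cancel hnE (by simp), one_mul,
            mul_comm _ (q * K), ENNReal.div_eq_inv_mul, mul_comm (q * K)]
  have hlim : Tendsto (fun n : ℕ => ∑ r ∈ Finset.range q, e r (n / q) + (q * K) / n) atTop
      (𝓝 (∑ r ∈ Finset.range q, 0 + 0)) := by
    refine (tendsto_finsetSum _ fun r _ => (hlaw r).comp ?_).add ?_
    · exact Nat.tendsto_div_const_atTop hq.ne'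
    · exact ENNReal.Tendsto.const_div ENNReal.tendsto_nat_nhds_top
        (Or.inr (ENNReal.mul_ne_top (by simp) hKtop)) |>.trans (by simp)
  simp only [Finset.sum_const_zero, add_zero] at hlim
  refine tendsto_of_tendsto_of_tendsto_of_le_of_le' tendsto_const_nhds hlim
    (Eventually.of_forall fun _ => zero_le) ?_
  filter_upwards [eventually_gt_atTop 0] with n hn using hbound n hn

end LawOfLargeNumbers


/-! ### Fourth moments in integral form -/

section Moments

variable {Ω H : Type*} {m₀ : MeasurableSpace Ω} {P : Measure Ω} [IsProbabilityMeasure P]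
  [NormedAddCommGroup H]

lemma integral_norm_mul_norm_le {f g : Ω → H} (hf : MemLp f 4 P) (hg : MemLp g 4 P) {K L : ℝ}
    (hK : 0 ≤ K) (hL : 0 ≤ L) (hfK : ∫ ω, ‖f ω‖ ^ 4 ∂P ≤ K ^ 4)
    (hgL : ∫ ω, ‖g ω‖ ^ 4 ∂P ≤ L ^ 4) : ∫ ω, ‖f ω‖ * ‖g ω‖ ∂P ≤ K * L := by
  have h2 : ∀ {f : Ω → H} {K : ℝ}, MemLp f 4 P → 0 ≤ K → ∫ ω, ‖f ω‖ ^ 4 ∂P ≤ K ^ 4 →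
      Integrable (fun ω => ‖f ω‖ ^ 2) P ∧ ∫ ω, ‖f ω‖ ^ 2 ∂P ≤ K ^ 2 := fun {f K} hf hK h => by
    refine ⟨(hf.mono_exponent (p := 2) (by norm_num)).integrable_norm_pow (by norm_num), ?_⟩
    have := integral_mul_le_of_sq_le (P := P) (f := fun ω => ‖f ω‖ ^ 2) (g := fun _ => 1)
      (fun _ => sq_nonneg _) (fun _ => zero_le_one) (hf.aestronglyMeasurable.norm.pow 2)
      aestronglyMeasurable_const
      (by simpa only [← pow_mul] using hf.integrable_norm_pow (p := 4) (by norm_num))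
      (by simp) (sq_nonneg K) zero_le_one (by simpa only [← pow_mul] using h) (by simp)
    simpa using this
  obtain ⟨hf1, hf2⟩ := h2 hf hK hfK
  obtain ⟨hg1, hg2⟩ := h2 hg hL hgL
  exact integral_mul_le_of_sq_le (fun _ => norm_nonneg _) (fun _ => norm_nonneg _)
    hf.aestronglyMeasurable.norm hg.aestronglyMeasurable.norm hf1 hg1 hK hL hf2 hg2

lemma integral_norm_pow_four_le_of_eLpNorm_le {f : Ω → H} (hf : MemLp f 4 P) {c : ℝ≥0∞}
    (hc : c ≠ ∞) (h : eLpNorm f 4 P ≤ c) : ∫ ω, ‖f ω‖ ^ 4 ∂P ≤ c.toReal ^ 4 := by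
  have h0 : 0 ≤ ∫ ω, ‖f ω‖ ^ 4 ∂P := integral_nonneg fun _ => by positivity
  rw [hf.eLpNorm_eq_integral_rpow_norm (by norm_num) (by norm_num)] at h
  have h4 : (4 : ℝ≥0∞).toReal = (4 : ℕ) := by simp
  simp only [h4, Real.rpow_natCast] at h
  have h5 := (ENNReal.ofReal_le_iff_le_toReal hc).1 h
  calc ∫ ω, ‖f ω‖ ^ 4 ∂P = ((∫ ω, ‖f ω‖ ^ 4 ∂P) ^ (((4 : ℕ) : ℝ)⁻¹)) ^ 4 :=
        (Real.rpow_inv_natCast_pow h0 (by norm_num)).symm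
    _ ≤ c.toReal ^ 4 := by gcongr

end Moments

/-! ### Moments and averages of the products `D_{k,s} ⊗ D_{l,t}` -/

section ShiftMoments

open InnerProductSpace

variable {Ω S H : Type*} [MeasurableSpace Ω] [MeasurableSpace S] {P : Measure Ω}
  [IsProbabilityMeasure P] {ε ε' : ℤ → Ω → S}
  [NormedAddCommGroup H] [InnerProductSpace ℂ H] [CompleteSpace H] {g : (ℕ → S) → H}

/-- The operators `E (D_{k,k} ⊗ D_{l,l})`, where `D_{k,t}` is the contribution of `ε_{t-k}` to
`X_t`. -/
noncomputable def crossMoment (P : Measure Ω) (ε : ℤ → Ω → S) (g : (ℕ → S) → H) (k l : ℕ) :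
    H →L[ℂ] H :=
  ∫ ω, rankOne ℂ (shiftDiff P ε g k k ω) (shiftDiff P ε g l l ω) ∂P

/-- The product `D_{k,u+k} ⊗ D_{l,u+l}`. -/
noncomputable def diagProduct (P : Measure Ω) (ε : ℤ → Ω → S) (g : (ℕ → S) → H) (k l : ℕ) (u : ℤ)
    (ω : Ω) : H →L[ℂ] H :=
  rankOne ℂ (shiftDiff P ε g k (u + k) ω) (shiftDiff P ε g l (u + l) ω)

lemma stronglyMeasurable_diagProduct (k l : ℕ) (u : ℤ) :
    StronglyMeasurable[innovSigma ε (Set.Icc u (u + max k l))] (diagProduct P ε g k l u) := by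
  have h1 : ∀ i : ℕ, i ≤ max k l →
      StronglyMeasurable[innovSigma ε (Set.Icc u (u + max k l))] (shiftDiff P ε g i (u + i)) :=
    fun i hi => (stronglyMeasurable_shiftDiff i (u + i)).mono (innovSigma_mono fun j hj => by
      simp only [Set.mem_Icc] at hj ⊢
      omega)
  exact stronglyMeasurable_rankOne (h1 k (le_max_left _ _)) (h1 l (le_max_right _ _))

namespace DependenceCondition

/-- The dependence coefficients as real numbers. -/
noncomputable def bound (_ : DependenceCondition P 4 g ε ε') (k : ℕ) : ℝ :=
  (dependenceCoeff P 4 g ε ε' k).toReal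

variable (hX : DependenceCondition P 4 g ε ε')

include hX

lemma dependenceCoeff_ne_top (k : ℕ) : dependenceCoeff P 4 g ε ε' k ≠ ∞ :=
  ENNReal.ne_top_of_tsum_ne_top hX.summable_coeff.ne k

lemma bound_nonneg (k : ℕ) : 0 ≤ hX.bound k := ENNReal.toReal_nonneg

lemma summable_bound : Summable hX.bound := ENNReal.summable_toReal hX.summable_coeff.ne

lemma summable_bound_mul : Summable fun p : ℕ × ℕ => hX.bound p.1 * hX.bound p.2 :=
  hX.summable_bound.mul_of_nonneg hX.summable_bound hX.bound_nonneg hX.bound_nonneg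

lemma memLp_shiftDiff (k : ℕ) (t : ℤ) : MemLp (shiftDiff P ε g k t) 4 P :=
  ⟨(hX.integrable_shiftDiff k t).aestronglyMeasurable,
    (hX.eLpNorm_shiftDiff_le k t).trans_lt (hX.dependenceCoeff_ne_top k).lt_top⟩

lemma moment_shiftDiff (k : ℕ) (t : ℤ) :
    ∫ ω, ‖shiftDiff P ε g k t ω‖ ^ 4 ∂P ≤ hX.bound k ^ 4 :=
  integral_norm_pow_four_le_of_eLpNorm_le (hX.memLp_shiftDiff k t) (hX.dependenceCoeff_ne_top k)
    (hX.eLpNorm_shiftDiff_le k t)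

/-- Indexing by the innovation `u = t - k` instead of the time `t` puts all `k` on one decreasing
family of σ-algebras, so that forms mixing different `k` and `l` can be treated. -/
lemma isReverseDiff (k : ℕ) : IsReverseDiff P (fun u => innovSigma ε (Set.Ici u))
    (fun u => shiftDiff P ε g k (u + k)) (hX.bound k) where
  nonneg := hX.bound_nonneg k
  meas u := (stronglyMeasurable_shiftDiff k (u + k)).mono (innovSigma_mono fun j hj => by
    simp only [Set.mem_Icc, Set.mem_Ici] at hj ⊢; omega)
  memLp u := hX.memLp_shiftDiff k _
  centred u := by
    have h := hX.condExp_shiftDiff k (u + k)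
    rwa [add_sub_cancel_right] at h
  moment u := hX.moment_shiftDiff k _

lemma integrable_rankOne_shiftDiff (k l : ℕ) (s t : ℤ) :
    Integrable (fun ω => rankOne ℂ (shiftDiff P ε g k s ω) (shiftDiff P ε g l t ω)) P :=
  integrable_rankOne (hX.memLp_shiftDiff k s) (hX.memLp_shiftDiff l t)

lemma integral_norm_rankOne_shiftDiff_le (k l : ℕ) (s t : ℤ) :
    ∫ ω, ‖rankOne ℂ (shiftDiff P ε g k s ω) (shiftDiff P ε g l t ω)‖ ∂P ≤
      hX.bound k * hX.bound l := by
  simp_rw [norm_rankOne]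
  exact integral_norm_mul_norm_le (hX.memLp_shiftDiff k s) (hX.memLp_shiftDiff l t)
    (hX.bound_nonneg k) (hX.bound_nonneg l) (hX.moment_shiftDiff k s) (hX.moment_shiftDiff l t)

lemma norm_crossMoment_le (k l : ℕ) : ‖crossMoment P ε g k l‖ ≤ hX.bound k * hX.bound l :=
  (norm_integral_le_integral_norm _).trans (hX.integral_norm_rankOne_shiftDiff_le k l k l)

/-- Both factors are a fixed function of the single sequence read backwards from time `u + max k l`,
whose law does not depend on `u`. -/
lemma identDistrib_diagProduct (k l : ℕ) (u v : ℤ) :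
    IdentDistrib (diagProduct P ε g k l u) (diagProduct P ε g k l v) P P := by
  set m := max k l with hm
  let z : (ℕ → S) → H →L[ℂ] H := fun x =>
    rankOne ℂ (coordDiff P ε g k fun n => x (n + (m - k)))
      (coordDiff P ε g l fun n => x (n + (m - l)))
  have hc : ∀ i j : ℕ, StronglyMeasurable fun x : ℕ → S =>
      coordDiff P ε g i fun n => x (n + j) := fun i j =>
    ((stronglyMeasurable_coordDiff i).mono (headSigma_le _)).comp_measurable
      (measurable_pi_iff.2 fun n => measurable_pi_apply (n + j))
  have hz : StronglyMeasurable z := stronglyMeasurable_rankOne (hc k _) (hc l _)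
  have he : ∀ u : ℤ, diagProduct P ε g k l u = z ∘ pastMap ε (u + m) := fun u => by
    funext ω
    have hp : ∀ i : ℕ, i ≤ m → pastMap ε (u + i) ω =
        fun n => pastMap ε (u + m) ω (n + (m - i)) := fun i hi => by
      funext n
      simp only [pastMap]
      congr 1
      push_cast [hi]
      ring
    simp only [diagProduct, shiftDiff, Function.comp_apply, z]
    rw [hp k (le_max_left _ _), hp l (le_max_right _ _)]
  have hmp := fun u : ℤ => hX.innovations.measurePreserving_pastMap (u + m)
  rw [he, he]
  refine ⟨(hz.measurable.comp (hmp u).measurable).aemeasurable,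
    (hz.measurable.comp (hmp v).measurable).aemeasurable, ?_⟩
  rw [← Measure.map_map hz.measurable (hmp u).measurable,
    ← Measure.map_map hz.measurable (hmp v).measurable, (hmp u).map_eq, (hmp v).map_eq]

lemma integrable_diagProduct (k l : ℕ) (u : ℤ) : Integrable (diagProduct P ε g k l u) P :=
  hX.integrable_rankOne_shiftDiff k l _ _

lemma integral_diagProduct (k l : ℕ) (u : ℤ) :
    ∫ ω, diagProduct P ε g k l u ω ∂P = crossMoment P ε g k l := by
  rw [(hX.identDistrib_diagProduct k l u 0).integral_eq]
  simp only [diagProduct, crossMoment, zero_add]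

lemma indepFun_diagProduct (k l : ℕ) {u v : ℤ} (h : u + max k l < v) :
    IndepFun (diagProduct P ε g k l u) (diagProduct P ε g k l v) P := by
  rw [IndepFun_iff_Indep]
  have h1 := innovSigma_indep hX.innovations.measurable hX.innovations.iIndep
    (I := Set.Icc u (u + max k l)) (J := Set.Icc v (v + max k l))
    (Set.disjoint_left.2 fun i hi hj => by
      simp only [Set.mem_Icc] at hi hj; omega)
  refine indep_of_indep_of_le_left (indep_of_indep_of_le_right h1 ?_) ?_
  · exact (stronglyMeasurable_diagProduct k l v).measurable.comap_le
  · exact (stronglyMeasurable_diagProduct k l u).measurable.comap_le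

/-- Products whose indices differ by more than `max k l` use disjoint sets of innovations; hence the
step `q = max k l + 1`. -/
lemma tendsto_average_diagProduct (k l : ℕ) (c : ℤ) :
    Tendsto (fun n : ℕ => ∫ ω, ‖(n : ℝ)⁻¹ • ∑ i ∈ Finset.range n, diagProduct P ε g k l (c + i) ω -
      crossMoment P ε g k l‖ ∂P) atTop (𝓝 0) := by
  set Z : ℕ → Ω → H →L[ℂ] H := fun i => diagProduct P ε g k l (c + i) with hZ
  have key : ∀ r i j : ℕ, i < j →
      IndepFun (Z (r + (max k l + 1) * i)) (Z (r + (max k l + 1) * j)) P := fun r i j hij => by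
    refine hX.indepFun_diagProduct k l ?_
    have : (max k l + 1) * (i + 1) ≤ (max k l + 1) * j := Nat.mul_le_mul_left _ hij
    rw [mul_add, mul_one] at this
    generalize (max k l + 1) * i = a at this ⊢
    generalize (max k l + 1) * j = b at this ⊢
    omega
  have hindep : ∀ r i j : ℕ, i ≠ j →
      IndepFun (Z (r + (max k l + 1) * i)) (Z (r + (max k l + 1) * j)) P := fun r i j hij => by
    rcases lt_or_gt_of_ne hij with h | h
    · exact key r i j h
    · exact (key r j i h).symm
  have hZi : ∀ i, Integrable (Z i) P := fun i => hX.integrable_diagProduct k l _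
  have h := tendsto_eLpNorm_average (P := P) (Nat.succ_pos (max k l)) hZi
    (fun i j => hX.identDistrib_diagProduct k l _ _) hindep
  have h0 : ∫ ω, Z 0 ω ∂P = crossMoment P ε g k l := hX.integral_diagProduct k l _
  rw [h0] at h
  have h2 := (ENNReal.tendsto_toReal ENNReal.zero_ne_top).comp h
  rw [ENNReal.toReal_zero] at h2
  refine h2.congr fun n => ?_
  have hi : Integrable (fun ω => (n : ℝ)⁻¹ • ∑ i ∈ Finset.range n, Z i ω -
      crossMoment P ε g k l) P := by
    have hs : Integrable (fun ω => ∑ i ∈ Finset.range n, Z i ω) P :=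
      integrable_finsetSum _ fun i _ => hZi i
    have hs' : Integrable (fun ω => (n : ℝ)⁻¹ • ∑ i ∈ Finset.range n, Z i ω) P := hs.fun_smul _
    exact hs'.sub (integrable_const _)
  rw [Function.comp_apply, eLpNorm_one_eq_lintegral_enorm,
    integral_norm_eq_lintegral_enorm hi.aestronglyMeasurable]

/-- The contributions of different innovations are uncorrelated. -/
lemma integral_rankOne_shiftDiff (k l : ℕ) (s t : ℤ) :
    ∫ ω, rankOne ℂ (shiftDiff P ε g k s ω) (shiftDiff P ε g l t ω) ∂P =
      if s - k = t - l then crossMoment P ε g k l else 0 := by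
  have hm := innovSigma_le hX.innovations.measurable
  have key : ∀ (k l : ℕ) (s t : ℤ), s - k < t - l →
      ∫ ω, rankOne ℂ (shiftDiff P ε g k s ω) (shiftDiff P ε g l t ω) ∂P = 0 :=
    fun k l s t hlt =>
      integral_bilin_eq_zero (isBoundedBilinearMap_rankOne (H := H)).toContinuousLinearMap
        (hm (Set.Ici (s - k + 1))) (hX.integrable_shiftDiff k s) (hX.condExp_shiftDiff k s)
        ((stronglyMeasurable_shiftDiff l t).mono (innovSigma_mono fun j hj => by
          simp only [Set.mem_Icc, Set.mem_Ici] at hj ⊢; omega))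
        (hX.integrable_rankOne_shiftDiff k l s t)
  rcases lt_trichotomy (s - k) (t - l) with h | h | h
  · rw [if_neg h.ne, key k l s t h]
  · rw [if_pos h, ← hX.integral_diagProduct k l (s - k)]
    simp only [diagProduct]
    rw [sub_add_cancel, h, sub_add_cancel]
  · rw [if_neg h.ne']
    have h1 := key l k t s h
    have h3 : ∀ ω, rankOne ℂ (shiftDiff P ε g k s ω) (shiftDiff P ε g l t ω) =
        ContinuousLinearMap.adjoint
          (rankOne ℂ (shiftDiff P ε g l t ω) (shiftDiff P ε g k s ω)) := fun ω => by
      rw [adjoint_rankOne]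
    -- The adjoint is conjugate-linear, so it passes through the integral as a real-linear map.
    let adj : (H →L[ℂ] H) →L[ℝ] (H →L[ℂ] H) :=
      { toFun := ContinuousLinearMap.adjoint
        map_add' := fun _ _ => map_add _ _ _
        map_smul' := fun c A => by
          rw [← Complex.coe_smul, map_smulₛₗ, Complex.conj_ofReal, Complex.coe_smul,
            RingHom.id_apply]
        cont := ContinuousLinearMap.adjoint.continuous }
    have h4 := adj.integral_comp_comm (hX.integrable_rankOne_shiftDiff l k t s)
    rw [h1, map_zero] at h4
    simp_rw [h3]
    exact h4

end DependenceCondition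

end ShiftMoments


/-! ### The spectral density operator in terms of cross moments -/

section SpectralDensity

open InnerProductSpace

section RankOneSeries

variable {H : Type*} [NormedAddCommGroup H] [InnerProductSpace ℂ H] [CompleteSpace H]

lemma summable_norm_rankOne {x y : ℕ → H} (hx : Summable fun k => ‖x k‖)
    (hy : Summable fun k => ‖y k‖) :
    Summable fun p : ℕ × ℕ => ‖rankOne ℂ (x p.1) (y p.2)‖ := by
  simp_rw [norm_rankOne]
  exact hx.mul_of_nonneg hy (fun _ => norm_nonneg _) (fun _ => norm_nonneg _)

lemma hasSum_rankOne {x y : ℕ → H} {X Y : H} (hx : Summable fun k => ‖x k‖)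
    (hy : Summable fun k => ‖y k‖) (hX : HasSum x X) (hY : HasSum y Y) :
    HasSum (fun p : ℕ × ℕ => rankOne ℂ (x p.1) (y p.2)) (rankOne ℂ X Y) := by
  have h := (summable_norm_rankOne hx hy).of_norm.hasSum
  have h1 : ∀ k, HasSum (fun l => rankOne ℂ (x k) (y l)) (rankOne ℂ (x k) Y) := fun k =>
    (rankOne ℂ (x k)).hasSum hY
  have h2 := h.prod_fiberwise h1
  let f : H →+ (H →L[ℂ] H) := AddMonoidHom.mk' (fun z => rankOne ℂ z Y) fun z z' => by simp
  have hf : Continuous f :=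
    continuous_rankOne.comp (continuous_id.prodMk (continuous_const (y := Y)))
  have h3 := hX.map f hf
  have h4 : HasSum (fun k => rankOne ℂ (x k) Y) (rankOne ℂ X Y) := h3
  rw [← h2.unique h4]
  exact h

end RankOneSeries

variable {Ω S H : Type*} [MeasurableSpace Ω] [MeasurableSpace S] {P : Measure Ω}
  [IsProbabilityMeasure P] {ε ε' : ℤ → Ω → S}
  [NormedAddCommGroup H] [InnerProductSpace ℂ H] [CompleteSpace H]
  [TopologicalSpace.SeparableSpace H] {g : (ℕ → S) → H}

namespace DependenceCondition

variable (hX : DependenceCondition P 4 g ε ε')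

include hX

/-- Termwise integration of the expanded product leaves only the pairs in which both factors belong
to the same innovation, `h - k = 0 - l`. -/
lemma hasSum_covOp (h : ℤ) :
    HasSum (fun p : ℕ × ℕ => if h = (p.1 : ℤ) - p.2 then crossMoment P ε g p.1 p.2 else 0)
      (covOp P (shiftProcess g ε) h) := by
  have h1 := hasSum_integral_of_summable_integral_norm
    (F := fun (p : ℕ × ℕ) ω => rankOne ℂ (shiftDiff P ε g p.1 h ω) (shiftDiff P ε g p.2 0 ω))
    (μ := P) (fun p => hX.integrable_rankOne_shiftDiff p.1 p.2 h 0)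
    (hX.summable_bound_mul.of_nonneg_of_le (fun p => integral_nonneg fun _ => norm_nonneg _)
      fun p => hX.integral_norm_rankOne_shiftDiff_le p.1 p.2 h 0)
  have h2 : ∫ ω, ∑' p : ℕ × ℕ, rankOne ℂ (shiftDiff P ε g p.1 h ω) (shiftDiff P ε g p.2 0 ω) ∂P =
      covOp P (shiftProcess g ε) h := by
    refine integral_congr_ae ?_
    filter_upwards [hX.ae_hasSum_shiftDiff h, hX.ae_hasSum_shiftDiff 0,
      hX.ae_summable_norm_shiftDiff h, hX.ae_summable_norm_shiftDiff 0] with ω a1 a2 a3 a4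
    exact (hasSum_rankOne a3 a4 a1 a2).tsum_eq
  rw [h2] at h1
  refine h1.congr_fun fun p => ?_
  rw [hX.integral_rankOne_shiftDiff]
  congr 1
  exact propext ⟨fun h => by omega, fun h => by omega⟩

/-- A pair `(k, l)` contributes to the single lag `h = k - l`, so the family on triples is a
reindexing of one dominated by `ν_k ν_l`. This justifies the exchange of summation over lags and
over pairs. -/
lemma summable_covOp_index (θ : ℝ) :
    Summable fun q : ℤ × (ℕ × ℕ) => ‖if q.1 = (q.2.1 : ℤ) - q.2.2 then
      Complex.exp (-(Complex.I * θ * q.1)) • crossMoment P ε g q.2.1 q.2.2 else 0‖ := by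
  have hinj : Function.Injective fun p : ℕ × ℕ => (((p.1 : ℤ) - p.2, p) : ℤ × (ℕ × ℕ)) :=
    fun p q hpq => (Prod.ext_iff.1 hpq).2
  rw [← hinj.summable_iff]
  · refine hX.summable_bound_mul.of_nonneg_of_le (fun _ => norm_nonneg _) fun p => ?_
    simp only [Function.comp_apply, if_true, norm_smul]
    have : ‖Complex.exp (-(Complex.I * θ * ((p.1 : ℤ) - p.2 : ℤ)))‖ = 1 := by
      rw [Complex.norm_exp]; simp
    rw [this, one_mul]
    exact hX.norm_crossMoment_le p.1 p.2
  · intro q hq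
    rw [if_neg, norm_zero]
    intro h
    exact hq ⟨q.2, Prod.ext h.symm rfl⟩

lemma hasSum_smul_covOp_index (θ : ℝ) (h : ℤ) :
    HasSum (fun p : ℕ × ℕ => if h = (p.1 : ℤ) - p.2 then
      Complex.exp (-(Complex.I * θ * h)) • crossMoment P ε g p.1 p.2 else 0)
      (Complex.exp (-(Complex.I * θ * h)) • covOp P (shiftProcess g ε) h) := by
  refine ((hX.hasSum_covOp h).const_smul _).congr_fun fun p => ?_
  split_ifs <;> simp

/-- The autocovariance operators are absolutely summable. -/
lemma summable_norm_covOp : Summable fun h : ℤ => ‖covOp P (shiftProcess g ε) h‖ := by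
  have h1 := hX.summable_covOp_index 0
  refine h1.prod.of_nonneg_of_le (fun _ => norm_nonneg _) fun h => ?_
  have h2 := hX.hasSum_smul_covOp_index 0 h
  have h3 := norm_tsum_le_tsum_norm (h1.prod_factor h)
  simp only at h3
  rw [h2.tsum_eq] at h3
  simpa using h3

lemma hasSum_crossMoment (θ : ℝ) :
    HasSum (fun p : ℕ × ℕ => Complex.exp (Complex.I * θ * ((p.2 : ℤ) - p.1 : ℤ)) •
      crossMoment P ε g p.1 p.2)
      (∑' h : ℤ, Complex.exp (-(Complex.I * θ * h)) • covOp P (shiftProcess g ε) h) := by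
  have h1 := (hX.summable_covOp_index θ).of_norm.hasSum
  have h2 := h1.prod_fiberwise fun h => hX.hasSum_smul_covOp_index θ h
  have hinj : Function.Injective fun p : ℕ × ℕ => (((p.1 : ℤ) - p.2, p) : ℤ × (ℕ × ℕ)) :=
    fun p q hpq => (Prod.ext_iff.1 hpq).2
  rw [← h2.tsum_eq, ← hinj.hasSum_iff] at h1
  · refine h1.congr_fun fun p => ?_
    simp only [Function.comp_apply, if_true]
    congr 2
    push_cast
    ring
  · intro q hq
    rw [if_neg]
    intro h
    exact hq ⟨q.2, Prod.ext h.symm rfl⟩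

/-- The spectral density operator is compact, self-adjoint and non-negative. -/
lemma spectralDensityOp_properties (θ : ℝ) :
    IsCompactOperator (spectralDensityOp P (shiftProcess g ε) θ) ∧
    IsSelfAdjoint (spectralDensityOp P (shiftProcess g ε) θ) ∧
    ∀ v, 0 ≤ (inner ℂ v (spectralDensityOp P (shiftProcess g ε) θ v)).re := by
  -- With these phases the weighted cross moments are the means of `x k ⊗ x l`, so their sum is the
  -- mean of `(∑ x k) ⊗ (∑ x k)`.
  let x : ℕ → Ω → H := fun k ω => Complex.exp (-(Complex.I * θ * k)) • shiftDiff P ε g k k ω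
  have hexp : ∀ k : ℕ, ‖Complex.exp (-(Complex.I * θ * k))‖ = 1 := fun k => by
    rw [Complex.norm_exp]; simp
  have hx : ∀ (p : ℕ × ℕ) ω, rankOne ℂ (x p.1 ω) (x p.2 ω) =
      Complex.exp (Complex.I * θ * ((p.2 : ℤ) - p.1 : ℤ)) •
        rankOne ℂ (shiftDiff P ε g p.1 p.1 ω) (shiftDiff P ε g p.2 p.2 ω) := fun p ω => by
    simp only [x, map_smul, map_smulₛₗ, _root_.smul_apply, smul_smul]
    congr 1
    rw [← Complex.exp_conj, ← Complex.exp_add]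
    congr 1
    simp
    ring
  have hxi : ∀ p : ℕ × ℕ, Integrable (fun ω => rankOne ℂ (x p.1 ω) (x p.2 ω)) P := fun p => by
    simp_rw [hx]
    exact (hX.integrable_rankOne_shiftDiff p.1 p.2 p.1 p.2).fun_smul _
  have h1 := hasSum_integral_of_summable_integral_norm (μ := P) hxi
    (hX.summable_bound_mul.of_nonneg_of_le (fun p => integral_nonneg fun _ => norm_nonneg _)
      fun p => by
        refine le_trans (le_of_eq ?_)
          (hX.integral_norm_rankOne_shiftDiff_le p.1 p.2 p.1 p.2)
        simp only [x, norm_rankOne, norm_smul, hexp, one_mul])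
  have h2 : ∀ p : ℕ × ℕ, ∫ ω, rankOne ℂ (x p.1 ω) (x p.2 ω) ∂P =
      Complex.exp (Complex.I * θ * ((p.2 : ℤ) - p.1 : ℤ)) • crossMoment P ε g p.1 p.2 := fun p => by
    simp_rw [hx, integral_smul]
    rfl
  simp_rw [h2] at h1
  have h3 := (hX.hasSum_crossMoment θ).unique h1
  set G := ∑' h : ℤ, Complex.exp (-(Complex.I * θ * h)) • covOp P (shiftProcess g ε) h with hG
  -- A closed convex cone that contains every `y ⊗ y`, hence also the mean of such operators.
  let s : Set (H →L[ℂ] H) :=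
    {A | IsCompactOperator A} ∩ {A | IsSelfAdjoint A} ∩ {A | ∀ v, 0 ≤ (inner ℂ v (A v)).re}
  have hpos : ∀ (c : ℝ), 0 ≤ c → ∀ A ∈ s, (c : ℂ) • A ∈ s := fun c hc A hA => by
    refine ⟨⟨hA.1.1.smul (c : ℂ), IsSelfAdjoint.smul (by simp [IsSelfAdjoint]) hA.1.2⟩,
      fun v => ?_⟩
    rw [_root_.smul_apply, inner_smul_right, Complex.re_ofReal_mul]
    exact mul_nonneg hc (hA.2 v)
  have hadd : ∀ A ∈ s, ∀ B ∈ s, A + B ∈ s := fun A hA B hB =>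
    ⟨⟨hA.1.1.add hB.1.1, hA.1.2.add hB.1.2⟩, fun v => by
      rw [_root_.add_apply, inner_add_right, Complex.add_re]
      exact add_nonneg (hA.2 v) (hB.2 v)⟩
  have hconv : Convex ℝ s := fun A hA B hB a b ha hb _ => by
    rw [← Complex.coe_smul, ← Complex.coe_smul]
    exact hadd _ (hpos a ha A hA) _ (hpos b hb B hB)
  have hclosed : IsClosed s := by
    refine (isClosed_setOfPred_isCompactOperator.inter ?_).inter ?_
    · exact isClosed_eq continuous_star continuous_id
    · simp only [Set.ofPred_forall]
      refine isClosed_iInter fun v => ?_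
      refine isClosed_le continuous_const (Complex.continuous_re.comp ?_)
      exact continuous_const.inner (ContinuousLinearMap.apply ℂ H v).continuous
  have hzero : (0 : H →L[ℂ] H) ∈ s := by
    refine ⟨⟨isCompactOperator_zero, IsSelfAdjoint.zero _⟩, fun v => by simp⟩
  have hmem : G ∈ s := by
    rw [h3]
    -- Otherwise the integral is zero by convention, and zero lies in `s`; integrability need not be
    -- decided.
    by_cases hi : Integrable (fun ω => ∑' p : ℕ × ℕ, rankOne ℂ (x p.1 ω) (x p.2 ω)) P
    · refine hconv.integral_mem hclosed ?_ hi
      have hs : ∀ᵐ ω ∂P, ∀ k : ℕ, HasSum (fun i => shiftDiff P ε g i k ω) (shiftProcess g ε k ω) :=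
        ae_all_iff.2 fun k => hX.ae_hasSum_shiftDiff k
      have hsn : ∀ᵐ ω ∂P, Summable fun k => ‖x k ω‖ := by
        have hm : ∀ k, AEMeasurable (fun ω => ‖x k ω‖ₑ) P := fun k =>
          (((hX.integrable_shiftDiff k k).aestronglyMeasurable).const_smul _).enorm
        have hlt : ∫⁻ ω, ∑' k, ‖x k ω‖ₑ ∂P < ∞ := by
          rw [lintegral_tsum hm]
          refine lt_of_le_of_lt (ENNReal.tsum_le_tsum fun k => ?_) hX.summable_coeff
          have : ∀ ω, ‖x k ω‖ₑ = ‖shiftDiff P ε g k k ω‖ₑ := fun ω => by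
            rw [← ofReal_norm, ← ofReal_norm]; simp only [x, norm_smul, hexp, one_mul]
          simp_rw [this]
          rw [← eLpNorm_one_eq_lintegral_enorm]
          exact (eLpNorm_le_eLpNorm_of_exponent_le (by norm_num)
            (hX.integrable_shiftDiff k k).aestronglyMeasurable).trans
            (hX.eLpNorm_shiftDiff_le k k)
        filter_upwards [ae_lt_top' (AEMeasurable.tsum hm) hlt.ne] with ω hω
        have := NNReal.summable_coe.2 (ENNReal.tsum_coe_ne_top_iff_summable.1 hω.ne)
        simpa using this
      filter_upwards [hsn] with ω hω
      rw [(hasSum_rankOne hω hω hω.of_norm.hasSum hω.of_norm.hasSum).tsum_eq]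
      refine ⟨⟨isCompactOperator_rankOne _ _,
        ContinuousLinearMap.isSelfAdjoint_iff_isSymmetric.2 (isSymmetric_rankOne_self _)⟩,
        fun v => ?_⟩
      rw [rankOne_apply, inner_smul_right, ← inner_conj_symm, ← Complex.normSq_eq_conj_mul_self,
        Complex.ofReal_re]
      exact Complex.normSq_nonneg _
    · rw [integral_undef hi]; exact hzero
  have hfin : spectralDensityOp P (shiftProcess g ε) θ ∈ s := by
    have := hpos (1 / (2 * Real.pi)) (by positivity) G hmem
    rw [spectralDensityOp, ← hG]
    push_cast at this
    exact this
  exact ⟨hfin.1.1, hfin.1.2, hfin.2⟩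

end DependenceCondition

end SpectralDensity


/-! ### Lag window sums: off-diagonal bound and diagonal limit -/

section LagWindow

open InnerProductSpace

/-- The coefficient `w(bh) e^{iθh}` of the lag window estimator. -/
noncomputable def winCoeff (w : ℝ → ℝ) (b θ : ℝ) (h : ℤ) : ℂ :=
  (w (b * h) : ℂ) * Complex.exp (Complex.I * θ * h)

lemma norm_exp_I_mul_int (θ : ℝ) (h : ℤ) : ‖Complex.exp (Complex.I * θ * h)‖ = 1 := by
  rw [Complex.norm_exp]; simp

lemma norm_winCoeff (w : ℝ → ℝ) (b θ : ℝ) (h : ℤ) : ‖winCoeff w b θ h‖ = |w (b * h)| := by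
  rw [winCoeff, norm_mul, norm_exp_I_mul_int, mul_one, Complex.norm_real, Real.norm_eq_abs]

lemma sum_norm_winCoeff_sq_le {w : ℝ → ℝ} {b : ℝ} (hs : Summable fun h : ℤ => w (b * h) ^ 2)
    (θ : ℝ) (V : Finset ℤ) {f : ℤ → ℤ} (hf : Function.Injective f) :
    ∑ v ∈ V, ‖winCoeff w b θ (f v)‖ ^ 2 ≤ ∑' h : ℤ, w (b * h) ^ 2 := by
  simp_rw [norm_winCoeff, sq_abs]
  rw [← Finset.sum_image (f := fun h : ℤ => w (b * h) ^ 2) (g := f) hf.injOn]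
  exact hs.sum_le_tsum _ fun _ _ => sq_nonneg _

/-- Any `κ` strictly above `∫ w²` eventually dominates the Riemann sums that converge to it. -/
lemma IsWindow.eventually_mul_tsum_le {w : ℝ → ℝ} (hw : IsWindow w) :
    ∃ κ : ℝ, 0 ≤ κ ∧ ∀ᶠ b in 𝓝[>] (0 : ℝ), Summable (fun h : ℤ => w (b * h) ^ 2) ∧
      b * ∑' h : ℤ, w (b * h) ^ 2 ≤ κ := by
  obtain ⟨κ, hκ, hκ'⟩ := ENNReal.lt_iff_exists_nnreal_btwn.1 hw.sq_integrable
  refine ⟨κ, κ.2, ?_⟩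
  filter_upwards [hw.tendsto_riemann.eventually_lt_const hκ, self_mem_nhdsWithin] with b hb hb0
  have hb0 : 0 < b := hb0
  have hne : ∑' h : ℤ, ENNReal.ofReal (w (b * h) ^ 2) ≠ ∞ := fun h => by
    rw [h, ENNReal.mul_top (by simpa using hb0)] at hb
    exact not_top_lt hb
  have hs : Summable fun h : ℤ => w (b * h) ^ 2 := by
    have := ENNReal.summable_toReal hne
    simpa only [ENNReal.toReal_ofReal (sq_nonneg _)] using this
  refine ⟨hs, ?_⟩
  rw [← ENNReal.ofReal_tsum_of_nonneg (fun _ => sq_nonneg _) hs, ← ENNReal.ofReal_mul hb0.le] at hb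
  have h2 := (ENNReal.ofReal_lt_iff_lt_toReal
    (mul_nonneg hb0.le (tsum_nonneg fun _ => sq_nonneg _)) ENNReal.coe_ne_top).1 hb
  simpa using h2.le

variable {Ω S H : Type*} [MeasurableSpace Ω] [MeasurableSpace S] {P : Measure Ω}
  [IsProbabilityMeasure P] {ε ε' : ℤ → Ω → S}
  [NormedAddCommGroup H] [InnerProductSpace ℂ H] [CompleteSpace H]
  [TopologicalSpace.SeparableSpace H] {g : (ℕ → S) → H}

/-- The double sum `∑_{s,t=1}^T w(b(t-s)) e^{iθ(t-s)} Y_s ⊗ Z_t`. -/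
noncomputable def lagSum (w : ℝ → ℝ) (b θ : ℝ) (T : ℕ) (Y Z : ℤ → H) : H →L[ℂ] H :=
  ∑ s ∈ Finset.Icc (1 : ℤ) T, ∑ t ∈ Finset.Icc (1 : ℤ) T,
    winCoeff w b θ (t - s) • rankOne ℂ (Y s) (Z t)

/-- The times `u` for which both `u + k` and `u + l` lie in `{1, …, T}`. -/
noncomputable def diagRange (T k l : ℕ) : Finset ℤ :=
  Finset.Icc (1 - k : ℤ) (T - k) ∩ Finset.Icc (1 - l : ℤ) (T - l)

lemma card_diagRange_le (T k l : ℕ) : (diagRange T k l).card ≤ T := by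
  refine (Finset.card_le_card Finset.inter_subset_left).trans ?_
  rw [Int.card_Icc]; omega

lemma sum_Icc_shift {M : Type*} [AddCommMonoid M] (T : ℕ) (k : ℤ) (f : ℤ → M) :
    ∑ s ∈ Finset.Icc (1 : ℤ) T, f s = ∑ u ∈ Finset.Icc (1 - k) (T - k), f (u + k) := by
  refine Finset.sum_nbij' (fun s => s - k) (fun u => u + k) ?_ ?_ ?_ ?_ ?_ <;>
    intro a <;> simp [Finset.mem_Icc] <;> omega

/-- The admissible `u` run from `1 - min k l` to `T - max k l`; the truncated subtraction makes the
range empty when there are none. -/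
lemma sum_diagRange {M : Type*} [AddCommMonoid M] (T k l : ℕ) (f : ℤ → M) :
    ∑ u ∈ diagRange T k l, f u =
      ∑ i ∈ Finset.range (T - (max k l - min k l)), f (1 - (min k l : ℕ) + i) := by
  refine Finset.sum_nbij' (fun s => (s - (1 - (min k l : ℕ))).toNat)
    (fun i => 1 - (min k l : ℕ) + i) ?_ ?_ ?_ ?_ ?_
  · intro a; simp only [diagRange, Finset.mem_inter, Finset.mem_Icc, Finset.mem_range]; omega
  · intro a; simp only [diagRange, Finset.mem_inter, Finset.mem_Icc, Finset.mem_range]; omega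
  · intro a; simp only [diagRange, Finset.mem_inter, Finset.mem_Icc]; omega
  · intro a; simp only [Finset.mem_range]; omega
  · intro a; simp only [diagRange, Finset.mem_inter, Finset.mem_Icc]; intro h
    congr 1; omega

namespace DependenceCondition

variable (hX : DependenceCondition P 4 g ε ε')

include hX

/-- With `s = u + k` and `t = v + l` the double sum is a quadratic form in reversed martingale
differences. Its coefficient is constant along `u = v`, and every row and column has square sum at
most `∑_h w(bh)²`. -/
lemma integral_norm_lagSum_sub_diag_le {w : ℝ → ℝ} {b : ℝ}
    (hs : Summable fun h : ℤ => w (b * h) ^ 2) (θ : ℝ) (T k l : ℕ) :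
    ∫ ω, ‖lagSum w b θ T (fun s => shiftDiff P ε g k s ω) (fun t => shiftDiff P ε g l t ω) -
        winCoeff w b θ (l - k) • ∑ u ∈ diagRange T k l, diagProduct P ε g k l u ω‖ ∂P ≤
      4 * (hX.bound k * hX.bound l) * √(T * ∑' h : ℤ, w (b * h) ^ 2) := by
  have h := integral_norm_offDiag_le (𝓕 := fun u => innovSigma ε (Set.Ici u))
    (fun u => innovSigma_le hX.innovations.measurable _)
    (fun u v huv => innovSigma_mono (Set.Ici_subset_Ici.2 huv))
    (hX.isReverseDiff k) (hX.isReverseDiff l)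
    (Finset.Icc (1 - k : ℤ) (T - k)) (Finset.Icc (1 - l : ℤ) (T - l))
    (fun u v => winCoeff w b θ (v + l - (u + k))) (tsum_nonneg fun _ => sq_nonneg _)
    (fun u => sum_norm_winCoeff_sq_le hs θ _ (f := fun v => v + l - (u + k))
      fun a b hab => by simpa using hab)
    (fun v => sum_norm_winCoeff_sq_le hs θ _ (f := fun u => v + l - (u + k))
      fun a b hab => by simpa using hab)
  have hc : ∀ k : ℕ, (Finset.Icc (1 - k : ℤ) (T - k)).card = T := fun k => by
    rw [Int.card_Icc]; omega
  rw [hc, hc] at h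
  refine le_trans (le_of_eq ?_) (h.trans (le_of_eq (by ring)))
  refine integral_congr_ae (Eventually.of_forall fun ω => ?_)
  have h1 : lagSum w b θ T (fun s => shiftDiff P ε g k s ω) (fun t => shiftDiff P ε g l t ω) =
      ∑ u ∈ Finset.Icc (1 - k : ℤ) (T - k), ∑ v ∈ Finset.Icc (1 - l : ℤ) (T - l),
        winCoeff w b θ (v + l - (u + k)) •
          rankOne ℂ (shiftDiff P ε g k (u + k) ω) (shiftDiff P ε g l (v + l) ω) := by
    rw [lagSum, sum_Icc_shift T k]
    exact Finset.sum_congr rfl fun u _ => sum_Icc_shift T l _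
  have h2 : winCoeff w b θ (l - k) • ∑ u ∈ diagRange T k l, diagProduct P ε g k l u ω =
      ∑ u ∈ Finset.Icc (1 - k : ℤ) (T - k) ∩ Finset.Icc (1 - l : ℤ) (T - l),
        winCoeff w b θ (u + l - (u + k)) •
          rankOne ℂ (shiftDiff P ε g k (u + k) ω) (shiftDiff P ε g l (u + l) ω) := by
    rw [Finset.smul_sum, diagRange]
    refine Finset.sum_congr rfl fun u _ => ?_
    rw [add_sub_add_left_eq_sub, diagProduct]
  simp only [h1, h2]

lemma integrable_sum_diagProduct (T k l : ℕ) :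
    Integrable (fun ω => ∑ u ∈ diagRange T k l, diagProduct P ε g k l u ω) P :=
  integrable_finsetSum _ fun u _ => hX.integrable_diagProduct k l u

/-- Uniform in `T`: it supplies the majorant for dominated convergence over `(k, l)`. -/
lemma integral_norm_diag_sub_le (T k l : ℕ) :
    ∫ ω, ‖(T : ℝ)⁻¹ • ∑ u ∈ diagRange T k l, diagProduct P ε g k l u ω -
      crossMoment P ε g k l‖ ∂P ≤ 2 * (hX.bound k * hX.bound l) := by
  set B := hX.bound k * hX.bound l with hB
  have hB0 : 0 ≤ B := mul_nonneg (hX.bound_nonneg k) (hX.bound_nonneg l)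
  have hi := fun u => (hX.integrable_diagProduct k l u).norm
  have hle : ∀ ω, ‖(T : ℝ)⁻¹ • ∑ u ∈ diagRange T k l, diagProduct P ε g k l u ω -
      crossMoment P ε g k l‖ ≤
      (T : ℝ)⁻¹ * ∑ u ∈ diagRange T k l, ‖diagProduct P ε g k l u ω‖ + B := fun ω => by
    refine (norm_sub_le _ _).trans (add_le_add ?_ (hX.norm_crossMoment_le k l))
    rw [norm_smul, Real.norm_of_nonneg (by positivity)]
    gcongr
    exact norm_sum_le _ _
  have hint : Integrable (fun ω => (T : ℝ)⁻¹ * ∑ u ∈ diagRange T k l,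
      ‖diagProduct P ε g k l u ω‖) P := (integrable_finsetSum _ fun u _ => hi u).const_mul _
  refine (integral_mono_of_nonneg (Eventually.of_forall fun _ => norm_nonneg _)
    (hint.add (integrable_const B)) (Eventually.of_forall hle)).trans ?_
  rw [integral_add' hint (integrable_const B), integral_const_mul,
    integral_finsetSum _ fun u _ => hi u]
  have h1 : ∑ u ∈ diagRange T k l, ∫ ω, ‖diagProduct P ε g k l u ω‖ ∂P ≤ T * B :=
    (Finset.sum_le_card_nsmul _ _ B fun u _ =>
      hX.integral_norm_rankOne_shiftDiff_le k l _ _).trans (by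
        rw [nsmul_eq_mul]; gcongr; exact card_diagRange_le T k l)
  have h2 : (T : ℝ)⁻¹ * (T * B) ≤ B := by
    rw [← mul_assoc]
    exact mul_le_of_le_one_left hB0 (inv_mul_le_one)
  have h3 := (mul_le_mul_of_nonneg_left h1 (by positivity : 0 ≤ (T : ℝ)⁻¹)).trans h2
  simp only [integral_const, probReal_univ, smul_eq_mul, one_mul]
  linarith

/-- Only `T - |k - l|` terms are present; dividing by `T` instead costs `|k - l| / T` times the
limit. -/
lemma tendsto_integral_norm_diag_sub (k l : ℕ) :
    Tendsto (fun T : ℕ => ∫ ω, ‖(T : ℝ)⁻¹ • ∑ u ∈ diagRange T k l, diagProduct P ε g k l u ω -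
      crossMoment P ε g k l‖ ∂P) atTop (𝓝 0) := by
  set d := max k l - min k l with hd
  have h1 := (hX.tendsto_average_diagProduct k l (1 - (min k l : ℕ))).comp (tendsto_sub_atTop_nat d)
  have h2 : Tendsto (fun T : ℕ => (d / T : ℝ) * ‖crossMoment P ε g k l‖) atTop (𝓝 0) := by
    simpa using (tendsto_const_div_atTop_nhds_zero_nat (d : ℝ)).mul_const
      ‖crossMoment P ε g k l‖
  have h3 := h1.add h2
  rw [add_zero] at h3
  refine squeeze_zero' (Eventually.of_forall fun T => integral_nonneg fun _ => norm_nonneg _) ?_ h3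
  filter_upwards [eventually_gt_atTop d] with T hT
  have hT0 : (0 : ℝ) < T := by exact_mod_cast (Nat.zero_le d).trans_lt hT
  have hN0 : (0 : ℝ) < (T - d : ℕ) := by exact_mod_cast Nat.sub_pos_of_lt hT
  have hN : ((T - d : ℕ) : ℝ) = T - d := Nat.cast_sub hT.le
  have hi : Integrable (fun ω => ((T - d : ℕ) : ℝ)⁻¹ • ∑ i ∈ Finset.range (T - d),
      diagProduct P ε g k l (1 - (min k l : ℕ) + i) ω - crossMoment P ε g k l) P :=
    ((integrable_finsetSum _ fun i _ => hX.integrable_diagProduct k l _).fun_smul _).sub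
      (integrable_const _)
  refine (integral_mono_of_nonneg (Eventually.of_forall fun _ => norm_nonneg _)
    (hi.norm.add (integrable_const ((d / T : ℝ) * ‖crossMoment P ε g k l‖)))
    (Eventually.of_forall fun ω => ?_)).trans (le_of_eq ?_)
  · simp only [Pi.add_apply]
    rw [sum_diagRange, ← hd]
    set Z := ∑ i ∈ Finset.range (T - d), diagProduct P ε g k l (1 - (min k l : ℕ) + i) ω
    have e : (T : ℝ)⁻¹ • Z - crossMoment P ε g k l =
        (((T - d : ℕ) : ℝ) / T) • (((T - d : ℕ) : ℝ)⁻¹ • Z - crossMoment P ε g k l) -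
          (d / T : ℝ) • crossMoment P ε g k l := by
      rw [smul_sub, smul_smul, sub_sub, ← add_smul]
      congr 1
      · congr 1; field_simp
      · rw [hN, ← add_div, sub_add_cancel, div_self hT0.ne', one_smul]
    rw [e]
    refine (norm_sub_le _ _).trans (add_le_add ?_ ?_)
    · rw [norm_smul]
      refine mul_le_of_le_one_left (norm_nonneg _) ?_
      rw [Real.norm_of_nonneg (by positivity), div_le_one hT0, hN]
      simp
    · rw [norm_smul, Real.norm_of_nonneg (by positivity)]
  · rw [Pi.add_def, integral_add hi.norm (integrable_const _)]
    simp [d]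

end DependenceCondition

end LagWindow


/-! ### Mean convergence of the estimator in operator norm -/

section Consistency

open InnerProductSpace

variable {Ω S H : Type*} [MeasurableSpace Ω] [MeasurableSpace S] {P : Measure Ω}
  [IsProbabilityMeasure P] {ε ε' : ℤ → Ω → S}
  [NormedAddCommGroup H] [InnerProductSpace ℂ H] [CompleteSpace H]
  [TopologicalSpace.SeparableSpace H] {g : (ℕ → S) → H}

lemma hasSum_lagSum {w : ℝ → ℝ} {b θ : ℝ} {T : ℕ} {x : ℕ → ℤ → H} {X : ℤ → H}
    (hx : ∀ t, Summable fun k => ‖x k t‖) (hX : ∀ t, HasSum (fun k => x k t) (X t)) :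
    HasSum (fun p : ℕ × ℕ => lagSum w b θ T (x p.1) (x p.2)) (lagSum w b θ T X X) :=
  hasSum_sum fun s _ => hasSum_sum fun t _ =>
    (hasSum_rankOne (hx s) (hx t) (hX s) (hX t)).const_smul _

/-- The deviation of the `(k, l)` component of the lag window estimator from its limit. -/
noncomputable def lagDev (P : Measure Ω) (ε : ℤ → Ω → S) (g : (ℕ → S) → H) (w : ℝ → ℝ) (b θ : ℝ)
    (T : ℕ) (p : ℕ × ℕ) (ω : Ω) : H →L[ℂ] H :=
  (T : ℝ)⁻¹ • lagSum w b θ T (fun s => shiftDiff P ε g p.1 s ω)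
      (fun t => shiftDiff P ε g p.2 t ω) -
    Complex.exp (Complex.I * θ * ((p.2 : ℤ) - p.1 : ℤ)) • crossMoment P ε g p.1 p.2

namespace DependenceCondition

variable (hX : DependenceCondition P 4 g ε ε')

include hX

lemma integrable_lagSum_shiftDiff (w : ℝ → ℝ) (b θ : ℝ) (T k l : ℕ) :
    Integrable (fun ω => lagSum w b θ T (fun s => shiftDiff P ε g k s ω)
      (fun t => shiftDiff P ε g l t ω)) P :=
  integrable_finsetSum _ fun s _ => integrable_finsetSum _ fun t _ =>
    (hX.integrable_rankOne_shiftDiff k l s t).fun_smul _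

lemma integrable_lagDev (w : ℝ → ℝ) (b θ : ℝ) (T : ℕ) (p : ℕ × ℕ) :
    Integrable (lagDev P ε g w b θ T p) P :=
  ((hX.integrable_lagSum_shiftDiff w b θ T p.1 p.2).fun_smul _).sub (integrable_const _)

/-- The three terms are the off-diagonal part, the error in the law of large numbers on the
diagonal, and the effect of replacing `w(b(l-k))` by 1. -/
lemma integral_norm_lagDev_le {w : ℝ → ℝ} {b κ : ℝ} (hb : 0 < b)
    (hs : Summable fun h : ℤ => w (b * h) ^ 2) (hκ : b * ∑' h : ℤ, w (b * h) ^ 2 ≤ κ)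
    (θ : ℝ) {T : ℕ} (hT : 0 < T) (p : ℕ × ℕ) :
    ∫ ω, ‖lagDev P ε g w b θ T p ω‖ ∂P ≤
      4 * (hX.bound p.1 * hX.bound p.2) * √(κ / (b * T)) +
      |w (b * (p.2 - p.1 : ℤ))| * ∫ ω, ‖(T : ℝ)⁻¹ • ∑ u ∈ diagRange T p.1 p.2,
        diagProduct P ε g p.1 p.2 u ω - crossMoment P ε g p.1 p.2‖ ∂P +
      |w (b * (p.2 - p.1 : ℤ)) - 1| * (hX.bound p.1 * hX.bound p.2) := by
  obtain ⟨k, l⟩ := p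
  simp only
  set B := hX.bound k * hX.bound l with hB
  have hB0 : 0 ≤ B := mul_nonneg (hX.bound_nonneg k) (hX.bound_nonneg l)
  have hT0 : (0 : ℝ) < T := by exact_mod_cast hT
  set c := winCoeff w b θ (l - k) with hc
  set Q : Ω → H →L[ℂ] H := fun ω => lagSum w b θ T (fun s => shiftDiff P ε g k s ω)
    (fun t => shiftDiff P ε g l t ω) with hQ
  set D : Ω → H →L[ℂ] H := fun ω => ∑ u ∈ diagRange T k l, diagProduct P ε g k l u ω with hD
  set M := crossMoment P ε g k l with hM
  have hQi : Integrable Q P := hX.integrable_lagSum_shiftDiff w b θ T k l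
  have hDi : Integrable D P := hX.integrable_sum_diagProduct T k l
  have h1 : Integrable (fun ω => (T : ℝ)⁻¹ * ‖Q ω - c • D ω‖) P :=
    (hQi.sub (hDi.fun_smul c)).norm.const_mul _
  have h2 : Integrable (fun ω => ‖c‖ * ‖(T : ℝ)⁻¹ • D ω - M‖) P :=
    ((hDi.fun_smul _).sub (integrable_const M)).norm.const_mul _
  have hz : ‖c - Complex.exp (Complex.I * θ * ((l : ℤ) - k : ℤ))‖ =
      |w (b * (l - k : ℤ)) - 1| := by
    have : c - Complex.exp (Complex.I * θ * ((l : ℤ) - k : ℤ)) =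
        ((w (b * (l - k : ℤ)) - 1 : ℝ) : ℂ) * Complex.exp (Complex.I * θ * ((l : ℤ) - k : ℤ)) := by
      rw [hc, winCoeff, Complex.ofReal_sub, Complex.ofReal_one, sub_mul, one_mul]
    rw [this, norm_mul, norm_exp_I_mul_int, mul_one, Complex.norm_real, Real.norm_eq_abs]
  have hle : ∀ ω, ‖lagDev P ε g w b θ T (k, l) ω‖ ≤
      (T : ℝ)⁻¹ * ‖Q ω - c • D ω‖ + ‖c‖ * ‖(T : ℝ)⁻¹ • D ω - M‖ +
        |w (b * (l - k : ℤ)) - 1| * B := fun ω => by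
    have e : lagDev P ε g w b θ T (k, l) ω = (T : ℝ)⁻¹ • (Q ω - c • D ω) +
        c • ((T : ℝ)⁻¹ • D ω - M) +
        (c - Complex.exp (Complex.I * θ * ((l : ℤ) - k : ℤ))) • M := by
      rw [smul_sub, smul_sub, sub_smul, smul_comm c (T : ℝ)⁻¹ (D ω)]
      simp only [lagDev, hQ, hM]
      abel
    rw [e]
    refine (norm_add₃_le).trans (add_le_add (add_le_add ?_ ?_) ?_)
    · rw [norm_smul, Real.norm_of_nonneg (by positivity)]
    · rw [norm_smul]
    · rw [norm_smul, hz]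
      exact mul_le_mul_of_nonneg_left (hX.norm_crossMoment_le k l) (abs_nonneg _)
  refine (integral_mono_of_nonneg (Eventually.of_forall fun _ => norm_nonneg _)
    ((h1.add h2).add (integrable_const _)) (Eventually.of_forall hle)).trans ?_
  rw [integral_add' (h1.add h2) (integrable_const _), integral_add' h1 h2, integral_const_mul,
    integral_const_mul]
  simp only [integral_const, probReal_univ, smul_eq_mul, one_mul]
  rw [hc, norm_winCoeff]
  refine add_le_add (add_le_add ?_ le_rfl) le_rfl
  set W := ∑' h : ℤ, w (b * h) ^ 2
  have h3 := mul_le_mul_of_nonneg_left (hX.integral_norm_lagSum_sub_diag_le hs θ T k l)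
    (by positivity : 0 ≤ (T : ℝ)⁻¹)
  refine h3.trans ?_
  have h4 : (T : ℝ)⁻¹ * √(T * W) ≤ √(κ / (b * T)) := by
    have : (T : ℝ)⁻¹ = √((T : ℝ)⁻¹ ^ 2) := (Real.sqrt_sq (by positivity)).symm
    rw [this, ← Real.sqrt_mul (by positivity)]
    refine Real.sqrt_le_sqrt ?_
    rw [le_div_iff₀ (by positivity)]
    calc (T : ℝ)⁻¹ ^ 2 * (T * W) * (b * T) = b * W := by field_simp
      _ ≤ κ := hκ
  calc (T : ℝ)⁻¹ * (4 * B * √(T * W)) = 4 * B * ((T : ℝ)⁻¹ * √(T * W)) := by ring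
    _ ≤ _ := mul_le_mul_of_nonneg_left h4 (by positivity)

variable {w : ℝ → ℝ} {b : ℕ → ℝ}

/-- Dominated convergence over `(k, l)`: for each pair all three error terms vanish, and boundedness
of `w` together with `b T * T ≥ 1` dominates them by a multiple of `ν_k ν_l`. -/
lemma tendsto_tsum_integral_norm_lagDev (hw : IsWindow w) (hb : Tendsto b atTop (𝓝 0))
    (hbT : Tendsto (fun T : ℕ => b T * T) atTop atTop) (θ : ℝ) :
    Tendsto (fun T => ∑' p, ∫ ω, ‖lagDev P ε g w (b T) θ T p ω‖ ∂P) atTop (𝓝 0) ∧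
    ∀ᶠ T in atTop, Summable fun p => ∫ ω, ‖lagDev P ε g w (b T) θ T p ω‖ ∂P := by
  obtain ⟨κ, hκ0, hκ⟩ := hw.eventually_mul_tsum_le
  obtain ⟨M, hM⟩ := hw.bounded
  have hM0 : 0 ≤ M := (abs_nonneg _).trans (hM 0)
  -- Positivity of the bandwidth is not assumed; it follows eventually from `b T * T → ∞`.
  have hpos : ∀ᶠ T : ℕ in atTop, 0 < b T ∧ 0 < T ∧ 1 ≤ b T * T := by
    filter_upwards [hbT.eventually_ge_atTop 1, eventually_gt_atTop 0] with T h1 hT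
    exact ⟨pos_of_mul_pos_left (zero_lt_one.trans_le h1) (Nat.cast_nonneg T), hT, h1⟩
  have hb' : Tendsto b atTop (𝓝[>] 0) :=
    tendsto_nhdsWithin_iff.2 ⟨hb, hpos.mono fun T h => h.1⟩
  have hwin := hb'.eventually hκ
  have hmain : ∀ᶠ T : ℕ in atTop, ∀ p : ℕ × ℕ, ∫ ω, ‖lagDev P ε g w (b T) θ T p ω‖ ∂P ≤
      4 * (hX.bound p.1 * hX.bound p.2) * √(κ / (b T * T)) +
      |w (b T * (p.2 - p.1 : ℤ))| * ∫ ω, ‖(T : ℝ)⁻¹ • ∑ u ∈ diagRange T p.1 p.2,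
        diagProduct P ε g p.1 p.2 u ω - crossMoment P ε g p.1 p.2‖ ∂P +
      |w (b T * (p.2 - p.1 : ℤ)) - 1| * (hX.bound p.1 * hX.bound p.2) := by
    filter_upwards [hpos, hwin] with T h1 h2 p
    exact hX.integral_norm_lagDev_le h1.1 h2.1 h2.2 θ h1.2.1 p
  have hdom : ∀ᶠ T : ℕ in atTop, ∀ p : ℕ × ℕ, ‖∫ ω, ‖lagDev P ε g w (b T) θ T p ω‖ ∂P‖ ≤
      (4 * √κ + 2 * M + (M + 1)) * (hX.bound p.1 * hX.bound p.2) := by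
    filter_upwards [hmain, hpos] with T h1 h2 p
    have hB0 : 0 ≤ hX.bound p.1 * hX.bound p.2 :=
      mul_nonneg (hX.bound_nonneg p.1) (hX.bound_nonneg p.2)
    rw [Real.norm_of_nonneg (integral_nonneg fun _ => norm_nonneg _)]
    refine (h1 p).trans ?_
    have h3 : √(κ / (b T * T)) ≤ √κ := Real.sqrt_le_sqrt (div_le_self hκ0 h2.2.2)
    have h4 := mul_le_mul (hM (b T * (p.2 - p.1 : ℤ))) (hX.integral_norm_diag_sub_le T p.1 p.2)
      (integral_nonneg fun _ => norm_nonneg _) hM0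
    have h5 : |w (b T * (p.2 - p.1 : ℤ)) - 1| ≤ M + 1 :=
      (abs_sub _ _).trans (add_le_add (hM _) (by simp))
    have h6 := mul_le_mul_of_nonneg_right h5 hB0
    have h7 := mul_le_mul_of_nonneg_left h3 (by positivity :
      0 ≤ 4 * (hX.bound p.1 * hX.bound p.2))
    linarith
  have hsum : Summable fun p : ℕ × ℕ =>
      (4 * √κ + 2 * M + (M + 1)) * (hX.bound p.1 * hX.bound p.2) :=
    hX.summable_bound_mul.mul_left _
  have hptw : ∀ p : ℕ × ℕ, Tendsto (fun T => ∫ ω, ‖lagDev P ε g w (b T) θ T p ω‖ ∂P) atTop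
      (𝓝 0) := fun p => by
    have hw1 : Tendsto (fun T => w (b T * (p.2 - p.1 : ℤ))) atTop (𝓝 1) := by
      refine hw.tendsto_zero.comp ?_
      simpa using hb.mul_const (((p.2 - p.1 : ℤ) : ℝ))
    have t1 : Tendsto (fun T : ℕ => √(κ / (b T * T))) atTop (𝓝 0) := by
      have := (hbT.const_div_atTop κ).sqrt
      rwa [Real.sqrt_zero] at this
    have t2 := (hw1.abs).mul (hX.tendsto_integral_norm_diag_sub p.1 p.2)
    have t3 := ((hw1.sub_const 1).abs).mul_const (hX.bound p.1 * hX.bound p.2)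
    have t := ((t1.const_mul (4 * (hX.bound p.1 * hX.bound p.2))).add t2).add t3
    simp only [mul_zero, sub_self, abs_zero, zero_mul, add_zero] at t
    exact squeeze_zero' (Eventually.of_forall fun T => integral_nonneg fun _ => norm_nonneg _)
      (hmain.mono fun T h => h p) t
  refine ⟨?_, ?_⟩
  · have := tendsto_tsum_of_dominated_convergence hsum hptw hdom
    rwa [tsum_zero] at this
  · filter_upwards [hdom] with T h
    exact hsum.of_norm_bounded h

lemma lintegral_enorm_lagSum_sub_le {w : ℝ → ℝ} {b θ : ℝ} {T : ℕ}
    (hs : Summable fun p => ∫ ω, ‖lagDev P ε g w b θ T p ω‖ ∂P) :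
    ∫⁻ ω, ‖(T : ℝ)⁻¹ • lagSum w b θ T (fun s => shiftProcess g ε s ω)
        (fun t => shiftProcess g ε t ω) -
        ∑' h : ℤ, Complex.exp (-(Complex.I * θ * h)) • covOp P (shiftProcess g ε) h‖ₑ ∂P ≤
      ENNReal.ofReal (∑' p, ∫ ω, ‖lagDev P ε g w b θ T p ω‖ ∂P) := by
  rw [ENNReal.ofReal_tsum_of_nonneg (fun _ => integral_nonneg fun _ => norm_nonneg _) hs]
  simp_rw [fun p => ofReal_integral_norm_eq_lintegral_enorm (hX.integrable_lagDev w b θ T p)]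
  rw [← lintegral_tsum fun p => (hX.integrable_lagDev w b θ T p).aestronglyMeasurable.enorm]
  refine lintegral_mono_ae ?_
  have a1 : ∀ᵐ ω ∂P, ∀ t, HasSum (fun k => shiftDiff P ε g k t ω) (shiftProcess g ε t ω) :=
    ae_all_iff.2 fun t => hX.ae_hasSum_shiftDiff t
  have a2 : ∀ᵐ ω ∂P, ∀ t, Summable fun k => ‖shiftDiff P ε g k t ω‖ :=
    ae_all_iff.2 fun t => hX.ae_summable_norm_shiftDiff t
  filter_upwards [a1, a2] with ω h1 h2
  have h3 := ((hasSum_lagSum (w := w) (b := b) (θ := θ) (T := T) h2 h1).const_smul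
    ((T : ℝ)⁻¹)).sub (hX.hasSum_crossMoment θ)
  rw [← h3.tsum_eq]
  exact enorm_tsum_le_tsum_enorm

end DependenceCondition

lemma spectralEstimator_eq (w : ℝ → ℝ) (b : ℝ) (X : ℤ → Ω → H) (T : ℕ) (θ : ℝ) (ω : Ω) :
    spectralEstimator w b X T θ ω = (1 / (2 * Real.pi) : ℂ) •
      ((T : ℝ)⁻¹ • lagSum w b θ T (fun s => X s ω) (fun t => X t ω)) := by
  rw [← Complex.coe_smul (T : ℝ)⁻¹, smul_smul, spectralEstimator, lagSum]
  congr 1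
  · push_cast; field_simp
  · refine Finset.sum_congr rfl fun s _ => Finset.sum_congr rfl fun t _ => ?_
    rw [winCoeff]; push_cast; rfl

lemma isCompactOperator_spectralEstimator (w : ℝ → ℝ) (b : ℝ) (X : ℤ → Ω → H) (T : ℕ) (θ : ℝ)
    (ω : Ω) : IsCompactOperator (spectralEstimator w b X T θ ω) := by
  have hsum : ∀ (s : Finset ℤ) (f : ℤ → H →L[ℂ] H), (∀ i ∈ s, IsCompactOperator (f i)) →
      IsCompactOperator (∑ i ∈ s, f i : H →L[ℂ] H) := fun s f h =>
    Finset.sum_induction f (fun A : H →L[ℂ] H => IsCompactOperator A) (fun A B hA hB => hA.add hB)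
      isCompactOperator_zero h
  refine IsCompactOperator.smul (hsum _ _ fun s _ => hsum _ _ fun t _ => ?_) _
  exact (isCompactOperator_rankOne _ _).smul _

/-- The adjoint exchanges `s` and `t` and conjugates the exponential; evenness of `w` restores the
coefficient. -/
lemma isSelfAdjoint_spectralEstimator {w : ℝ → ℝ} (hw : ∀ x, w (-x) = w x) (b : ℝ)
    (X : ℤ → Ω → H) (T : ℕ) (θ : ℝ) (ω : Ω) :
    IsSelfAdjoint (spectralEstimator w b X T θ ω) := by
  rw [isSelfAdjoint_iff, spectralEstimator, star_smul, star_sum]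
  congr 1
  · simp
  · simp_rw [star_sum]
    rw [Finset.sum_comm]
    refine Finset.sum_congr rfl fun s _ => Finset.sum_congr rfl fun t _ => ?_
    rw [star_smul, ContinuousLinearMap.star_eq_adjoint, adjoint_rankOne]
    congr 1
    rw [star_mul', Complex.star_def, Complex.conj_ofReal, ← Complex.exp_conj,
      ← neg_sub (t : ℝ) s, mul_neg, hw]
    congr 2
    simp
    ring

variable {w : ℝ → ℝ} {b : ℕ → ℝ}

/-- Markov's inequality applied to the bound in mean; the factor `1 / (2π) ≤ 1` is discarded. -/
lemma DependenceCondition.tendsto_measure_norm_sub (hX : DependenceCondition P 4 g ε ε')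
    (hw : IsWindow w) (hb : Tendsto b atTop (𝓝 0))
    (hbT : Tendsto (fun T : ℕ => b T * T) atTop atTop) (θ : ℝ) {c : ℝ} (hc : 0 < c) :
    Tendsto (fun T : ℕ => P {ω | c ≤ ‖spectralEstimator w (b T) (shiftProcess g ε) T θ ω -
      spectralDensityOp P (shiftProcess g ε) θ‖}) atTop (𝓝 0) := by
  obtain ⟨h1, h2⟩ := hX.tendsto_tsum_integral_norm_lagDev hw hb hbT θ
  have h3 := ENNReal.Tendsto.div_const (ENNReal.tendsto_ofReal h1) (b := ENNReal.ofReal c)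
    (Or.inr (by simpa using hc))
  rw [ENNReal.ofReal_zero, ENNReal.zero_div] at h3
  refine tendsto_of_tendsto_of_tendsto_of_le_of_le' tendsto_const_nhds h3
    (Eventually.of_forall fun _ => zero_le) (h2.mono fun T hT => ?_)
  set G := ∑' h : ℤ, Complex.exp (-(Complex.I * θ * h)) • covOp P (shiftProcess g ε) h with hG
  have hm : AEStronglyMeasurable (fun ω => (T : ℝ)⁻¹ • lagSum w (b T) θ T
      (fun s => shiftProcess g ε s ω) (fun t => shiftProcess g ε t ω) - G) P := by
    refine AEStronglyMeasurable.sub ?_ aestronglyMeasurable_const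
    suffices h : AEStronglyMeasurable (fun ω => lagSum w (b T) θ T
      (fun s => shiftProcess g ε s ω) (fun t => shiftProcess g ε t ω)) P from
      h.fun_const_smul (T : ℝ)⁻¹
    refine Finset.aestronglyMeasurable_fun_sum _ fun s _ =>
      Finset.aestronglyMeasurable_fun_sum _ fun t _ => ?_
    exact (aestronglyMeasurable_rankOne (hX.memLp s).1 (hX.memLp t).1).fun_const_smul
      (winCoeff w (b T) θ (t - s))
  refine le_trans (measure_mono fun ω hω => ?_) ((meas_ge_le_lintegral_div hm.enorm
    (by simpa using hc) ENNReal.ofReal_ne_top).trans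
    (ENNReal.div_le_div_right (hX.lintegral_enorm_lagSum_sub_le hT) _))
  simp only [Set.mem_ofPred_eq] at hω ⊢
  rw [← ofReal_norm]
  refine ENNReal.ofReal_le_ofReal (hω.trans ?_)
  rw [spectralEstimator_eq, spectralDensityOp, ← hG, ← smul_sub, norm_smul]
  refine mul_le_of_le_one_left (norm_nonneg _) ?_
  have : (1 / (2 * Real.pi) : ℂ) = ((1 / (2 * Real.pi) : ℝ) : ℂ) := by push_cast; rfl
  rw [this, Complex.norm_real, Real.norm_of_nonneg (by positivity), div_le_one (by positivity)]
  linarith [Real.pi_gt_three]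

end Consistency


/-! ### From operators to eigenelements -/

section Eigenelements

open InnerProductSpace

variable {Ω H : Type*} [MeasurableSpace Ω] {P : Measure Ω}
  [NormedAddCommGroup H] [InnerProductSpace ℂ H] [CompleteSpace H]

lemma exists_pos_ofReal_le {r : ℝ≥0∞} (hr : 0 < r) : ∃ q : ℝ, 0 < q ∧ ENNReal.ofReal q ≤ r := by
  have h : min r 1 ≠ ∞ := ne_top_of_le_ne_top ENNReal.one_ne_top (min_le_right _ _)
  refine ⟨(min r 1).toReal, ENNReal.toReal_pos (lt_min hr one_pos).ne' h, ?_⟩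
  rw [ENNReal.ofReal_toReal h]
  exact min_le_left _ _

variable {A : H →L[ℂ] H} {B : ℕ → Ω → H →L[ℂ] H} {β : ℕ → ℝ} {φ : ℕ → H}
  {β' : ℕ → Ω → ℕ → ℝ} {φ' : ℕ → Ω → ℕ → H} {j : ℕ}

/-- Eigenvalues are consistent as soon as the operators are. -/
lemma tendstoInMeasure_eigenvalue
    (hB : ∀ c : ℝ, 0 < c → Tendsto (fun T => P {ω | c ≤ ‖B T ω - A‖}) atTop (𝓝 0))
    (h : IsEigensystem A β φ) (h' : ∀ T ω, IsEigensystem (B T ω) (β' T ω) (φ' T ω))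
    (hA : ∀ v, 0 ≤ (inner ℂ v (A v)).re) (hj : j ∈ eigenIndex H) :
    TendstoInMeasure P (fun T ω => β' T ω j) atTop (fun _ => β j) := by
  intro r hr
  obtain ⟨q, hq, hqr⟩ := exists_pos_ofReal_le hr
  -- Only an inclusion of events is used, so the chosen eigenvalues need not be measurable.
  refine tendsto_of_tendsto_of_tendsto_of_le_of_le tendsto_const_nhds (hB (q / 3) (by positivity))
    (fun _ => zero_le) fun T => measure_mono fun ω hω => ?_
  simp only [Set.mem_ofPred_eq] at hω ⊢
  have h1 := hqr.trans hω
  rw [edist_dist, ENNReal.ofReal_le_ofReal_iff dist_nonneg, Real.dist_eq] at h1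
  have h2 := h.abs_sub_le (h' T ω) hA hj
  linarith

/-- Eigenprojectors of isolated eigenvalues are consistent as soon as the operators are. -/
lemma tendsto_measure_hsNorm_eigenprojector {ι : Type*} (χ : HilbertBasis ι ℂ H)
    (hB : ∀ c : ℝ, 0 < c → Tendsto (fun T => P {ω | c ≤ ‖B T ω - A‖}) atTop (𝓝 0))
    (h : IsEigensystem A β φ) (h' : ∀ T ω, IsEigensystem (B T ω) (β' T ω) (φ' T ω))
    (hA : ∀ v, 0 ≤ (inner ℂ v (A v)).re) (hj : j ∈ eigenIndex H)
    (hiso : IsIsolatedEigenvalue H β j) {r : ℝ≥0∞} (hr : 0 < r) :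
    Tendsto (fun T => P {ω | r ≤ hsNorm χ
      (rankOne ℂ (φ' T ω j) (φ' T ω j) - rankOne ℂ (φ j) (φ j))}) atTop (𝓝 0) := by
  obtain ⟨δ, hδ, hgap⟩ := hiso
  obtain ⟨q, hq, hqr⟩ := exists_pos_ofReal_le hr
  refine tendsto_of_tendsto_of_tendsto_of_le_of_le tendsto_const_nhds
    (hB (q * δ / 8) (by positivity))
    (fun _ => zero_le) fun T => measure_mono fun ω hω => ?_
  simp only [Set.mem_ofPred_eq] at hω ⊢
  have h1 := (hqr.trans hω).trans (h.hsNorm_sub_le (h' T ω) hA hj hδ hgap χ)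
  rw [ENNReal.ofReal_rpow_of_nonneg (by positivity) (by norm_num),
    ENNReal.ofReal_le_ofReal_iff (by positivity), ← Real.sqrt_eq_rpow,
    Real.le_sqrt hq.le (by positivity)] at h1
  set x := ‖B T ω - A‖
  have hx : 0 ≤ x := norm_nonneg _
  -- The 8 rounds up the `4√2` of the perturbation bound, and determines the threshold `q * δ / 8`
  -- above.
  have h2 : q ^ 2 ≤ (8 * x / δ) ^ 2 :=
    h1.trans (by rw [div_pow, div_pow, mul_pow, mul_pow]
                 rw [← mul_div_assoc]
                 gcongr ?_ / _
                 nlinarith [sq_nonneg x])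
  have h3 := (pow_le_pow_iff_left₀ hq.le (by positivity) two_ne_zero).1 h2
  rw [le_div_iff₀ hδ] at h3
  linarith

end Eigenelements

end FTS

theorem proposition4p2
    {Ω S H ι : Type*} [MeasurableSpace Ω] [MeasurableSpace S]
    [NormedAddCommGroup H] [InnerProductSpace ℂ H] [CompleteSpace H]
    [TopologicalSpace.SeparableSpace H]
    (P : Measure Ω) [IsProbabilityMeasure P]
    (ε ε' : ℤ → Ω → S) (g : (ℕ → S) → H) (hX : FTS.DependenceCondition P 4 g ε ε')
    (w : ℝ → ℝ) (hw : FTS.IsWindow w)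
    (b : ℕ → ℝ) (hb : Tendsto b atTop (𝓝 0)) (hbT : Tendsto (fun T : ℕ => b T * T) atTop atTop)
    (θ : ℝ) (hθ : θ ∈ Set.Icc 0 Real.pi) (χ : HilbertBasis ι ℂ H) :
    -- the series defining the spectral density operator converges absolutely
    (Summable fun h : ℤ => ‖FTS.covOp P (FTS.shiftProcess g ε) h‖) ∧
    -- both operators have spectral representations
    (∃ (β : ℕ → ℝ) (φ : ℕ → H),
      FTS.IsEigensystem (FTS.spectralDensityOp P (FTS.shiftProcess g ε) θ) β φ) ∧
    (∀ (T : ℕ) (ω : Ω), ∃ (β : ℕ → ℝ) (φ : ℕ → H),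
      FTS.IsEigensystem (FTS.spectralEstimator w (b T) (FTS.shiftProcess g ε) T θ ω) β φ) ∧
    -- and, whichever representations are chosen, the eigenelements are consistent
    ∀ (β : ℕ → ℝ) (φ : ℕ → H) (βhat : ℕ → Ω → ℕ → ℝ) (φhat : ℕ → Ω → ℕ → H),
      FTS.IsEigensystem (FTS.spectralDensityOp P (FTS.shiftProcess g ε) θ) β φ →
      (∀ (T : ℕ) (ω : Ω), FTS.IsEigensystem
        (FTS.spectralEstimator w (b T) (FTS.shiftProcess g ε) T θ ω) (βhat T ω) (φhat T ω)) →
      ∀ j ∈ FTS.eigenIndex H,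
        TendstoInMeasure P (fun T ω => βhat T ω j) atTop (fun _ => β j) ∧
        (FTS.IsIsolatedEigenvalue H β j →
          ∀ r : ℝ≥0∞, 0 < r →
            Tendsto (fun T => P {ω | r ≤ FTS.hsNorm χ
              (InnerProductSpace.rankOne ℂ (φhat T ω j) (φhat T ω j) -
                InnerProductSpace.rankOne ℂ (φ j) (φ j))}) atTop (𝓝 0)) := by
  obtain ⟨hc, hs, hpos⟩ := hX.spectralDensityOp_properties θ
  refine ⟨hX.summable_norm_covOp, FTS.exists_isEigensystem hc hs,
    fun T ω => FTS.exists_isEigensystem (FTS.isCompactOperator_spectralEstimator _ _ _ _ _ _)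
      (FTS.isSelfAdjoint_spectralEstimator hw.even _ _ _ _ _),
    fun β φ βhat φhat h h' j hj => ?_⟩
  have hcons := fun c (hc : 0 < c) => hX.tendsto_measure_norm_sub hw hb hbT θ hc
  exact ⟨FTS.tendstoInMeasure_eigenvalue hcons h h' hpos hj, fun hiso r hr =>
    FTS.tendsto_measure_hsNorm_eigenprojector χ hcons h h' hpos hj hiso hr⟩
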